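/- **Setting.** Let $\omega\subset\mathbb{R}^2$ be a bounded Lipschitz domain and let $\gamma=b([\alpha,\beta])$, $\alpha<\beta$, be a piecewise $C^1$ curve with continuous arclength parametrization $b$ ($|b'|=1$) and $b(t)\in\omega$ for $\alpha<t<\beta$, such that $\omega\setminus\gamma=\omega_1\cup\omega_2$ with two disjoint Lipschitz domains $\omega_1,\omega_2$. Let $$V=\{v\in H^2(\omega\setminus\gamma;\mathbb{R}^3)\cap W^{1,\infty}(\omega;\mathbb{R}^3):(\nabla v)^{\sf T}\nabla v=I_{2\times2}\ \text{a.e.}\}.$$ For each $m\in\mathbb{N}$ let $\alpha=t_0<\dots<t_{N_m}=\beta$ be a partition, let $c_j=b(t_j)$ be the vertices of the interpolating polygonal curve $\gamma_m$ (the $t_j$ and $c_j$ depend on $m$), and let $\mathcal{T}_m$ be a conforming triangulation of $\overline\omega$ such that every segment $[c_{j-1},c_j]$ is an edge of $\mathcal{T}_m$. The family $(\mathcal{T}_m)$ is uniformly shape regular and its maximal mesh size tends to zero. The fattened crease line $\widehat\gamma_m$ is a union of closed triangles of $\mathcal{T}_m$, called crease triangles, such that * each crease triangle has a segment $[c_{j-1},c_j]$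 as an edge, and its third vertex is not one of the points $c_i$ and belongs to no other crease triangle; * $\gamma\subset\widehat\gamma_m$; * every node of $\mathcal{T}_m$ lies in $\overline{\omega\setminus\widehat\gamma_m}$, and $\omega\setminus\widehat\gamma_m$ is locally connected at every node $z\notin\{c_0,\dots,c_{N_m}\}$, i.e., $B_r(z)\cap(\omega\setminus\widehat\gamma_m)$ is connected for all small $r>0$. Let $\widetilde V_m$ be the set of $v\in H^2(\omega\setminus\widehat\gamma_m;\mathbb{R}^3)$ with $(\nabla v)^{\sf T}\nabla v=I_{2\times 2}$ a.e. in $\omega\setminus\widehat\gamma_m$ whose continuous representative has a limit at each of $c_0,\dots,c_{N_m}$ from $\omega\setminus\widehat\gamma_m$, and let $\widetilde I_m(v)=\frac12\int_{\omega\setminus\widehat\gamma_m}|D^2v|^2\,dx$. Functions in $\widetilde V_m$ and their derivatives are extended by zero to $\omega$. **Proposition (Compactness).** Let $v_m\in\widetilde V_m$ with $\widetilde I_m(v_m)\le c$ for all $m\in\mathbb{N}$. Then the continuous, piecewise affine nodal interpolants $\widetilde v_m$ of $v_m$ on $\mathcal{T}_m$ (whose value at each node is the limit of the continuous representative of $v_m$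 from $\omega\setminus\widehat\gamma_m$) exist and belong to $W^{1,\infty}(\omega;\mathbb{R}^3)$. There is a constant $c'$ with $\|\nabla\widetilde v_m\|_{L^\infty(\omega)}\le c'$ for all $m$, and $\widetilde v_m-v_m\to0$ in $H^1(\omega';\mathbb{R}^3)$ for every open $\omega'$ that is compactly contained in $\omega\setminus\gamma$. If $v\in W^{1,\infty}(\omega;\mathbb{R}^3)$ is a weak-$\star$ accumulation point of $(\widetilde v_m)$ (the weak-$\star$ limit in $W^{1,\infty}(\omega;\mathbb{R}^3)$ of a subsequence), then $v\in V$, and $D^2v$ (the Hessian on $\omega\setminus\gamma$) is a weak accumulation point in $L^2(\omega;\mathbb{R}^{3\times2\times2})$ of $(D^2v_m)$. -/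

import Mathlib

open MeasureTheory Filter Topology Set
open scoped ENNReal NNReal

noncomputable section

/-- The plane, with the Euclidean norm. -/
abbrev R2 : Type := EuclideanSpace ℝ (Fin 2)

/-- Three-space, with the Euclidean norm. -/
abbrev R3 : Type := EuclideanSpace ℝ (Fin 3)

/-- Values of gradients of maps `R2 → R3` (one column per partial derivative), Frobenius norm. -/
abbrev GradVal : Type := PiLp 2 (fun _ : Fin 2 => R3)

/-- Values of Hessians of maps `R2 → R3`, Frobenius norm. -/
abbrev HessVal : Type := PiLp 2 (fun _ : Fin 2 × Fin 2 => R3)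

/-! ### Weak derivatives and Sobolev spaces -/

/-- `g` is a weak partial derivative of `f` in direction `i` on the open set `U`. -/
def HasWeakPartial (U : Set R2) (i : Fin 2) (f g : R2 → R3) : Prop :=
  LocallyIntegrableOn f U volume ∧ LocallyIntegrableOn g U volume ∧
    ∀ φ : R2 → ℝ, ContDiff ℝ (⊤ : ℕ∞) φ → HasCompactSupport φ → tsupport φ ⊆ U →
      ∫ x in U, (fderiv ℝ φ x (EuclideanSpace.single i 1)) • f x = - ∫ x in U, φ x • g x

open Classical in
/-- The weak partial derivative on `U` (unique almost everywhere on `U`), extended by zero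
outside `U`; it is only meaningful where a weak partial derivative exists. -/
def weakPartial (U : Set R2) (i : Fin 2) (f : R2 → R3) : R2 → R3 :=
  if h : ∃ g, HasWeakPartial U i f g then U.indicator h.choose else 0

/-- The weak gradient on `U`, extended by zero. -/
def weakGrad (U : Set R2) (f : R2 → R3) (x : R2) : GradVal :=
  WithLp.toLp 2 fun i => weakPartial U i f x

/-- The weak Hessian on `U`, extended by zero. -/
def weakHess (U : Set R2) (f : R2 → R3) (x : R2) : HessVal :=
  WithLp.toLp 2 fun ij => weakPartial U ij.1 (weakPartial U ij.2 f) x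

/-- `f ∈ W^{1,p}(U; ℝ³)`. -/
def MemW1p (U : Set R2) (p : ℝ≥0∞) (f : R2 → R3) : Prop :=
  MemLp f p (volume.restrict U) ∧ (∀ i, ∃ g, HasWeakPartial U i f g) ∧
    MemLp (weakGrad U f) p (volume.restrict U)

/-- `f ∈ H²(U; ℝ³)`. -/
def MemH2 (U : Set R2) (f : R2 → R3) : Prop :=
  MemW1p U 2 f ∧ (∀ i j, ∃ g, HasWeakPartial U i (weakPartial U j f) g) ∧
    MemLp (weakHess U f) 2 (volume.restrict U)

/-- The `H¹(U; ℝ³)` norm (up to equivalence). -/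
def h1Norm (U : Set R2) (f : R2 → R3) : ℝ≥0∞ :=
  eLpNorm f 2 (volume.restrict U) + eLpNorm (weakGrad U f) 2 (volume.restrict U)

/-- `w m → 0` in `H¹(U; ℝ³)`; finitely many members may fail to lie in the space. -/
def TendstoZeroH1 (U : Set R2) (w : ℕ → R2 → R3) : Prop :=
  (∀ᶠ m in atTop, MemW1p U 2 (w m)) ∧ Tendsto (fun m => h1Norm U (w m)) atTop (𝓝 0)

/-- `(∇f)ᵀ ∇f = I` almost everywhere in `U`. -/
def IsIsometric (U : Set R2) (f : R2 → R3) : Prop :=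
  ∀ᵐ x ∂(volume.restrict U), ∀ i j : Fin 2,
    inner ℝ (weakPartial U i f x) (weakPartial U j f x) = if i = j then (1 : ℝ) else 0

/-- `u` is a weak-star accumulation point in `W^{1,∞}(ω; ℝ³)` of the sequence `w`: some subsequence
converges, together with its gradients, against all `L¹` functions. -/
def IsWeakStarAccPt (ω : Set R2) (w : ℕ → R2 → R3) (u : R2 → R3) : Prop :=
  MemW1p ω ∞ u ∧ ∃ k : ℕ → ℕ, StrictMono k ∧
    (∀ g : R2 → R3, Integrable g (volume.restrict ω) →
      Tendsto (fun n => ∫ x in ω, inner ℝ (w (k n) x) (g x)) atTop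
        (𝓝 (∫ x in ω, inner ℝ (u x) (g x)))) ∧
    (∀ G : R2 → GradVal, Integrable G (volume.restrict ω) →
      Tendsto (fun n => ∫ x in ω, inner ℝ (weakGrad ω (w (k n)) x) (G x)) atTop
        (𝓝 (∫ x in ω, inner ℝ (weakGrad ω u x) (G x))))

/-- `X` is a weak accumulation point in `L²(ω; ℝ^{3×2×2})` of the sequence `Y`. -/
def IsWeakL2AccPt (ω : Set R2) (Y : ℕ → R2 → HessVal) (X : R2 → HessVal) : Prop :=
  MemLp X 2 (volume.restrict ω) ∧ ∃ k : ℕ → ℕ, StrictMono k ∧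
    ∀ Φ : R2 → HessVal, MemLp Φ 2 (volume.restrict ω) →
      Tendsto (fun n => ∫ x in ω, inner ℝ (Y (k n) x) (Φ x)) atTop
        (𝓝 (∫ x in ω, inner ℝ (X x) (Φ x)))

/-! ### Domains, crease lines and triangulations -/

/-- A bounded Lipschitz domain: near each boundary point it is, after an orthogonal change of
coordinates, the region below the graph of a Lipschitz function. -/
def IsLipschitzDomain (Ω : Set R2) : Prop :=
  IsOpen Ω ∧ IsConnected Ω ∧ Bornology.IsBounded Ω ∧
    ∀ x ∈ frontier Ω, ∃ (e : R2 ≃ₗᵢ[ℝ] R2) (L : ℝ≥0) (g : ℝ → ℝ) (r : ℝ),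
      LipschitzWith L g ∧ 0 < r ∧
        ∀ y ∈ Metric.ball x r, y ∈ Ω ↔ (e y) 1 < g ((e y) 0)

/-- `b` is a continuous piecewise `C¹` arclength parametrization on `[α, β]`; `S` is the finite set
of break points. -/
def IsPiecewiseC1Arclength (b : ℝ → R2) (α β : ℝ) : Prop :=
  α < β ∧ ContinuousOn b (Icc α β) ∧ ∃ S : Set ℝ, S.Finite ∧
    (∀ x y, x < y → Icc x y ⊆ Icc α β → Disjoint (Ioo x y) S → ContDiffOn ℝ 1 b (Icc x y)) ∧
    ∀ t ∈ Ioo α β, t ∉ S → ‖deriv b t‖ = 1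

/-- The set `ω` and the crease `γ = b([α, β])`, with `γ` running inside `ω` except possibly for its
end points, and splitting `ω` into the disjoint Lipschitz domains `ω₁` and `ω₂`. -/
structure IsCreasedDomain (ω ω₁ ω₂ : Set R2) (b : ℝ → R2) (α β : ℝ) : Prop where
  lipschitz : IsLipschitzDomain ω
  arc : IsPiecewiseC1Arclength b α β
  inside : ∀ t ∈ Ioo α β, b t ∈ ω
  lipschitz₁ : IsLipschitzDomain ω₁
  lipschitz₂ : IsLipschitzDomain ω₂
  disj : Disjoint ω₁ ω₂
  split : ω \ b '' Icc α β = ω₁ ∪ ω₂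

/-- A conforming triangulation of (the closure of) `ω`. A triangle is given by its set of three
vertices; the closed triangle is the convex hull. -/
structure Triangulation (ω : Set R2) where
  tri : Finset (Finset R2)
  card_eq : ∀ t ∈ tri, t.card = 3
  indep : ∀ t ∈ tri, AffineIndependent ℝ ((↑) : t → R2)
  conforming : ∀ s ∈ tri, ∀ t ∈ tri,
    convexHull ℝ (s : Set R2) ∩ convexHull ℝ (t : Set R2) ⊆ convexHull ℝ ((s : Set R2) ∩ t)
  cover : ⋃ t ∈ tri, convexHull ℝ (t : Set R2) = closure ω

namespace Triangulation

/-- The set of nodes. -/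
def nodes {ω : Set R2} (T : Triangulation ω) : Set R2 := {z | ∃ t ∈ T.tri, z ∈ t}

/-- Every triangle contains a disc whose radius is at least `1/κ` times the diameter. -/
def ShapeRegular {ω : Set R2} (T : Triangulation ω) (κ : ℝ) : Prop :=
  ∀ t ∈ T.tri, ∃ (x : R2) (ρ : ℝ), 0 < ρ ∧
    Metric.closedBall x ρ ⊆ convexHull ℝ (t : Set R2) ∧
    Metric.diam (convexHull ℝ (t : Set R2)) ≤ κ * ρ

/-- The maximal diameter of the triangles. -/
def meshSize {ω : Set R2} (T : Triangulation ω) : ℝ≥0∞ :=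
  T.tri.sup fun t => Metric.ediam (convexHull ℝ (t : Set R2))

end Triangulation

/-- A polygonal approximation of the crease `b([α, β])` by linear interpolation, a triangulation of
`ω` that matches it, and a fattened crease line made of triangles of this triangulation. -/
structure CreaseMesh (ω : Set R2) (b : ℝ → R2) (α β : ℝ) extends Triangulation ω where
  /-- number of segments of the polygonal crease line -/
  N : ℕ
  /-- interpolation points in the parameter interval -/
  t : Fin (N + 1) → ℝ
  t_strictMono : StrictMono t
  t_zero : t 0 = α
  t_last : t (Fin.last N) = β
  /-- the segments of the polygonal crease line are edges of the triangulation -/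
  matching : ∀ j : Fin N, ∃ s ∈ tri, b (t j.castSucc) ∈ s ∧ b (t j.succ) ∈ s
  /-- the triangles that form the fattened crease line -/
  creaseTri : Finset (Finset R2)
  crease_subset : creaseTri ⊆ tri
  /-- each of them has one segment of the polygonal crease line as an edge, and the opposite vertex
  is no vertex of the polygonal crease line and lies in no other triangle of the fattened crease -/
  crease_shape : ∀ s ∈ creaseTri, ∃ (j : Fin N) (a : R2),
    (s : Set R2) = {b (t j.castSucc), b (t j.succ), a} ∧ (∀ i, a ≠ b (t i)) ∧
      ∀ s' ∈ creaseTri, a ∈ s' → s' = s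
  /-- the exact crease line is contained in the fattened one -/
  crease_cover : b '' Icc α β ⊆ ⋃ s ∈ creaseTri, convexHull ℝ (s : Set R2)
  /-- the vertices of the polygonal crease line are in the closure of the perforated domain -/
  vertex_mem_closure : ∀ i,
    b (t i) ∈ closure (ω \ ⋃ s ∈ creaseTri, convexHull ℝ (s : Set R2))
  /-- all other nodes are in the closure too, and there the perforated domain is not pinched -/
  node_connected : ∀ z, (∃ s ∈ tri, z ∈ s) → (∀ i, z ≠ b (t i)) →
    ∀ᶠ r in 𝓝[>] (0 : ℝ),
      IsConnected (Metric.ball z r ∩ (ω \ ⋃ s ∈ creaseTri, convexHull ℝ (s : Set R2)))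

namespace CreaseMesh

variable {ω : Set R2} {b : ℝ → R2} {α β : ℝ}

/-- The vertices `c_0, …, c_N` of the polygonal crease line. -/
def vertex (M : CreaseMesh ω b α β) (i : Fin (M.N + 1)) : R2 := b (M.t i)

/-- The fattened crease line. -/
def fatCrease (M : CreaseMesh ω b α β) : Set R2 :=
  ⋃ s ∈ M.creaseTri, convexHull ℝ (s : Set R2)

/-- The perforated domain: `ω` without the fattened crease line. -/
def perforated (M : CreaseMesh ω b α β) : Set R2 := ω \ M.fatCrease

end CreaseMesh

/-! ### Admissible deformations, energies, interpolation -/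

/-- `w` is the continuous representative of `f` on `U`. -/
def IsContRep (U : Set R2) (f w : R2 → R3) : Prop :=
  ContinuousOn w U ∧ f =ᵐ[volume.restrict U] w

/-- The admissible set `V` for the crease `γ`. -/
def admissible (ω γ : Set R2) : Set (R2 → R3) :=
  {v | MemH2 (ω \ γ) v ∧ MemW1p ω ∞ v ∧ IsIsometric ω v}

/-- The relaxed admissible set: piecewise `H²` isometries on the perforated domain that are
continuous in the vertices of the polygonal crease line. -/
def relaxedAdmissible {ω : Set R2} {b : ℝ → R2} {α β : ℝ} (M : CreaseMesh ω b α β) :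
    Set (R2 → R3) :=
  {v | MemH2 M.perforated v ∧ IsIsometric M.perforated v ∧
    ∃ w, IsContRep M.perforated v w ∧
      ∀ i, ∃ a : R3, Tendsto w (𝓝[M.perforated] (M.vertex i)) (𝓝 a)}

/-- The bending energy on the perforated domain. -/
def relaxedEnergy {ω : Set R2} {b : ℝ → R2} {α β : ℝ} (M : CreaseMesh ω b α β)
    (v : R2 → R3) : ℝ :=
  (1 / 2) * ∫ x in M.perforated, ‖weakHess M.perforated v x‖ ^ 2

/-- `q` is (on the closure of `ω`) the nodal interpolant of `v`: it is affine on each triangle, and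
in each node it takes the limit value of `v` from the perforated domain. -/
def IsNodalInterpolant {ω : Set R2} {b : ℝ → R2} {α β : ℝ} (M : CreaseMesh ω b α β)
    (v q : R2 → R3) : Prop :=
  (∀ s ∈ M.tri, ∃ A : R2 →ᵃ[ℝ] R3, EqOn q A (convexHull ℝ (s : Set R2))) ∧
    ∃ w, IsContRep M.perforated v w ∧
      ∀ z ∈ M.nodes, Tendsto w (𝓝[M.perforated] z) (𝓝 (q z))

end

/-! Nodal limits. The partial derivatives of an isometry have length one, so its continuous
representative is 2-Lipschitz along every segment in the perforated domain
(`IsContRep.norm_sub_le`). On a triangle outside the fattened crease it therefore extends to the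
closed triangle. At a node off the polygonal crease this leaves finitely many candidate limits, and
connectedness of small punctured-out balls selects one (`CreaseMesh.exists_tendsto_of_connected`).
At crease vertices the limit is part of the definition of the relaxed class.

Gradient bound. By shape regularity it suffices to bound differences of nodal values on each
triangle by its diameter. Outside the crease this is the Lipschitz bound. In a crease triangle the
apex lies in no other crease triangle, so the edge from an inner crease vertex to the apex is shared
with a triangle outside the crease. The crease edge itself either borders such a triangle or is
bypassed through an apex (`CreaseMesh.norm_sub_le_of_crease`). If the far end of the edge lies on
the boundary of the domain, the bypass rests on local connectedness of Lipschitz domains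
(`CreaseMesh.exists_openSegment_of_forall_crease`). On fine meshes every relevant crease segment has
an inner end (`eventually_inner_vertex`); the finitely many other meshes contribute their own
constants.

Local convergence. Crease triangles stay within one mesh size of the curve, so near a compact set
off the curve only ordinary triangles occur eventually. There the first-order interpolation estimate
`lintegral_interpolation_error_le` applies, proved by mollification and Taylor's formula with
integral remainder; the energy bound makes the error vanish with the mesh size.

Limits. The Hessians extended by zero are bounded in L² and have a weak limit along a further
subsequence. Local H¹ closeness transfers the weak-star limits of the interpolants to the
deformations and their gradients, so integration by parts identifies the Hessian limit. The isometry
constraint is quadratic in weakly convergent gradients. The product rule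
`HasWeakPartial.integral_product_rule` rewrites it as pairings of the deformation with its first and
second derivatives. The deformations are equi-Lipschitz on balls, hence converge boundedly and
almost everywhere (`exists_pointwise_limit_of_weak`), and bounded pointwise times weak convergence
passes to the limit (`inner_eq_of_weak_limit`). The curve is a null set, so the constraint holds
almost everywhere in the whole domain. -/

/-! ### Weak derivatives -/

section WeakDerivatives

/-- The standard basis vectors of the plane. -/
noncomputable abbrev e2 (i : Fin 2) : R2 := EuclideanSpace.single i 1

variable {E : Type*} [NormedAddCommGroup E] [NormedSpace ℝ E]

theorem integrable_smul_of_tsupport_subset {U : Set R2} {φ : R2 → ℝ} (hφ : Continuous φ)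
    (hc : HasCompactSupport φ) (hs : tsupport φ ⊆ U) {f : R2 → E}
    (hf : LocallyIntegrableOn f U volume) : Integrable (fun x => φ x • f x) := by
  have h1 : IntegrableOn f (tsupport φ) volume :=
    hf.integrableOn_compact_subset hs hc
  have h2 : IntegrableOn (fun x => φ x • f x) (tsupport φ) volume :=
    h1.continuousOn_smul hφ.continuousOn hc
  rwa [integrableOn_iff_integrable_of_support_subset] at h2
  intro x hx
  by_contra h
  exact hx (by simp [image_eq_zero_of_notMem_tsupport h])

theorem setIntegral_smul_of_tsupport_subset {U : Set R2} {φ : R2 → ℝ}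
    (hs : tsupport φ ⊆ U) (f : R2 → E) : ∫ x in U, φ x • f x = ∫ x, φ x • f x := by
  apply setIntegral_eq_integral_of_forall_compl_eq_zero
  intro x hx
  rw [image_eq_zero_of_notMem_tsupport fun h => hx (hs h), zero_smul]

theorem tsupport_fderiv_apply_subset' {φ : R2 → ℝ} (e : R2) :
    tsupport (fun x => fderiv ℝ φ x e) ⊆ tsupport φ :=
  tsupport_fderiv_apply_subset ℝ e

theorem hasWeakPartial_iff {U : Set R2} {i : Fin 2} {f g : R2 → R3} :
    HasWeakPartial U i f g ↔ LocallyIntegrableOn f U volume ∧ LocallyIntegrableOn g U volume ∧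
    ∀ φ : R2 → ℝ, ContDiff ℝ (⊤ : ℕ∞) φ → HasCompactSupport φ → tsupport φ ⊆ U →
      ∫ x, (fderiv ℝ φ x (e2 i)) • f x = - ∫ x, φ x • g x := by
  unfold HasWeakPartial
  refine and_congr_right fun _ => and_congr_right fun _ => forall_congr' fun φ =>
    forall_congr' fun h1 => forall_congr' fun h2 => forall_congr' fun h3 => ?_
  rw [setIntegral_smul_of_tsupport_subset h3,
    setIntegral_smul_of_tsupport_subset ((tsupport_fderiv_apply_subset' _).trans h3)]

theorem HasWeakPartial.mono {U V : Set R2} {i : Fin 2} {f g : R2 → R3}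
    (h : HasWeakPartial U i f g) (hVU : V ⊆ U) : HasWeakPartial V i f g := by
  rw [hasWeakPartial_iff] at h ⊢
  exact ⟨h.1.mono_set hVU, h.2.1.mono_set hVU, fun φ h1 h2 h3 => h.2.2 φ h1 h2 (h3.trans hVU)⟩

theorem LocallyIntegrableOn.congr_ae {U : Set R2} {f g : R2 → R3}
    (hf : LocallyIntegrableOn f U volume) (h : f =ᵐ[volume.restrict U] g) (hU : IsOpen U) :
    LocallyIntegrableOn g U volume := by
  rw [locallyIntegrableOn_iff hU.isLocallyClosed] at hf ⊢
  intro k hk hkc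
  exact (hf k hk hkc).congr (ae_restrict_of_ae_restrict_of_subset hk h)

theorem HasWeakPartial.congr {U : Set R2} (hU : IsOpen U) {i : Fin 2} {f f' g g' : R2 → R3}
    (h : HasWeakPartial U i f g) (hf : f =ᵐ[volume.restrict U] f')
    (hg : g =ᵐ[volume.restrict U] g') : HasWeakPartial U i f' g' := by
  refine ⟨LocallyIntegrableOn.congr_ae h.1 hf hU, LocallyIntegrableOn.congr_ae h.2.1 hg hU,
    fun φ h1 h2 h3 => ?_⟩
  have := h.2.2 φ h1 h2 h3
  have e1 : ∫ x in U, φ x • g' x = ∫ x in U, φ x • g x := by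
    apply integral_congr_ae
    filter_upwards [hg] with x hx
    rw [hx]
  rw [e1, ← this]
  apply integral_congr_ae
  filter_upwards [hf] with x hx
  rw [hx]

theorem HasWeakPartial.ae_unique {U : Set R2} (hU : IsOpen U) {i : Fin 2} {f g g' : R2 → R3}
    (h : HasWeakPartial U i f g) (h' : HasWeakPartial U i f g') :
    g =ᵐ[volume.restrict U] g' := by
  rw [hasWeakPartial_iff] at h h'
  have key : ∀ᵐ x ∂(volume : Measure R2), x ∈ U → (g - g') x = 0 := by
    apply hU.ae_eq_zero_of_integral_contDiff_smul_eq_zero (h.2.1.sub h'.2.1)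
    intro φ h1 h2 h3
    have e1 := h.2.2 φ h1 h2 h3
    have e2 := h'.2.2 φ h1 h2 h3
    simp only [Pi.sub_apply, smul_sub]
    rw [integral_sub (integrable_smul_of_tsupport_subset h1.continuous h2 h3 h.2.1)
      (integrable_smul_of_tsupport_subset h1.continuous h2 h3 h'.2.1), sub_eq_zero]
    rw [e1] at e2
    exact neg_injective e2
  rw [EventuallyEq, ae_restrict_iff' hU.measurableSet]
  filter_upwards [key] with x hx hxU
  exact sub_eq_zero.1 (hx hxU)

theorem HasWeakPartial.sub {U : Set R2} {i : Fin 2} {f f' g g' : R2 → R3}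
    (h : HasWeakPartial U i f g) (h' : HasWeakPartial U i f' g') :
    HasWeakPartial U i (f - f') (g - g') := by
  rw [hasWeakPartial_iff] at h h' ⊢
  refine ⟨h.1.sub h'.1, h.2.1.sub h'.2.1, fun φ h1 h2 h3 => ?_⟩
  have hd : Continuous fun x => fderiv ℝ φ x (e2 i) :=
    (h1.continuous_fderiv (by simp)).clm_apply continuous_const
  have hdc : HasCompactSupport fun x => fderiv ℝ φ x (e2 i) := h2.fderiv_apply ℝ _
  have hds := (tsupport_fderiv_apply_subset' (φ := φ) (e2 i)).trans h3
  simp only [Pi.sub_apply, smul_sub]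
  rw [integral_sub (integrable_smul_of_tsupport_subset hd hdc hds h.1)
    (integrable_smul_of_tsupport_subset hd hdc hds h'.1),
    integral_sub (integrable_smul_of_tsupport_subset h1.continuous h2 h3 h.2.1)
    (integrable_smul_of_tsupport_subset h1.continuous h2 h3 h'.2.1),
    h.2.2 φ h1 h2 h3, h'.2.2 φ h1 h2 h3]
  abel

/-- Frees all later arguments from the choice made in `weakPartial`: by the fundamental lemma of the
calculus of variations any concrete weak derivative may replace the chosen one. -/
theorem weakPartial_ae_eq {U : Set R2} (hU : IsOpen U) {i : Fin 2} {f g : R2 → R3}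
    (h : HasWeakPartial U i f g) : weakPartial U i f =ᵐ[volume.restrict U] g := by
  have hex : ∃ g, HasWeakPartial U i f g := ⟨g, h⟩
  have h2 : weakPartial U i f =ᵐ[volume.restrict U] hex.choose := by
    rw [weakPartial, dif_pos hex]
    exact indicator_ae_eq_restrict hU.measurableSet
  exact h2.trans (hex.choose_spec.ae_unique hU h)

theorem hasWeakPartial_weakPartial {U : Set R2} (hU : IsOpen U) {i : Fin 2} {f : R2 → R3}
    (h : ∃ g, HasWeakPartial U i f g) : HasWeakPartial U i f (weakPartial U i f) := by
  obtain ⟨g, hg⟩ := h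
  exact hg.congr hU EventuallyEq.rfl (weakPartial_ae_eq hU hg).symm

theorem weakPartial_eq_zero_of_notMem {U : Set R2} {i : Fin 2} {f : R2 → R3} {x : R2}
    (hx : x ∉ U) : weakPartial U i f x = 0 := by
  unfold weakPartial
  split_ifs with h
  · exact indicator_of_notMem hx _
  · rfl

theorem weakHess_eq_zero_of_notMem {U : Set R2} {f : R2 → R3} {x : R2}
    (hx : x ∉ U) : weakHess U f x = 0 := by
  ext ij
  simp [weakHess, weakPartial_eq_zero_of_notMem hx]

theorem weakPartial_mono_ae_eq {U V : Set R2} (hU : IsOpen U) (hV : IsOpen V) (hVU : V ⊆ U)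
    {i : Fin 2} {f : R2 → R3} (h : ∃ g, HasWeakPartial U i f g) :
    weakPartial V i f =ᵐ[volume.restrict V] weakPartial U i f :=
  weakPartial_ae_eq hV ((hasWeakPartial_weakPartial hU h).mono hVU)

/-- Small balls are convex, so locally the bound along segments is an ordinary Lipschitz bound. -/
theorem continuousOn_of_segment_lipschitz {U : Set R2} (hU : IsOpen U) {f : R2 → R3} {C : ℝ}
    (hf : ∀ x y, segment ℝ x y ⊆ U → ‖f x - f y‖ ≤ C * ‖x - y‖) : ContinuousOn f U := by
  intro x hx
  obtain ⟨r, hr, hrU⟩ := Metric.isOpen_iff.1 hU x hx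
  apply ContinuousAt.continuousWithinAt
  have hC : Tendsto (fun y => C * ‖y - x‖) (𝓝 x) (𝓝 0) := by
    have : Continuous (fun y => C * ‖y - x‖) := by fun_prop
    simpa using this.tendsto x
  rw [ContinuousAt, tendsto_iff_norm_sub_tendsto_zero]
  refine squeeze_zero' (Eventually.of_forall fun y => norm_nonneg _) ?_ hC
  filter_upwards [Metric.ball_mem_nhds x hr] with y hy
  exact hf y x (((convex_ball x r).segment_subset hy (Metric.mem_ball_self hr)).trans hrU)

/-- A function that is Lipschitz along segments and has classical directional derivatives almost
everywhere has these as weak derivatives. -/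
theorem HasWeakPartial.of_lipschitz {U : Set R2} (hU : IsOpen U) {f g : R2 → R3} {i : Fin 2}
    {C : ℝ} (hf : ∀ x y, segment ℝ x y ⊆ U → ‖f x - f y‖ ≤ C * ‖x - y‖)
    (hg : LocallyIntegrableOn g U volume)
    (hd : ∀ᵐ x ∂(volume.restrict U), HasLineDerivAt ℝ f (g x) x (e2 i)) :
    HasWeakPartial U i f g := by
  have hfc : ContinuousOn f U := continuousOn_of_segment_lipschitz hU hf
  have hfl : LocallyIntegrableOn f U volume := hfc.locallyIntegrableOn hU.measurableSet
  rw [hasWeakPartial_iff]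
  refine ⟨hfl, hg, fun φ h1 h2 h3 => ?_⟩
  obtain ⟨δ, hδ, hδU⟩ := h2.exists_cthickening_subset_open hU h3
  set K := tsupport φ
  have hK : IsCompact K := h2
  have hK' : IsCompact (Metric.cthickening δ K) := hK.cthickening
  -- Increments of size at most `δ` keep the translates of the support of `φ` inside a compact
  -- thickening contained in `U`.
  set h : ℕ → ℝ := fun n => δ / (n + 1) with hh
  have hpos : ∀ n, 0 < h n := fun n => by positivity
  have hle : ∀ n, h n ≤ δ := fun n => by
    rw [hh]; exact div_le_self hδ.le (by linarith [n.cast_nonneg (α := ℝ)])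
  have hlim : Tendsto h atTop (𝓝 0) := by
    have := (tendsto_one_div_add_atTop_nhds_zero_nat (𝕜 := ℝ)).const_mul δ
    simpa [hh, div_eq_mul_inv] using this
  have hlim' : Tendsto h atTop (𝓝[≠] 0) :=
    tendsto_nhdsWithin_iff.2 ⟨hlim, Eventually.of_forall fun n => (hpos n).ne'⟩
  have hne : ‖e2 i‖ = 1 := by simp
  have hmem : ∀ x ∈ K, ∀ n, x + h n • e2 i ∈ Metric.cthickening δ K := by
    intro x hx n
    apply Metric.mem_cthickening_of_dist_le _ x _ _ hx
    rw [dist_eq_norm, add_sub_cancel_left, norm_smul, hne, mul_one, Real.norm_of_nonneg (hpos n).le]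
    exact hle n
  have hseg : ∀ x ∈ K, ∀ n, segment ℝ (x + h n • e2 i) x ⊆ U := by
    intro x hx n
    have : segment ℝ (x + h n • e2 i) x ⊆ Metric.closedBall x δ := by
      apply (convex_closedBall x δ).segment_subset _ (Metric.mem_closedBall_self hδ.le)
      rw [Metric.mem_closedBall, dist_eq_norm, add_sub_cancel_left, norm_smul, hne, mul_one,
        Real.norm_of_nonneg (hpos n).le]
      exact hle n
    exact this.trans ((Metric.closedBall_subset_cthickening hx δ).trans hδU)
  have hCnn : ∀ x ∈ K, ∀ n, ‖(h n)⁻¹ • (f (x + h n • e2 i) - f x)‖ ≤ |C| := by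
    intro x hx n
    have := hf _ _ (hseg x hx n)
    rw [add_sub_cancel_left, norm_smul, hne, mul_one, Real.norm_of_nonneg (hpos n).le] at this
    rw [norm_smul, norm_inv, Real.norm_of_nonneg (hpos n).le, inv_mul_le_iff₀ (hpos n)]
    nlinarith [hpos n, le_abs_self C]
  -- the two forms of the difference quotient
  have hAint : ∀ n, Integrable fun x => φ x • f (x + h n • e2 i) := by
    intro n
    have hV : IsOpen ((fun x : R2 => x + h n • e2 i) ⁻¹' U) := hU.preimage (by fun_prop)
    refine integrable_smul_of_tsupport_subset (U := (fun x : R2 => x + h n • e2 i) ⁻¹' U)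
      h1.continuous h2 (fun x hx => hδU (hmem x hx n)) ?_
    apply ContinuousOn.locallyIntegrableOn _ hV.measurableSet
    exact hfc.comp (by fun_prop) fun x hx => hx
  have hBint : Integrable fun x => φ x • f x :=
    integrable_smul_of_tsupport_subset h1.continuous h2 h3 hfl
  have hshift : ∀ n, ∫ x, φ x • f (x + h n • e2 i) = ∫ x, φ (x - h n • e2 i) • f x := by
    intro n
    rw [← integral_add_right_eq_self (fun x => φ (x - h n • e2 i) • f x) (h n • e2 i)]
    simp
  have hCint : ∀ n, Integrable fun x => φ (x - h n • e2 i) • f x := by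
    intro n
    have := (hAint n).comp_sub_right (h n • e2 i)
    simpa using this
  -- Discrete integration by parts: translation invariance moves the difference quotient from `f` to
  -- `φ`. The limits of the two sides are the two sides of the claim.
  have heq : ∀ n, ∫ x, φ x • ((h n)⁻¹ • (f (x + h n • e2 i) - f x)) =
      ∫ x, ((h n)⁻¹ * (φ (x - h n • e2 i) - φ x)) • f x := by
    intro n
    calc _ = ∫ x, (h n)⁻¹ • (φ x • f (x + h n • e2 i) - φ x • f x) := by
          congr 1; ext1 x; rw [smul_comm, smul_sub (φ x)]
      _ = ∫ x, (h n)⁻¹ • (φ (x - h n • e2 i) • f x - φ x • f x) := by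
          rw [integral_smul, integral_smul, integral_sub (hAint n) hBint, hshift,
            integral_sub (hCint n) hBint]
      _ = _ := by congr 1; ext1 x; rw [← sub_smul, smul_smul]
  have hlim1 : Tendsto (fun n => ∫ x, φ x • ((h n)⁻¹ • (f (x + h n • e2 i) - f x))) atTop
      (𝓝 (∫ x, φ x • g x)) := by
    apply tendsto_integral_of_dominated_convergence (fun x => |C| * ‖φ x‖)
    · intro n
      have : Integrable fun x => φ x • ((h n)⁻¹ • (f (x + h n • e2 i) - f x)) := by
        have := ((hAint n).sub hBint).smul (h n)⁻¹
        refine this.congr (Eventually.of_forall fun x => ?_)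
        simp only [Pi.smul_apply, Pi.sub_apply]
        rw [smul_comm, smul_sub (φ x)]
      exact this.aestronglyMeasurable
    · exact ((h1.continuous.integrable_of_hasCompactSupport h2).norm.const_mul _)
    · intro n
      refine Eventually.of_forall fun x => ?_
      by_cases hx : x ∈ K
      · rw [norm_smul, mul_comm]
        exact mul_le_mul_of_nonneg_right (hCnn x hx n) (norm_nonneg _)
      · simp [image_eq_zero_of_notMem_tsupport hx]
    · rw [ae_restrict_iff' hU.measurableSet] at hd
      filter_upwards [hd] with x hx
      by_cases hxU : x ∈ U
      · have := (hasLineDerivAt_iff_tendsto_slope_zero.1 (hx hxU)).comp hlim'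
        exact this.const_smul _
      · have : φ x = 0 := image_eq_zero_of_notMem_tsupport fun h => hxU (h3 h)
        simp [this]
  -- The Lipschitz constant of `φ` bounds its difference quotients, which vanish off the thickening;
  -- this gives an integrable majorant.
  obtain ⟨L, hL⟩ := ContDiff.lipschitzWith_of_hasCompactSupport (𝕂 := ℝ) h2 h1 (by simp)
  have hlim2 : Tendsto (fun n => ∫ x, ((h n)⁻¹ * (φ (x - h n • e2 i) - φ x)) • f x) atTop
      (𝓝 (∫ x, -(fderiv ℝ φ x (e2 i)) • f x)) := by
    apply tendsto_integral_of_dominated_convergence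
      (fun x => (Metric.cthickening δ K).indicator (fun x => L * ‖f x‖) x)
    · intro n
      have : Integrable fun x => ((h n)⁻¹ * (φ (x - h n • e2 i) - φ x)) • f x := by
        have := ((hCint n).sub hBint).smul (h n)⁻¹
        refine this.congr (Eventually.of_forall fun x => ?_)
        simp only [Pi.smul_apply, Pi.sub_apply]
        rw [← sub_smul, smul_smul]
      exact this.aestronglyMeasurable
    · rw [integrable_indicator_iff hK'.measurableSet]
      exact ((hfc.mono hδU).norm.const_smul (L : ℝ)).integrableOn_compact hK'
    · intro n
      refine Eventually.of_forall fun x => ?_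
      by_cases hx : x ∈ Metric.cthickening δ K
      · rw [indicator_of_mem hx, norm_smul]
        apply mul_le_mul_of_nonneg_right _ (norm_nonneg _)
        rw [norm_mul, norm_inv, Real.norm_of_nonneg (hpos n).le, inv_mul_le_iff₀ (hpos n)]
        have := hL.dist_le_mul (x - h n • e2 i) x
        rw [dist_eq_norm, dist_eq_norm, sub_sub_cancel_left, norm_neg, norm_smul, hne, mul_one,
          Real.norm_of_nonneg (hpos n).le] at this
        linarith
      · rw [indicator_of_notMem hx]
        have hx1 : φ x = 0 := image_eq_zero_of_notMem_tsupport fun h =>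
          hx (Metric.self_subset_cthickening _ h)
        have hx2 : φ (x - h n • e2 i) = 0 := image_eq_zero_of_notMem_tsupport fun h => hx (by
          have := hmem _ h n
          simpa using this)
        simp [hx1, hx2]
    · refine Eventually.of_forall fun x => ?_
      apply Tendsto.smul_const
      have hdiff : HasFDerivAt φ (fderiv ℝ φ x) x :=
        (h1.differentiable (by simp) x).hasFDerivAt
      have hld : HasLineDerivAt ℝ φ (fderiv ℝ φ x (-e2 i)) x (-e2 i) :=
        hdiff.hasLineDerivAt _
      have := (hasLineDerivAt_iff_tendsto_slope_zero.1 hld).comp hlim'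
      simp only [map_neg] at this
      refine this.congr fun n => ?_
      simp [sub_eq_add_neg]
  have := tendsto_nhds_unique (hlim1.congr heq) hlim2
  rw [this, ← integral_neg]
  congr 1; ext1 x; rw [neg_smul, neg_neg]

end WeakDerivatives

/-! ### Mollification -/

section Mollification

open ContinuousLinearMap Convolution

/-- A smooth bump function supported in the ball of radius `1 / (n + 1)`. -/
noncomputable def mollBump (n : ℕ) : ContDiffBump (0 : R2) where
  -- The fixed ratio 2 of the radii is what the almost everywhere convergence in
  -- `ae_tendsto_mollify` relies on.
  rIn := 1 / (n + 1) / 2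
  rOut := 1 / (n + 1)
  rIn_pos := by positivity
  rIn_lt_rOut := half_lt_self (by positivity)

/-- The mollification of `f` at scale `1 / (n + 1)`. -/
noncomputable def mollify (n : ℕ) (f : R2 → R3) : R2 → R3 :=
  (mollBump n).normed volume ⋆[lsmul ℝ ℝ, volume] f

theorem tendsto_mollBump_rOut : Tendsto (fun n => (mollBump n).rOut) atTop (𝓝 0) :=
  tendsto_one_div_add_atTop_nhds_zero_nat

theorem mollify_apply (n : ℕ) (f : R2 → R3) (x : R2) :
    mollify n f x = ∫ t, (mollBump n).normed volume (x - t) • f t :=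
  convolution_lsmul_swap

theorem mollify_congr {f g : R2 → R3} (h : f =ᵐ[volume] g) (n : ℕ) :
    mollify n f = mollify n g := by
  ext1 x
  rw [mollify_apply, mollify_apply]
  apply integral_congr_ae
  filter_upwards [h] with t ht
  rw [ht]

theorem contDiff_mollify (n : ℕ) {f : R2 → R3} (hf : LocallyIntegrable f volume) :
    ContDiff ℝ (⊤ : ℕ∞) (mollify n f) :=
  (mollBump n).hasCompactSupport_normed.contDiff_convolution_left _
    (mollBump n).contDiff_normed hf

theorem ae_tendsto_mollify {f : R2 → R3} (hf : LocallyIntegrable f volume) :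
    ∀ᵐ x, Tendsto (fun n => mollify n f x) atTop (𝓝 (f x)) := by
  apply ContDiffBump.ae_convolution_tendsto_right_of_locallyIntegrable (K := 2)
    tendsto_mollBump_rOut _ hf
  refine Eventually.of_forall fun n => ?_
  simp [mollBump, mul_div_cancel₀]

theorem tendsto_mollify_of_continuousAt {f : R2 → R3} (hf : AEStronglyMeasurable f volume) {x : R2}
    (hx : ContinuousAt f x) : Tendsto (fun n => mollify n f x) atTop (𝓝 (f x)) :=
  ContDiffBump.convolution_tendsto_right (g := fun _ => f) (k := fun _ => x)
    tendsto_mollBump_rOut (Eventually.of_forall fun _ => hf)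
    (by exact hx.tendsto.comp tendsto_snd) tendsto_const_nhds

theorem norm_mollify_le {f : R2 → R3} {C : ℝ} (hf : ∀ᵐ x, ‖f x‖ ≤ C) (n : ℕ) (x : R2) :
    ‖mollify n f x‖ ≤ C := by
  rw [mollify_apply]
  have hi : ∫ t, (mollBump n).normed volume (x - t) = 1 := by
    rw [integral_sub_left_eq_self ((mollBump n).normed volume)]
    exact (mollBump n).integral_normed
  have hInt : Integrable fun t => (mollBump n).normed volume (x - t) :=
    (mollBump n).integrable_normed.comp_sub_left x
  calc _ ≤ ∫ t, (mollBump n).normed volume (x - t) * C := by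
        apply norm_integral_le_of_norm_le (hInt.mul_const C)
        filter_upwards [hf] with t ht
        rw [norm_smul, Real.norm_of_nonneg ((mollBump n).nonneg_normed _)]
        exact mul_le_mul_of_nonneg_left ht ((mollBump n).nonneg_normed _)
    _ = C := by rw [integral_mul_const, hi, one_mul]

theorem fderiv_mollify_apply (n : ℕ) {f : R2 → R3} (hf : LocallyIntegrable f volume) (x e : R2) :
    fderiv ℝ (mollify n f) x e =
      ∫ t, fderiv ℝ ((mollBump n).normed volume) (x - t) e • f t := by
  have hc := (mollBump n).hasCompactSupport_normed (μ := (volume : Measure R2))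
  have hd : ContDiff ℝ 1 ((mollBump n).normed (volume : Measure R2)) :=
    (mollBump n).contDiff_normed (n := 1)
  have h1 := hc.hasFDerivAt_convolution_left (lsmul ℝ ℝ) (μ := volume) hd hf x
  have h2 : fderiv ℝ (mollify n f) x = _ := h1.fderiv
  rw [h2, convolution_eq_swap]
  rw [ContinuousLinearMap.integral_apply]
  · rfl
  · have := (hc.fderiv ℝ).convolutionExists_left (precompL R2 (lsmul ℝ ℝ : ℝ →L[ℝ] R3 →L[ℝ] R3))
      (hd.continuous_fderiv one_ne_zero) hf x
    exact this.integrable_swap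

/-- Weak derivatives commute with mollification away from the boundary. -/
theorem fderiv_mollify_eq {U : Set R2} (hU : IsOpen U) {i : Fin 2} {f g : R2 → R3}
    (h : HasWeakPartial U i f g) (hf : IntegrableOn f U volume)
    {n : ℕ} {x : R2} (hx : Metric.closedBall x (1 / (n + 1)) ⊆ U) :
    fderiv ℝ (mollify n (U.indicator f)) x (e2 i) = mollify n (U.indicator g) x := by
  have hfi : Integrable (U.indicator f) := hf.integrable_indicator hU.measurableSet
  rw [fderiv_mollify_apply n hfi.locallyIntegrable, mollify_apply]
  set ρ := (mollBump n).normed (volume : Measure R2) with hρ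
  have hρd : ContDiff ℝ (⊤ : ℕ∞) ρ := (mollBump n).contDiff_normed
  -- The reflected kernel is an admissible test function because its support lies in the closed ball
  -- around `x`. The sign from the chain rule cancels the sign in the definition of the weak
  -- derivative.
  set φ : R2 → ℝ := fun t => ρ (x - t) with hφ
  have hφd : ContDiff ℝ (⊤ : ℕ∞) φ := hρd.comp (by fun_prop)
  have hfd : ∀ t, fderiv ℝ ρ (x - t) (e2 i) = - fderiv ℝ φ t (e2 i) := by
    intro t
    have h1 : HasFDerivAt φ ((fderiv ℝ ρ (x - t)).comp (-(ContinuousLinearMap.id ℝ R2))) t := by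
      have ha : HasFDerivAt ρ (fderiv ℝ ρ (x - t)) (x - t) :=
        (hρd.differentiable (by simp) _).hasFDerivAt
      have hb : HasFDerivAt (fun t : R2 => x - t) (-(ContinuousLinearMap.id ℝ R2)) t := by
        simpa using (hasFDerivAt_id (𝕜 := ℝ) t).const_sub x
      exact ha.comp t hb
    rw [h1.fderiv]
    simp
  have hsupp : tsupport φ ⊆ Metric.closedBall x (1 / (n + 1)) := by
    apply closure_minimal _ Metric.isClosed_closedBall
    intro t ht
    have : x - t ∈ Function.support ρ := ht
    rw [hρ, ContDiffBump.support_normed_eq] at this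
    rw [Metric.mem_closedBall, dist_comm, dist_eq_norm]
    exact (mem_ball_zero_iff.1 this).le
  have hcs : HasCompactSupport φ :=
    (isCompact_closedBall x _).of_isClosed_subset (isClosed_tsupport _) hsupp
  have hU' := hsupp.trans hx
  have key := h.2.2 φ hφd hcs hU'
  simp_rw [hfd, neg_smul]
  rw [integral_neg]
  have e1 : ∫ t, fderiv ℝ φ t (e2 i) • U.indicator f t = ∫ t in U, fderiv ℝ φ t (e2 i) • f t := by
    rw [← integral_indicator hU.measurableSet]
    congr 1; ext1 t
    by_cases ht : t ∈ U <;> simp [ht]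
  have e3 : ∫ t, φ t • U.indicator g t = ∫ t in U, φ t • g t := by
    rw [← integral_indicator hU.measurableSet]
    congr 1; ext1 t
    by_cases ht : t ∈ U <;> simp [ht]
  rw [e1, key, neg_neg, ← e3]

/-- Cauchy–Schwarz against the constant one. -/
theorem lintegral_sq_le_of_isProbabilityMeasure {α : Type*} [MeasurableSpace α] (ν : Measure α)
    [IsProbabilityMeasure ν] {f : α → ℝ≥0∞} (hf : AEMeasurable f ν) :
    (∫⁻ a, f a ∂ν) ^ 2 ≤ ∫⁻ a, f a ^ 2 ∂ν := by
  have h := ENNReal.lintegral_mul_le_Lp_mul_Lq ν Real.HolderConjugate.two_two hf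
    (aemeasurable_const (b := (1 : ℝ≥0∞)))
  simp only [Pi.mul_apply, mul_one, ENNReal.one_rpow, lintegral_const, measure_univ] at h
  calc (∫⁻ a, f a ∂ν) ^ 2 ≤ ((∫⁻ a, f a ^ (2 : ℝ) ∂ν) ^ (1 / (2 : ℝ))) ^ 2 := by gcongr
    _ = ∫⁻ a, f a ^ 2 ∂ν := by
      rw [← ENNReal.rpow_natCast, ← ENNReal.rpow_mul]
      norm_num

/-- The mollification kernel integrates to one. -/
theorem lintegral_mollBump (n : ℕ) :
    ∫⁻ t, ENNReal.ofReal ((mollBump n).normed (volume : Measure R2) t) = 1 := by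
  rw [← ofReal_integral_eq_lintegral_ofReal (mollBump n).integrable_normed
    (Eventually.of_forall (mollBump n).nonneg_normed), (mollBump n).integral_normed]
  simp

/-- Jensen's inequality for the probability measure with the kernel as density, followed by Tonelli.
A translation by a vector in the support of the kernel moves `A` into its thickening. -/
theorem lintegral_mollify_sq_le (n : ℕ) {f : R2 → R3} (hf : AEStronglyMeasurable f volume)
    {A : Set R2} (hA : MeasurableSet A) :
    ∫⁻ x in A, ‖mollify n f x‖ₑ ^ 2 ≤
      ∫⁻ x in Metric.cthickening (1 / (n + 1)) A, ‖f x‖ₑ ^ 2 := by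
  set ρ := (mollBump n).normed (volume : Measure R2) with hρ
  have hρm : Measurable fun t => ENNReal.ofReal (ρ t) :=
    ((mollBump n).continuous_normed.measurable).ennreal_ofReal
  set ν : Measure R2 := volume.withDensity fun t => ENNReal.ofReal (ρ t) with hν
  have : IsProbabilityMeasure ν := ⟨by
    rw [hν, withDensity_apply _ MeasurableSet.univ, Measure.restrict_univ, lintegral_mollBump]⟩
  have hac : ν ≪ volume := withDensity_absolutelyContinuous _ _
  have hqm : ∀ x : R2, Measure.QuasiMeasurePreserving (fun t : R2 => x - t) volume volume :=
    fun x => (quasiMeasurePreserving_sub_left volume x)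
  have h1 : ∀ x, ‖mollify n f x‖ₑ ^ 2 ≤ ∫⁻ t, ENNReal.ofReal (ρ t) * ‖f (x - t)‖ₑ ^ 2 := by
    intro x
    have hm : AEMeasurable (fun t => ‖f (x - t)‖ₑ) volume :=
      (hf.comp_quasiMeasurePreserving (hqm x)).enorm
    have e1 : ‖mollify n f x‖ₑ ≤ ∫⁻ t, ‖f (x - t)‖ₑ ∂ν := by
      rw [hν, lintegral_withDensity_eq_lintegral_mul₀ hρm.aemeasurable hm]
      calc _ ≤ ∫⁻ t, ‖ρ t • f (x - t)‖ₑ := enorm_integral_le_lintegral_enorm _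
        _ = _ := by
          congr 1; ext1 t
          rw [enorm_smul, Real.enorm_eq_ofReal ((mollBump n).nonneg_normed t)]
          rfl
    calc _ ≤ (∫⁻ t, ‖f (x - t)‖ₑ ∂ν) ^ 2 := by gcongr
      _ ≤ ∫⁻ t, ‖f (x - t)‖ₑ ^ 2 ∂ν :=
        lintegral_sq_le_of_isProbabilityMeasure ν (hm.mono_ac hac)
      _ = _ := by
        rw [hν, lintegral_withDensity_eq_lintegral_mul₀ hρm.aemeasurable (hm.pow_const 2)]
        rfl
  have hqm2 : Measure.QuasiMeasurePreserving (fun p : R2 × R2 => p.1 - p.2)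
      ((volume.restrict A).prod volume) volume := by
    refine (quasiMeasurePreserving_sub_of_right_invariant volume volume).mono_left ?_
    exact Measure.AbsolutelyContinuous.prod Measure.restrict_le_self.absolutelyContinuous
      Measure.AbsolutelyContinuous.rfl
  calc ∫⁻ x in A, ‖mollify n f x‖ₑ ^ 2
      ≤ ∫⁻ x in A, ∫⁻ t, ENNReal.ofReal (ρ t) * ‖f (x - t)‖ₑ ^ 2 := lintegral_mono h1
    _ = ∫⁻ t, ∫⁻ x in A, ENNReal.ofReal (ρ t) * ‖f (x - t)‖ₑ ^ 2 := by
      apply lintegral_lintegral_swap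
      refine AEMeasurable.mul (f := fun p : R2 × R2 => ENNReal.ofReal (ρ p.2))
        (g := fun p : R2 × R2 => ‖f (p.1 - p.2)‖ₑ ^ 2) ?_ ?_
      · exact (hρm.comp measurable_snd).aemeasurable
      · exact (hf.comp_quasiMeasurePreserving hqm2).enorm.pow_const 2
    _ ≤ ∫⁻ t, ENNReal.ofReal (ρ t) *
        ∫⁻ x in Metric.cthickening (1 / (n + 1)) A, ‖f x‖ₑ ^ 2 := by
      apply lintegral_mono
      intro t
      dsimp only
      rw [lintegral_const_mul' _ _ ENNReal.ofReal_ne_top]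
      by_cases ht : ρ t = 0
      · simp [ht]
      refine mul_le_mul_right ?_ _
      have htb : ‖t‖ < 1 / (n + 1) := by
        have : t ∈ Function.support ρ := ht
        rw [hρ, ContDiffBump.support_normed_eq] at this
        exact mem_ball_zero_iff.1 this
      rw [← lintegral_indicator hA,
        ← lintegral_indicator Metric.isClosed_cthickening.measurableSet,
        ← lintegral_sub_right_eq_self ((Metric.cthickening (1 / ((n : ℝ) + 1)) A).indicator _) t]
      apply lintegral_mono
      intro x
      by_cases hx : x ∈ A
      · have : x - t ∈ Metric.cthickening (1 / ((n : ℝ) + 1)) A := by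
          apply Metric.mem_cthickening_of_dist_le _ x _ _ hx
          rw [dist_eq_norm]
          simpa using htb.le
        simp only [indicator_of_mem hx]
        rw [indicator_of_mem this]
      · simp [hx]
    _ = _ := by
      rw [lintegral_mul_const _ hρm, lintegral_mollBump, one_mul]

end Mollification

/-! ### Functions with bounded weak gradients -/

section BoundedGradient

theorem eq_smul_e2_add (h : R2) : h = h 0 • e2 0 + h 1 • e2 1 := by
  ext i
  fin_cases i <;> simp

theorem opNorm_le_of_partials (A : R2 →L[ℝ] R3) : ‖A‖ ≤ ‖A (e2 0)‖ + ‖A (e2 1)‖ := by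
  apply A.opNorm_le_bound (by positivity)
  intro h
  have h0 : ‖h 0‖ ≤ ‖h‖ := PiLp.norm_apply_le h 0
  have h1 : ‖h 1‖ ≤ ‖h‖ := PiLp.norm_apply_le h 1
  calc ‖A h‖ = ‖h 0 • A (e2 0) + h 1 • A (e2 1)‖ := by
        conv_lhs => rw [eq_smul_e2_add h]
        rw [map_add, map_smul, map_smul]
    _ ≤ ‖h 0‖ * ‖A (e2 0)‖ + ‖h 1‖ * ‖A (e2 1)‖ := by
        refine (norm_add_le _ _).trans ?_
        rw [norm_smul, norm_smul]
    _ ≤ ‖h‖ * ‖A (e2 0)‖ + ‖h‖ * ‖A (e2 1)‖ := by gcongr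
    _ = _ := by ring

theorem eventually_forall_closedBall_subset {U K : Set R2} (hU : IsOpen U) (hK : IsCompact K)
    (hKU : K ⊆ U) : ∀ᶠ n : ℕ in atTop, ∀ z ∈ K, Metric.closedBall z (1 / ((n : ℝ) + 1)) ⊆ U := by
  obtain ⟨δ, hδ, hδU⟩ := hK.exists_cthickening_subset_open hU hKU
  have := tendsto_one_div_add_atTop_nhds_zero_nat (𝕜 := ℝ)
  filter_upwards [this.eventually (gt_mem_nhds hδ)] with n hn z hz
  exact (Metric.closedBall_subset_closedBall hn.le).trans
    ((Metric.closedBall_subset_cthickening hz δ).trans hδU)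

/-- Convergence at every point rather than almost everywhere, which is needed to control nodal
values. -/
theorem IsContRep.tendsto_mollify {U : Set R2} (hU : IsOpen U) {v w : R2 → R3}
    (hw : IsContRep U v w) {x : R2} (hx : x ∈ U) :
    Tendsto (fun n => mollify n (U.indicator v) x) atTop (𝓝 (w x)) := by
  have h1 : U.indicator v =ᵐ[volume] U.indicator w := by
    have := hw.2
    rw [EventuallyEq, ae_restrict_iff' hU.measurableSet] at this
    filter_upwards [this] with y hy
    by_cases h : y ∈ U
    · simp [h, hy h]
    · simp [h]
  have h2 : AEStronglyMeasurable (U.indicator w) volume :=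
    (aestronglyMeasurable_indicator_iff hU.measurableSet).2
      (hw.1.aestronglyMeasurable hU.measurableSet)
  have h3 : ContinuousAt (U.indicator w) x := by
    have h4 : ContinuousAt w x := hw.1.continuousAt (hU.mem_nhds hx)
    apply h4.congr
    filter_upwards [hU.mem_nhds hx] with y hy
    simp [hy]
  have h5 := tendsto_mollify_of_continuousAt h2 h3
  rw [indicator_of_mem hx] at h5
  exact h5.congr fun n => by rw [mollify_congr h1]

theorem ae_indicator_norm_le {U : Set R2} (hU : IsOpen U) {g : R2 → R3} {C : ℝ} (hC : 0 ≤ C)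
    (hg : ∀ᵐ x ∂(volume.restrict U), ‖g x‖ ≤ C) : ∀ᵐ x, ‖U.indicator g x‖ ≤ C := by
  rw [ae_restrict_iff' hU.measurableSet] at hg
  filter_upwards [hg] with x hx
  by_cases h : x ∈ U
  · simpa [h] using hx h
  · simpa [h] using hC

/-- The continuous representative of a function whose weak partial derivatives are bounded by one
is Lipschitz along segments. -/
theorem IsContRep.norm_sub_le {U : Set R2} (hU : IsOpen U) {v w : R2 → R3} {g : Fin 2 → R2 → R3}
    (hv : IntegrableOn v U volume) (hg : ∀ i, HasWeakPartial U i v (g i))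
    (hb : ∀ i, ∀ᵐ x ∂(volume.restrict U), ‖g i x‖ ≤ 1) (hw : IsContRep U v w) {x y : R2}
    (hxy : segment ℝ x y ⊆ U) : ‖w x - w y‖ ≤ 2 * ‖x - y‖ := by
  have hK : IsCompact (segment ℝ x y) := by
    rw [← convexHull_pair (𝕜 := ℝ)]
    exact (Set.toFinite {x, y}).isCompact_convexHull (𝕜 := ℝ)
  have hlim : Tendsto (fun n => ‖mollify n (U.indicator v) x - mollify n (U.indicator v) y‖) atTop
      (𝓝 ‖w x - w y‖) :=
    ((hw.tendsto_mollify hU (hxy (left_mem_segment ℝ x y))).sub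
      (hw.tendsto_mollify hU (hxy (right_mem_segment ℝ x y)))).norm
  apply le_of_tendsto hlim
  filter_upwards [eventually_forall_closedBall_subset hU hK hxy] with n hn
  have hvi : Integrable (U.indicator v) := hv.integrable_indicator hU.measurableSet
  have hd : Differentiable ℝ (mollify n (U.indicator v)) :=
    (contDiff_mollify n hvi.locallyIntegrable).differentiable (by simp)
  refine (convex_segment x y).norm_image_sub_le_of_norm_hasFDerivWithin_le
    (f' := fun z => fderiv ℝ (mollify n (U.indicator v)) z)
    (fun z _ => (hd z).hasFDerivAt.hasFDerivWithinAt) (fun z hz => ?_)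
    (right_mem_segment ℝ x y) (left_mem_segment ℝ x y)
  refine (opNorm_le_of_partials _).trans ?_
  -- Origin of the Lipschitz constant 2: two partial derivatives, each bounded by one.
  rw [fderiv_mollify_eq hU (hg 0) hv (hn z hz), fderiv_mollify_eq hU (hg 1) hv (hn z hz)]
  have h0 := norm_mollify_le (ae_indicator_norm_le hU zero_le_one (hb 0)) n z
  have h1 := norm_mollify_le (ae_indicator_norm_le hU zero_le_one (hb 1)) n z
  linarith

/-- The components of a vector-valued test map are scalar test functions. The vector form is needed
because the product rule tests with a cut-off times a mollified map. -/
theorem HasWeakPartial.integral_inner_eq {U : Set R2} {i : Fin 2} {f g : R2 → R3}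
    (h : HasWeakPartial U i f g) {Ψ : R2 → R3} (h1 : ContDiff ℝ (⊤ : ℕ∞) Ψ)
    (h2 : HasCompactSupport Ψ) (h3 : tsupport Ψ ⊆ U) :
    ∫ x, inner ℝ (fderiv ℝ Ψ x (e2 i)) (f x) = - ∫ x, inner ℝ (Ψ x) (g x) := by
  rw [hasWeakPartial_iff] at h
  set ψ : Fin 3 → R2 → ℝ := fun k x => Ψ x k with hψ
  have hψd : ∀ k, ContDiff ℝ (⊤ : ℕ∞) (ψ k) := fun k => by
    exact (contDiff_euclidean.1 h1 k)
  have hψs : ∀ k, tsupport (ψ k) ⊆ tsupport Ψ := fun k => by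
    apply closure_mono
    intro x hx hx'
    exact hx (by simp [hψ, hx'])
  have hψc : ∀ k, HasCompactSupport (ψ k) := fun k =>
    h2.of_isClosed_subset (isClosed_tsupport _) (hψs k)
  have hψU : ∀ k, tsupport (ψ k) ⊆ U := fun k => (hψs k).trans h3
  have hderiv : ∀ k x, fderiv ℝ (ψ k) x (e2 i) = fderiv ℝ Ψ x (e2 i) k := by
    intro k x
    have ha : HasFDerivAt Ψ (fderiv ℝ Ψ x) x := (h1.differentiable (by simp) x).hasFDerivAt
    have hb : HasFDerivAt (ψ k) ((EuclideanSpace.proj k : R3 →L[ℝ] ℝ).comp (fderiv ℝ Ψ x)) x :=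
      (EuclideanSpace.proj k : R3 →L[ℝ] ℝ).hasFDerivAt.comp x ha
    rw [hb.fderiv]
    rfl
  have hdc : ∀ k, Continuous fun x => fderiv ℝ (ψ k) x (e2 i) := fun k =>
    ((hψd k).continuous_fderiv (by simp)).clm_apply continuous_const
  have hInt1 : ∀ k, Integrable fun x => fderiv ℝ (ψ k) x (e2 i) • f x := fun k =>
    integrable_smul_of_tsupport_subset (hdc k) ((hψc k).fderiv_apply ℝ _)
      ((tsupport_fderiv_apply_subset' _).trans (hψU k)) h.1
  have hInt2 : ∀ k, Integrable fun x => ψ k x • g x := fun k =>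
    integrable_smul_of_tsupport_subset (hψd k).continuous (hψc k) (hψU k) h.2.1
  have key : ∀ k : Fin 3, ∫ x, (fderiv ℝ (ψ k) x (e2 i) • f x) k = - ∫ x, (ψ k x • g x) k := by
    intro k
    have := congrArg (EuclideanSpace.proj k : R3 →L[ℝ] ℝ) (h.2.2 (ψ k) (hψd k) (hψc k) (hψU k))
    rw [map_neg, ← ContinuousLinearMap.integral_comp_comm _ (hInt1 k),
      ← ContinuousLinearMap.integral_comp_comm _ (hInt2 k)] at this
    exact this
  have hik1 : ∀ k : Fin 3, Integrable fun x => (fderiv ℝ (ψ k) x (e2 i) • f x) k := fun k =>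
    (EuclideanSpace.proj k : R3 →L[ℝ] ℝ).integrable_comp (hInt1 k)
  have hik2 : ∀ k : Fin 3, Integrable fun x => (ψ k x • g x) k := fun k =>
    (EuclideanSpace.proj k : R3 →L[ℝ] ℝ).integrable_comp (hInt2 k)
  have e1 : ∀ x, inner ℝ (fderiv ℝ Ψ x (e2 i)) (f x) =
      ∑ k : Fin 3, (fderiv ℝ (ψ k) x (e2 i) • f x) k := by
    intro x
    rw [PiLp.inner_apply]
    refine Finset.sum_congr rfl fun k _ => ?_
    simp [hderiv, mul_comm]
  have e3 : ∀ x, inner ℝ (Ψ x) (g x) = ∑ k : Fin 3, (ψ k x • g x) k := by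
    intro x
    rw [PiLp.inner_apply]
    refine Finset.sum_congr rfl fun k _ => ?_
    simp [hψ, mul_comm]
  simp_rw [e1, e3]
  rw [integral_finsetSum _ fun k _ => hik1 k, integral_finsetSum _ fun k _ => hik2 k,
    ← Finset.sum_neg_distrib]
  exact Finset.sum_congr rfl fun k _ => key k

/-- The product rule for `⟪v, ∂ⱼ v⟫`, tested with a smooth function. -/
theorem HasWeakPartial.integral_product_rule {U : Set R2} (hU : IsOpen U) {v gi gj H : R2 → R3}
    {i : Fin 2} {B C : ℝ} (hB : 0 ≤ B) (hC : 0 ≤ C)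
    (hv : IntegrableOn v U volume) (hgi : HasWeakPartial U i v gi)
    (hH : HasWeakPartial U i gj H)
    (hvb : ∀ᵐ x ∂(volume.restrict U), ‖v x‖ ≤ B) (hgb : ∀ᵐ x ∂(volume.restrict U), ‖gi x‖ ≤ C)
    (hgim : IntegrableOn gi U volume)
    {φ : R2 → ℝ} (h1 : ContDiff ℝ (⊤ : ℕ∞) φ)
    (h2 : HasCompactSupport φ) (h3 : tsupport φ ⊆ U) :
    ∫ x, φ x * inner ℝ (gi x) (gj x) =
      - (∫ x, fderiv ℝ φ x (e2 i) * inner ℝ (v x) (gj x)) - ∫ x, φ x * inner ℝ (v x) (H x) := by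
  set V : R2 → R3 := U.indicator v with hV
  set G : R2 → R3 := U.indicator gi with hG
  have hVi : Integrable V := hv.integrable_indicator hU.measurableSet
  have hGi : Integrable G := hgim.integrable_indicator hU.measurableSet
  have hVb := ae_indicator_norm_le hU hB hvb
  have hGb := ae_indicator_norm_le hU hC hgb
  have hdφ : Continuous fun x => fderiv ℝ φ x (e2 i) :=
    (h1.continuous_fderiv (by simp)).clm_apply continuous_const
  have hdc : HasCompactSupport fun x => fderiv ℝ φ x (e2 i) := h2.fderiv_apply ℝ _
  have hds := (tsupport_fderiv_apply_subset' (φ := φ) (e2 i)).trans h3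
  have i1 : Integrable fun x => fderiv ℝ φ x (e2 i) • gj x :=
    integrable_smul_of_tsupport_subset hdφ hdc hds hH.1
  have i2 : Integrable fun x => φ x • gj x :=
    integrable_smul_of_tsupport_subset h1.continuous h2 h3 hH.1
  have i3 : Integrable fun x => φ x • H x :=
    integrable_smul_of_tsupport_subset h1.continuous h2 h3 hH.2.1
  have hVn : ∀ n, ContDiff ℝ (⊤ : ℕ∞) (mollify n V) := fun n =>
    contDiff_mollify n hVi.locallyIntegrable
  have hGn : ∀ n, ContDiff ℝ (⊤ : ℕ∞) (mollify n G) := fun n =>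
    contDiff_mollify n hGi.locallyIntegrable
  have smul_inner : ∀ (a : ℝ) (x y : R3), a * inner ℝ x y = inner ℝ x (a • y) := by
    intro a x y; rw [real_inner_smul_right]
  -- limits of the three integrals
  have lim : ∀ (D : ℝ) (F q : R2 → R3) (_ : Integrable F) (_ : ∀ᵐ x, ‖F x‖ ≤ D)
      (_ : ∀ n, ContDiff ℝ (⊤ : ℕ∞) (mollify n F)) (_ : Integrable q),
      Tendsto (fun n => ∫ x, inner ℝ (mollify n F x) (q x)) atTop (𝓝 (∫ x, inner ℝ (F x) (q x))) := by
    intro D F q hF hFb hFn hq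
    apply tendsto_integral_of_dominated_convergence (fun x => D * ‖q x‖)
    · intro n
      exact (hFn n).continuous.aestronglyMeasurable.inner hq.aestronglyMeasurable
    · exact hq.norm.const_mul D
    · intro n
      refine Eventually.of_forall fun x => (norm_inner_le_norm _ _).trans ?_
      exact mul_le_mul_of_nonneg_right (norm_mollify_le hFb n x) (norm_nonneg _)
    · filter_upwards [ae_tendsto_mollify hF.locallyIntegrable] with x hx
      exact hx.inner tendsto_const_nhds
  have intb : ∀ (D : ℝ) (F q : R2 → R3) (n : ℕ) (_ : ∀ᵐ x, ‖F x‖ ≤ D)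
      (_ : ContDiff ℝ (⊤ : ℕ∞) (mollify n F)) (_ : Integrable q),
      Integrable (fun x => inner ℝ (mollify n F x) (q x)) := by
    intro D F q n hFb hFn hq
    refine (hq.norm.const_mul D).mono' (hFn.continuous.aestronglyMeasurable.inner
      hq.aestronglyMeasurable) (Eventually.of_forall fun x => (norm_inner_le_norm _ _).trans ?_)
    exact mul_le_mul_of_nonneg_right (norm_mollify_le hFb n x) (norm_nonneg _)
  have l1 := lim B V _ hVi hVb hVn i1
  have l2 := lim C G _ hGi hGb hGn i2
  have l3 := lim B V _ hVi hVb hVn i3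
  -- The map `φ` times the mollified `v` is a legitimate test map for the weak derivative of `gj`.
  -- Mollification preserves the bounds on `v` and `gi`, so dominated convergence removes it
  -- afterwards.
  have heq : ∀ᶠ n in atTop, (∫ x, inner ℝ (mollify n V x) (fderiv ℝ φ x (e2 i) • gj x)) +
      ∫ x, inner ℝ (mollify n G x) (φ x • gj x) = - ∫ x, inner ℝ (mollify n V x) (φ x • H x) := by
    filter_upwards [eventually_forall_closedBall_subset hU h2 h3] with n hn
    have hΨ : ContDiff ℝ (⊤ : ℕ∞) fun x => φ x • mollify n V x := h1.smul (hVn n)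
    have hts : tsupport (fun x => φ x • mollify n V x) ⊆ tsupport φ := by
      apply closure_mono
      intro x hx hx'
      exact hx (by simp [hx'])
    have key := hH.integral_inner_eq hΨ (h2.of_isClosed_subset (isClosed_tsupport _) hts)
      (hts.trans h3)
    rw [← integral_add (intb B V _ n hVb (hVn n) i1) (intb C G _ n hGb (hGn n) i2)]
    have r : ∫ x, inner ℝ (φ x • mollify n V x) (H x) =
        ∫ x, inner ℝ (mollify n V x) (φ x • H x) := by
      congr 1; ext1 x
      rw [real_inner_smul_left, real_inner_smul_right]
    rw [← r, ← key]
    congr 1; ext1 x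
    have hd : HasFDerivAt (fun x => φ x • mollify n V x) _ x :=
      HasFDerivAt.fun_smul (h1.differentiable (by simp) x).hasFDerivAt
        ((hVn n).differentiable (by simp) x).hasFDerivAt
    rw [hd.fderiv]
    simp only [add_apply, smul_apply,
      ContinuousLinearMap.smulRight_apply]
    rw [inner_add_left, real_inner_smul_left, real_inner_smul_left, real_inner_smul_right,
      real_inner_smul_right]
    by_cases hx : x ∈ tsupport φ
    · rw [fderiv_mollify_eq hU hgi hv (hn x hx)]
      ring
    · rw [image_eq_zero_of_notMem_tsupport hx]
      ring
  have fin := tendsto_nhds_unique ((l1.add l2).congr' heq) l3.neg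
  have c1 : ∫ x, φ x * inner ℝ (gi x) (gj x) = ∫ x, inner ℝ (G x) (φ x • gj x) := by
    congr 1; ext1 x
    rw [smul_inner]
    by_cases hx : x ∈ U
    · simp [hG, hx]
    · rw [image_eq_zero_of_notMem_tsupport fun h => hx (h3 h)]; simp
  have c2 : ∫ x, fderiv ℝ φ x (e2 i) * inner ℝ (v x) (gj x) =
      ∫ x, inner ℝ (V x) (fderiv ℝ φ x (e2 i) • gj x) := by
    congr 1; ext1 x
    rw [smul_inner]
    by_cases hx : x ∈ U
    · simp [hV, hx]
    · have : fderiv ℝ φ x (e2 i) = 0 :=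
        image_eq_zero_of_notMem_tsupport (f := fun x => fderiv ℝ φ x (e2 i)) fun h => hx (hds h)
      rw [this]; simp
  have c3 : ∫ x, φ x * inner ℝ (v x) (H x) = ∫ x, inner ℝ (V x) (φ x • H x) := by
    congr 1; ext1 x
    rw [smul_inner]
    by_cases hx : x ∈ U
    · simp [hV, hx]
    · rw [image_eq_zero_of_notMem_tsupport fun h => hx (h3 h)]; simp
  rw [c1, c2, c3]
  linarith

end BoundedGradient

/-! ### The interpolation estimate on a triangle -/

section Interpolation

/-- Balls are convex, so a bound on the vertices persists on the hull. Comparing the values at the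
antipodal points `x ± ρ • e` then bounds `2 * ρ` times the slope by `2 * m`. -/
theorem norm_linear_le_of_norm_le_on_vertices {s : Set R2} {x : R2} {ρ m : ℝ} (hρ : 0 < ρ)
    (hball : Metric.closedBall x ρ ⊆ convexHull ℝ s) (L : R2 →ᵃ[ℝ] R3)
    (hL : ∀ z ∈ s, ‖L z‖ ≤ m) {e : R2} (he : ‖e‖ = 1) : ‖L.linear e‖ ≤ m / ρ := by
  have hsub : convexHull ℝ s ⊆ L ⁻¹' Metric.closedBall 0 m := by
    apply convexHull_min
    · intro z hz
      simpa using hL z hz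
    · exact (convex_closedBall 0 m).affine_preimage L
  have hm : ∀ y ∈ Metric.closedBall x ρ, ‖L y‖ ≤ m := fun y hy => by
    simpa using hsub (hball hy)
  have h1 := hm (x + ρ • e) (by simp [norm_smul, he, abs_of_pos hρ])
  have h2 := hm (x - ρ • e) (by simp [norm_smul, he, abs_of_pos hρ])
  have h3 : L (x + ρ • e) - L (x - ρ • e) = (2 * ρ) • L.linear e := by
    have := L.linearMap_vsub (x + ρ • e) (x - ρ • e)
    rw [vsub_eq_sub, vsub_eq_sub] at this
    rw [← this, ← map_smul]
    congr 1
    module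
  have h4 : ‖(2 * ρ) • L.linear e‖ ≤ m + m := by
    rw [← h3]
    exact (norm_sub_le _ _).trans (add_le_add h1 h2)
  rw [norm_smul, Real.norm_of_nonneg (by positivity)] at h4
  rw [le_div_iff₀ hρ]
  linarith

theorem clm_apply_eq_sum (A : R2 →L[ℝ] R3) (h : R2) : A h = ∑ j : Fin 2, h j • A (e2 j) := by
  conv_lhs => rw [eq_smul_e2_add h]
  rw [map_add, map_smul, map_smul, Fin.sum_univ_two]

/-- Taylor's formula with integral remainder for functions whose first and second partial
derivatives are known on a convex set. -/
theorem norm_taylor_remainder_le {T : Set R2} (hT : Convex ℝ T) {f : R2 → R3}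
    {G : Fin 2 → R2 → R3} {H : Fin 2 → Fin 2 → R2 → R3} (hf : ContDiff ℝ (⊤ : ℕ∞) f)
    (hG : ∀ j, ContDiff ℝ (⊤ : ℕ∞) (G j)) (hH : ∀ i j, Continuous (H i j))
    (hfG : ∀ x ∈ T, ∀ j, fderiv ℝ f x (e2 j) = G j x)
    (hGH : ∀ x ∈ T, ∀ i j, fderiv ℝ (G j) x (e2 i) = H i j x) {x z : R2} (hx : x ∈ T) (hz : z ∈ T)
    {d : ℝ} (hd : ‖z - x‖ ≤ d) :
    ‖f z - f x - fderiv ℝ f x (z - x)‖ ≤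
      d ^ 2 * ∫ s in (0 : ℝ)..1, (1 - s) * ∑ p : Fin 2 × Fin 2, ‖H p.1 p.2 (x + s • (z - x))‖ := by
  set y := z - x with hy
  have hmem : ∀ s ∈ Icc (0 : ℝ) 1, x + s • y ∈ T := by
    intro s hs
    have := hT.add_smul_sub_mem hx hz hs
    simpa [hy] using this
  have hpath : ∀ s : ℝ, HasDerivAt (fun s : ℝ => x + s • y) y s := fun s => by
    simpa using ((hasDerivAt_id s).smul_const y).const_add x
  have hfd : ∀ s : ℝ, HasDerivAt (fun s : ℝ => f (x + s • y)) (fderiv ℝ f (x + s • y) y) s :=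
    fun s => (hf.differentiable (by simp) _).hasFDerivAt.comp_hasDerivAt s (hpath s)
  have hGd : ∀ j, ∀ s : ℝ, HasDerivAt (fun s : ℝ => G j (x + s • y))
      (fderiv ℝ (G j) (x + s • y) y) s :=
    fun j s => ((hG j).differentiable (by simp) _).hasFDerivAt.comp_hasDerivAt s (hpath s)
  -- With `F s = f (x + s • y)` this is the function `(1 - s) F' + F`, whose derivative is `(1 - s)
  -- F''`. Its increment over the unit interval is exactly the Taylor remainder.
  have hder : ∀ s ∈ uIcc (0 : ℝ) 1, HasDerivAt
      (fun s : ℝ => (1 - s) • ∑ j, y j • G j (x + s • y) + f (x + s • y))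
      ((1 - s) • ∑ j, ∑ i, (y j * y i) • H i j (x + s • y)) s := by
    intro s hs
    rw [uIcc_of_le zero_le_one] at hs
    have h1 : HasDerivAt (fun s : ℝ => ∑ j, y j • G j (x + s • y))
        (∑ j, y j • fderiv ℝ (G j) (x + s • y) y) s :=
      HasDerivAt.fun_sum fun j _ => (hGd j s).const_smul (y j)
    have h2 : HasDerivAt (fun s : ℝ => 1 - s) (-1) s := by
      simpa using (hasDerivAt_id s).const_sub 1
    refine ((h2.fun_smul h1).add (hfd s)).congr_deriv ?_
    have e1 : fderiv ℝ f (x + s • y) y = ∑ j, y j • G j (x + s • y) := by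
      rw [clm_apply_eq_sum]
      simp_rw [hfG _ (hmem s hs)]
    have e3 : ∀ j, fderiv ℝ (G j) (x + s • y) y = ∑ i, y i • H i j (x + s • y) := by
      intro j
      rw [clm_apply_eq_sum]
      simp_rw [hGH _ (hmem s hs)]
    rw [e1]
    simp_rw [e3, Finset.smul_sum, smul_smul]
    simp
    abel
  have hcont : Continuous fun s : ℝ => (1 - s) • ∑ j, ∑ i, (y j * y i) • H i j (x + s • y) := by
    have : ∀ i j, Continuous fun s : ℝ => H i j (x + s • y) := fun i j =>
      (hH i j).comp (by fun_prop)
    fun_prop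
  have hInt := intervalIntegral.integral_eq_sub_of_hasDerivAt hder (hcont.intervalIntegrable 0 1)
  have hval : f z - f x - fderiv ℝ f x y =
      ∫ s in (0 : ℝ)..1, (1 - s) • ∑ j, ∑ i, (y j * y i) • H i j (x + s • y) := by
    rw [hInt, clm_apply_eq_sum]
    simp_rw [hfG x hx]
    simp [hy]
    abel
  rw [hval, ← intervalIntegral.integral_const_mul]
  apply intervalIntegral.norm_integral_le_of_norm_le zero_le_one
  · refine Eventually.of_forall fun s hs => ?_
    have hs1 : 0 ≤ 1 - s := by linarith [hs.2]
    rw [norm_smul, Real.norm_of_nonneg hs1, mul_left_comm]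
    refine mul_le_mul_of_nonneg_left ?_ hs1
    rw [Finset.mul_sum, Fintype.sum_prod_type_right]
    refine (norm_sum_le _ _).trans (Finset.sum_le_sum fun j _ => ?_)
    refine (norm_sum_le _ _).trans (Finset.sum_le_sum fun i _ => ?_)
    rw [norm_smul, norm_mul]
    have h1 : ‖y j‖ ≤ d := (PiLp.norm_apply_le y j).trans hd
    have h2 : ‖y i‖ ≤ d := (PiLp.norm_apply_le y i).trans hd
    have h0 : 0 ≤ d := (norm_nonneg _).trans hd
    refine mul_le_mul_of_nonneg_right ?_ (norm_nonneg _)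
    rw [pow_two]
    exact mul_le_mul h1 h2 (norm_nonneg _) h0
  · have : ∀ i j, Continuous fun s : ℝ => H i j (x + s • y) := fun i j =>
      (hH i j).comp (by fun_prop)
    apply Continuous.intervalIntegrable
    fun_prop

/-- Contracting a convex set towards one of its points. -/
theorem lintegral_contraction_le {T : Set R2} (hT : Convex ℝ T) (hTm : MeasurableSet T) {z : R2}
    (hz : z ∈ T) {F : R2 → ℝ≥0∞} (hF : Measurable F) {s : ℝ} (hs0 : 0 ≤ s) (hs1 : s < 1) :
    ∫⁻ x in T, ENNReal.ofReal ((1 - s) ^ 2) * F (x + s • (z - x)) ≤ ∫⁻ x in T, F x := by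
  have hr : (0 : ℝ) < 1 - s := by linarith
  -- Scaling the plane by `1 - s` has Jacobian `(1 - s) ^ 2`, which is the weight in the statement;
  -- the contraction maps `T` into itself by convexity.
  have hmap : ∫⁻ x, T.indicator F ((1 - s) • x + s • z) =
      ENNReal.ofReal (((1 - s) ^ 2)⁻¹) * ∫⁻ x, T.indicator F x := by
    have h1 : ∫⁻ x, T.indicator F ((1 - s) • x + s • z) =
        ∫⁻ y, T.indicator F (y + s • z) ∂(Measure.map ((1 - s) • ·) (volume : Measure R2)) := by
      rw [lintegral_map]
      · exact (hF.indicator hTm).comp (measurable_add_const _)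
      · exact measurable_const_smul _
    rw [h1, Measure.map_addHaar_smul _ hr.ne', lintegral_smul_measure,
      lintegral_add_right_eq_self (T.indicator F) (s • z)]
    simp [abs_of_pos hr, smul_eq_mul]
  calc ∫⁻ x in T, ENNReal.ofReal ((1 - s) ^ 2) * F (x + s • (z - x))
      ≤ ∫⁻ x, ENNReal.ofReal ((1 - s) ^ 2) * T.indicator F ((1 - s) • x + s • z) := by
        rw [← lintegral_indicator hTm]
        apply lintegral_mono
        intro x
        by_cases hx : x ∈ T
        · have hm : (1 - s) • x + s • z ∈ T := hT hx hz hr.le hs0 (by ring)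
          have : x + s • (z - x) = (1 - s) • x + s • z := by module
          simp only [indicator_of_mem hx, indicator_of_mem hm, this]
          exact le_rfl
        · simp [hx]
    _ = ∫⁻ x in T, F x := by
        rw [lintegral_const_mul' _ _ ENNReal.ofReal_ne_top, hmap, ← mul_assoc,
          ← ENNReal.ofReal_mul (by positivity), mul_inv_cancel₀ (by positivity),
          ENNReal.ofReal_one, one_mul, lintegral_indicator hTm]

/-- Jensen on the unit interval and Tonelli reduce this to fixed `s`. The squared Taylor weight `(1
- s) ^ 2` is precisely the Jacobian of the contraction towards `z`, so no singularity remains at the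
vertex. -/
theorem lintegral_sq_interval_average_le {T : Set R2} (hT : Convex ℝ T) (hTm : MeasurableSet T)
    {z : R2} (hz : z ∈ T) {N : R2 → ℝ} (hN : Continuous N) (hN0 : ∀ x, 0 ≤ N x) :
    ∫⁻ x in T, ENNReal.ofReal ((∫ s in (0 : ℝ)..1, (1 - s) * N (x + s • (z - x))) ^ 2) ≤
      ∫⁻ x in T, ENNReal.ofReal (N x ^ 2) := by
  -- The open interval excludes `s = 1`, where the contraction degenerates.
  set ν : Measure ℝ := volume.restrict (Ioo 0 1) with hν
  have : IsProbabilityMeasure ν := ⟨by simp [hν]⟩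
  have hcont : Continuous fun p : R2 × ℝ => N (p.1 + p.2 • (z - p.1)) := hN.comp (by fun_prop)
  have h1 : ∀ x, ENNReal.ofReal ((∫ s in (0 : ℝ)..1, (1 - s) * N (x + s • (z - x))) ^ 2) ≤
      ∫⁻ s, ENNReal.ofReal ((1 - s) ^ 2) * ENNReal.ofReal (N (x + s • (z - x)) ^ 2) ∂ν := by
    intro x
    have hc : Continuous fun s : ℝ => (1 - s) * N (x + s • (z - x)) := by
      have : Continuous fun s : ℝ => N (x + s • (z - x)) := hN.comp (by fun_prop)
      fun_prop
    have hnn : 0 ≤ᵐ[ν] fun s : ℝ => (1 - s) * N (x + s • (z - x)) := by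
      filter_upwards [ae_restrict_mem measurableSet_Ioo] with s hs
      exact mul_nonneg (by linarith [hs.2]) (hN0 _)
    have e1 : ∫ s in (0 : ℝ)..1, (1 - s) * N (x + s • (z - x)) =
        ∫ s, (1 - s) * N (x + s • (z - x)) ∂ν := by
      rw [intervalIntegral.integral_of_le zero_le_one, integral_Ioc_eq_integral_Ioo]
    rw [e1, ENNReal.ofReal_pow (integral_nonneg_of_ae hnn), ofReal_integral_eq_lintegral_ofReal _ hnn]
    · refine (lintegral_sq_le_of_isProbabilityMeasure ν
        hc.measurable.ennreal_ofReal.aemeasurable).trans ?_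
      apply lintegral_mono_ae
      filter_upwards [hnn] with s hs
      rw [← ENNReal.ofReal_pow hs, ← ENNReal.ofReal_mul (sq_nonneg _), mul_pow]
    · exact (hc.integrableOn_Icc).mono_set Ioo_subset_Icc_self
  calc _ ≤ ∫⁻ x in T, ∫⁻ s, ENNReal.ofReal ((1 - s) ^ 2) *
        ENNReal.ofReal (N (x + s • (z - x)) ^ 2) ∂ν := lintegral_mono h1
    _ = ∫⁻ s, (∫⁻ x in T, ENNReal.ofReal ((1 - s) ^ 2) *
        ENNReal.ofReal (N (x + s • (z - x)) ^ 2)) ∂ν := by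
      apply lintegral_lintegral_swap
      apply Measurable.aemeasurable
      refine Measurable.mul (f := fun p : R2 × ℝ => ENNReal.ofReal ((1 - p.2) ^ 2))
        (g := fun p : R2 × ℝ => ENNReal.ofReal (N (p.1 + p.2 • (z - p.1)) ^ 2)) ?_ ?_
      · exact Measurable.ennreal_ofReal (by fun_prop)
      · exact (hcont.pow 2).measurable.ennreal_ofReal
    _ ≤ ∫⁻ _, (∫⁻ x in T, ENNReal.ofReal (N x ^ 2)) ∂ν := by
      apply lintegral_mono_ae
      filter_upwards [ae_restrict_mem measurableSet_Ioo] with s hs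
      exact lintegral_contraction_le (F := fun y => ENNReal.ofReal (N y ^ 2)) hT hTm hz
        (hN.pow 2).measurable.ennreal_ofReal hs.1.le hs.2
    _ = _ := by simp

/-- Continuity from above of the finite measure with density `‖f‖ ^ 2`; closedness of `T` makes it
the intersection of its thickenings. -/
theorem tendsto_lintegral_cthickening {T : Set R2} (hT : IsClosed T) {f : R2 → R3}
    (hf : MemLp f 2 volume) :
    Tendsto (fun n : ℕ => ∫⁻ x in Metric.cthickening (1 / ((n : ℝ) + 1)) T, ‖f x‖ₑ ^ 2) atTop
      (𝓝 (∫⁻ x in T, ‖f x‖ₑ ^ 2)) := by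
  set μ : Measure R2 := volume.withDensity fun x => ‖f x‖ₑ ^ 2 with hμ
  have hfin : μ univ ≠ ∞ := by
    rw [hμ, withDensity_apply _ MeasurableSet.univ, Measure.restrict_univ]
    have := (hf.eLpNorm_lt_top).ne
    rw [eLpNorm_eq_lintegral_rpow_enorm_toReal (by simp) (by simp)] at this
    intro h
    apply this
    simp only [ENNReal.toReal_ofNat, ENNReal.rpow_ofNat, one_div]
    rw [h, ENNReal.top_rpow_of_pos (by norm_num)]
  have h1 := tendsto_measure_cthickening_of_isClosed (μ := μ) (s := T)
    ⟨1, one_pos, ne_top_of_le_ne_top hfin (measure_mono (subset_univ _))⟩ hT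
  have h2 := h1.comp (tendsto_one_div_add_atTop_nhds_zero_nat (𝕜 := ℝ))
  rw [hμ, withDensity_apply _ hT.measurableSet] at h2
  refine h2.congr fun n => ?_
  rw [Function.comp_apply, withDensity_apply _ Metric.isClosed_cthickening.measurableSet]

/-- The error estimate for nodal interpolation on a triangle of diameter at most `d` that contains a
disc of radius `ρ`. -/
theorem lintegral_interpolation_error_le {U : Set R2} (hU : IsOpen U) {v w : R2 → R3}
    {g : Fin 2 → R2 → R3} {H : Fin 2 → Fin 2 → R2 → R3} (hv : IntegrableOn v U volume)
    (hgi : ∀ i, IntegrableOn (g i) U volume) (hHi : ∀ i j, MemLp (H i j) 2 (volume.restrict U))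
    (hg : ∀ i, HasWeakPartial U i v (g i)) (hH : ∀ i j, HasWeakPartial U i (g j) (H i j))
    (hw : IsContRep U v w) {t : Finset R2} (ht : t.card = 3) {x₀ : R2} {ρ d : ℝ} (hρ : 0 < ρ)
    (hball : Metric.closedBall x₀ ρ ⊆ convexHull ℝ (t : Set R2))
    (htU : convexHull ℝ (t : Set R2) ⊆ U) (hd : Metric.diam (convexHull ℝ (t : Set R2)) ≤ d)
    (A : R2 →ᵃ[ℝ] R3) (hA : ∀ z ∈ t, A z = w z) (j : Fin 2) :
    ∫⁻ x in convexHull ℝ (t : Set R2), ‖A.linear (e2 j) - g j x‖ₑ ^ 2 ≤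
      ENNReal.ofReal (72 * d ^ 4 / ρ ^ 2) *
        ∑ p : Fin 2 × Fin 2, ∫⁻ x in convexHull ℝ (t : Set R2), ‖H p.1 p.2 x‖ₑ ^ 2 := by
  set T := convexHull ℝ (t : Set R2) with hTdef
  have hTc : IsCompact T := t.finite_toSet.isCompact_convexHull (𝕜 := ℝ)
  have hTm : MeasurableSet T := hTc.measurableSet
  have hTconv : Convex ℝ T := convex_convexHull ℝ _
  have htT : ∀ z ∈ t, z ∈ T := fun z hz => subset_convexHull ℝ _ hz
  set V := U.indicator v with hV
  set Gi : Fin 2 → R2 → R3 := fun i => U.indicator (g i) with hGi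
  set Hi : Fin 2 → Fin 2 → R2 → R3 := fun i j => U.indicator (H i j) with hHidef
  have hVint : Integrable V := hv.integrable_indicator hU.measurableSet
  have hGint : ∀ i, Integrable (Gi i) := fun i => (hgi i).integrable_indicator hU.measurableSet
  have hHL2 : ∀ i j, MemLp (Hi i j) 2 volume := fun i j =>
    (memLp_indicator_iff_restrict hU.measurableSet).2 (hHi i j)
  have hHloc : ∀ i j, LocallyIntegrable (Hi i j) volume := fun i j =>
    (hHL2 i j).locallyIntegrable (by norm_num)
  -- The affine map interpolates `w`, while Taylor's formula is applied to the mollification; `δ` is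
  -- the resulting mismatch at the vertices and vanishes in the limit.
  set δ : ℕ → R2 → ℝ := fun n z => ‖w z - mollify n V z‖ with hδ
  have hδlim : ∀ z ∈ t, Tendsto (fun n => δ n z) atTop (𝓝 0) := by
    intro z hz
    have := (hw.tendsto_mollify hU (htU (htT z hz))).const_sub (w z)
    rw [sub_self] at this
    simpa using this.norm
  set N : ℕ → R2 → ℝ := fun n y => ∑ p : Fin 2 × Fin 2, ‖mollify n (Hi p.1 p.2) y‖ with hN
  have hHc : ∀ n i j, Continuous (mollify n (Hi i j)) := fun n i j =>
    (contDiff_mollify n (hHloc i j)).continuous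
  have hNc : ∀ n, Continuous (N n) := fun n => by
    apply continuous_finsetSum
    intro p _
    exact (hHc n p.1 p.2).norm
  have hN0 : ∀ n x, 0 ≤ N n x := fun n x => Finset.sum_nonneg fun p _ => norm_nonneg _
  set J : ℕ → R2 → R2 → ℝ := fun n z x =>
    ∫ s in (0 : ℝ)..1, (1 - s) * N n (x + s • (z - x)) with hJ
  have hJ0 : ∀ n z x, 0 ≤ J n z x := fun n z x =>
    intervalIntegral.integral_nonneg zero_le_one fun s hs =>
      mul_nonneg (by linarith [hs.2]) (hN0 _ _)
  have hd0 : 0 ≤ d := Metric.diam_nonneg.trans hd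
  -- pointwise estimate
  have hpt : ∀ᶠ n in atTop, ∀ x ∈ T, ‖A.linear (e2 j) - mollify n (Gi j) x‖ ^ 2 ≤
      ∑ z ∈ t, (6 / ρ ^ 2 * δ n z ^ 2 + 6 * d ^ 4 / ρ ^ 2 * J n z x ^ 2) := by
    filter_upwards [eventually_forall_closedBall_subset hU hTc htU] with n hn x hx
    have hf := contDiff_mollify n hVint.locallyIntegrable
    have htay : ∀ z ∈ t, ‖mollify n V z - mollify n V x - fderiv ℝ (mollify n V) x (z - x)‖ ≤
        d ^ 2 * J n z x := by
      intro z hz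
      apply norm_taylor_remainder_le (G := fun j => mollify n (Gi j))
        (H := fun i j => mollify n (Hi i j)) hTconv hf
        (fun j => contDiff_mollify n (hGint j).locallyIntegrable) (hHc n) ?_ ?_ hx (htT z hz)
      · rw [← dist_eq_norm]
        exact (Metric.dist_le_diam_of_mem hTc.isBounded (htT z hz) hx).trans hd
      · intro y hy j
        exact fderiv_mollify_eq hU (hg j) hv (hn y hy)
      · intro y hy i j
        exact fderiv_mollify_eq hU (hH i j) (hgi j) (hn y hy)
    set D := fderiv ℝ (mollify n V) x with hD
    -- The affine map minus the first-order Taylor polynomial at `x`. At a vertex it is the mismatch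
    -- plus the Taylor remainder, and its slope is the gradient error at `x`.
    set L : R2 →ᵃ[ℝ] R3 := A - (D : R2 →ₗ[ℝ] R3).toAffineMap -
      AffineMap.const ℝ R2 (mollify n V x - D x) with hL
    have hLz : ∀ z ∈ t, ‖L z‖ ≤ ∑ z ∈ t, (δ n z + d ^ 2 * J n z x) := by
      intro z hz
      have e1 : L z = (w z - mollify n V z) + (mollify n V z - mollify n V x - D (z - x)) := by
        simp only [hL, AffineMap.coe_sub, Pi.sub_apply, hA z hz, LinearMap.coe_toAffineMap,
          AffineMap.const_apply, map_sub]
        simp only [ContinuousLinearMap.coe_coe]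
        abel
      rw [e1]
      refine (norm_add_le _ _).trans ((add_le_add le_rfl (htay z hz)).trans ?_)
      exact Finset.single_le_sum (f := fun z => δ n z + d ^ 2 * J n z x)
        (fun z _ => add_nonneg (norm_nonneg _) (mul_nonneg (sq_nonneg _) (hJ0 n z x))) hz
    have hlin : L.linear (e2 j) = A.linear (e2 j) - mollify n (Gi j) x := by
      have : D (e2 j) = mollify n (Gi j) x := fderiv_mollify_eq hU (hg j) hv (hn x hx)
      simp [hL, this]
    have hb := norm_linear_le_of_norm_le_on_vertices hρ hball L hLz
      (show ‖e2 j‖ = 1 by simp)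
    rw [hlin] at hb
    have hsum : (∑ z ∈ t, (δ n z + d ^ 2 * J n z x)) ^ 2 ≤
        3 * ∑ z ∈ t, (δ n z + d ^ 2 * J n z x) ^ 2 := by
      have := sq_sum_le_card_mul_sum_sq (s := t) (f := fun z => δ n z + d ^ 2 * J n z x)
      rw [ht] at this
      exact_mod_cast this
    -- The factor 6 is 3, from Cauchy–Schwarz over the three vertices, times 2, from separating the
    -- mismatch and the remainder.
    calc ‖A.linear (e2 j) - mollify n (Gi j) x‖ ^ 2
        ≤ ((∑ z ∈ t, (δ n z + d ^ 2 * J n z x)) / ρ) ^ 2 := by gcongr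
      _ ≤ (3 * ∑ z ∈ t, (δ n z + d ^ 2 * J n z x) ^ 2) / ρ ^ 2 := by
        rw [div_pow]; gcongr
      _ = ∑ z ∈ t, 3 / ρ ^ 2 * (δ n z + d ^ 2 * J n z x) ^ 2 := by
        rw [Finset.mul_sum, Finset.sum_div]
        exact Finset.sum_congr rfl fun z _ => by ring
      _ ≤ _ := by
        apply Finset.sum_le_sum
        intro z _
        have h1 : (δ n z + d ^ 2 * J n z x) ^ 2 ≤ 2 * δ n z ^ 2 + 2 * (d ^ 2 * J n z x) ^ 2 := by
          nlinarith [sq_nonneg (δ n z - d ^ 2 * J n z x)]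
        calc 3 / ρ ^ 2 * (δ n z + d ^ 2 * J n z x) ^ 2
            ≤ 3 / ρ ^ 2 * (2 * δ n z ^ 2 + 2 * (d ^ 2 * J n z x) ^ 2) := by gcongr
          _ = _ := by ring
  -- integrated estimate
  have hInt : ∀ᶠ n in atTop, ∫⁻ x in T, ‖A.linear (e2 j) - mollify n (Gi j) x‖ₑ ^ 2 ≤
      ∑ z ∈ t, (ENNReal.ofReal (6 / ρ ^ 2 * δ n z ^ 2) * volume T +
        ENNReal.ofReal (24 * d ^ 4 / ρ ^ 2) * ∑ p : Fin 2 × Fin 2,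
          ∫⁻ x in Metric.cthickening (1 / ((n : ℝ) + 1)) T, ‖Hi p.1 p.2 x‖ₑ ^ 2) := by
    filter_upwards [hpt] with n hn
    have hJm : ∀ z, Measurable fun x => ENNReal.ofReal (J n z x ^ 2) := by
      intro z
      have hc : Continuous fun p : R2 × ℝ => (1 - p.2) * N n (p.1 + p.2 • (z - p.1)) := by
        have : Continuous fun p : R2 × ℝ => N n (p.1 + p.2 • (z - p.1)) :=
          (hNc n).comp (by fun_prop)
        fun_prop
      have : Continuous (J n z) :=
        intervalIntegral.continuous_parametric_intervalIntegral_of_continuous' hc 0 1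
      exact (this.pow 2).measurable.ennreal_ofReal
    -- The 4 counts the second partial derivatives. Together with the 6 above it gives 24 per
    -- vertex, and summing over three vertices gives the 72 of the statement.
    have hNsq : ∫⁻ x in T, ENNReal.ofReal (N n x ^ 2) ≤ 4 * ∑ p : Fin 2 × Fin 2,
        ∫⁻ x in Metric.cthickening (1 / ((n : ℝ) + 1)) T, ‖Hi p.1 p.2 x‖ₑ ^ 2 := by
      calc _ ≤ ∫⁻ x in T, 4 * ∑ p : Fin 2 × Fin 2, ‖mollify n (Hi p.1 p.2) x‖ₑ ^ 2 := by
            apply lintegral_mono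
            intro x
            have h4 : N n x ^ 2 ≤ 4 * ∑ p : Fin 2 × Fin 2, ‖mollify n (Hi p.1 p.2) x‖ ^ 2 := by
              have := sq_sum_le_card_mul_sum_sq (s := (Finset.univ : Finset (Fin 2 × Fin 2)))
                (f := fun p => ‖mollify n (Hi p.1 p.2) x‖)
              simpa using this
            refine (ENNReal.ofReal_le_ofReal h4).trans ?_
            rw [ENNReal.ofReal_mul (by norm_num), ENNReal.ofReal_sum_of_nonneg
              (fun p _ => by positivity)]
            simp only [ENNReal.ofReal_ofNat]
            refine mul_le_mul_right (Finset.sum_le_sum fun p _ => ?_) _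
            rw [ENNReal.ofReal_pow (norm_nonneg _), ofReal_norm]
        _ = 4 * ∑ p : Fin 2 × Fin 2, ∫⁻ x in T, ‖mollify n (Hi p.1 p.2) x‖ₑ ^ 2 := by
            rw [lintegral_const_mul' _ _ (by simp), lintegral_finsetSum]
            intro p _
            exact ((hHc n p.1 p.2).enorm.measurable).pow_const 2
        _ ≤ _ := by
            refine mul_le_mul_right (Finset.sum_le_sum fun p _ => ?_) _
            exact lintegral_mollify_sq_le n (hHL2 p.1 p.2).aestronglyMeasurable hTm
    calc ∫⁻ x in T, ‖A.linear (e2 j) - mollify n (Gi j) x‖ₑ ^ 2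
        ≤ ∫⁻ x in T, ∑ z ∈ t, (ENNReal.ofReal (6 / ρ ^ 2 * δ n z ^ 2) +
          ENNReal.ofReal (6 * d ^ 4 / ρ ^ 2) * ENNReal.ofReal (J n z x ^ 2)) := by
          apply setLIntegral_mono' hTm
          intro x hx
          rw [← ofReal_norm, ← ENNReal.ofReal_pow (norm_nonneg _)]
          refine (ENNReal.ofReal_le_ofReal (hn x hx)).trans ?_
          rw [ENNReal.ofReal_sum_of_nonneg (fun z _ => by positivity)]
          apply Finset.sum_le_sum
          intro z _
          rw [ENNReal.ofReal_add (by positivity) (by positivity),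
            ← ENNReal.ofReal_mul (by positivity)]
      _ = ∑ z ∈ t, (ENNReal.ofReal (6 / ρ ^ 2 * δ n z ^ 2) * volume T +
          ENNReal.ofReal (6 * d ^ 4 / ρ ^ 2) * ∫⁻ x in T, ENNReal.ofReal (J n z x ^ 2)) := by
          rw [lintegral_finsetSum]
          · refine Finset.sum_congr rfl fun z _ => ?_
            rw [lintegral_add_left measurable_const, lintegral_const_mul' _ _ ENNReal.ofReal_ne_top]
            simp
          · intro z _
            exact measurable_const.add ((hJm z).const_mul _)
      _ ≤ _ := by
          apply Finset.sum_le_sum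
          intro z hz
          refine add_le_add le_rfl ?_
          calc _ ≤ ENNReal.ofReal (6 * d ^ 4 / ρ ^ 2) * (4 * ∑ p : Fin 2 × Fin 2,
                ∫⁻ x in Metric.cthickening (1 / ((n : ℝ) + 1)) T, ‖Hi p.1 p.2 x‖ₑ ^ 2) := by
                refine mul_le_mul_right ?_ _
                exact (lintegral_sq_interval_average_le hTconv hTm (htT z hz) (hNc n)
                  (hN0 n)).trans hNsq
            _ = _ := by
                rw [← mul_assoc]
                congr 1
                rw [show (4 : ℝ≥0∞) = ENNReal.ofReal 4 by simp, ← ENNReal.ofReal_mul (by positivity)]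
                congr 1
                ring
  -- passage to the limit
  have hrhs : Tendsto (fun n : ℕ => ∑ z ∈ t, (ENNReal.ofReal (6 / ρ ^ 2 * δ n z ^ 2) * volume T +
        ENNReal.ofReal (24 * d ^ 4 / ρ ^ 2) * ∑ p : Fin 2 × Fin 2,
          ∫⁻ x in Metric.cthickening (1 / ((n : ℝ) + 1)) T, ‖Hi p.1 p.2 x‖ₑ ^ 2)) atTop
      (𝓝 (∑ _z ∈ t, (0 + ENNReal.ofReal (24 * d ^ 4 / ρ ^ 2) * ∑ p : Fin 2 × Fin 2,
          ∫⁻ x in T, ‖Hi p.1 p.2 x‖ₑ ^ 2))) := by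
    apply tendsto_finsetSum
    intro z hz
    apply Tendsto.add
    · have h1 : Tendsto (fun n => 6 / ρ ^ 2 * δ n z ^ 2) atTop (𝓝 0) := by
        simpa using ((hδlim z hz).pow 2).const_mul (6 / ρ ^ 2)
      have h2 := ENNReal.tendsto_ofReal h1
      rw [ENNReal.ofReal_zero] at h2
      simpa using ENNReal.Tendsto.mul_const h2 (Or.inr hTc.measure_lt_top.ne)
    · apply ENNReal.Tendsto.const_mul _ (Or.inr ENNReal.ofReal_ne_top)
      apply tendsto_finsetSum
      intro p _
      exact tendsto_lintegral_cthickening hTc.isClosed (hHL2 p.1 p.2)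
  -- Only an upper bound is wanted, so Fatou with almost everywhere convergence of the mollified
  -- gradient suffices on the left.
  have hfatou : ∫⁻ x in T, ‖A.linear (e2 j) - g j x‖ₑ ^ 2 ≤
      liminf (fun n => ∫⁻ x in T, ‖A.linear (e2 j) - mollify n (Gi j) x‖ₑ ^ 2) atTop := by
    refine le_trans ?_ (lintegral_liminf_le' fun n => ?_)
    · apply lintegral_mono_ae
      filter_upwards [ae_restrict_of_ae (ae_tendsto_mollify (hGint j).locallyIntegrable),
        ae_restrict_mem hTm] with x hx hxT
      have h1 : Tendsto (fun n => ‖A.linear (e2 j) - mollify n (Gi j) x‖ₑ ^ 2) atTop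
          (𝓝 (‖A.linear (e2 j) - Gi j x‖ₑ ^ 2)) :=
        ((ENNReal.continuous_pow 2).tendsto _).comp ((hx.const_sub _).enorm)
      rw [h1.liminf_eq]
      simp [hGi, htU hxT]
    · have : Continuous (mollify n (Gi j)) :=
        (contDiff_mollify n (hGint j).locallyIntegrable).continuous
      exact ((continuous_const.sub this).enorm.measurable.pow_const 2).aemeasurable
  refine hfatou.trans ?_
  refine (liminf_le_liminf hInt).trans ?_
  rw [hrhs.liminf_eq, Finset.sum_const, ht, zero_add, nsmul_eq_mul, ← mul_assoc]
  apply le_of_eq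
  congr 1
  · rw [show ((3 : ℕ) : ℝ≥0∞) = ENNReal.ofReal 3 by simp, ← ENNReal.ofReal_mul (by norm_num)]
    congr 1
    ring
  · refine Finset.sum_congr rfl fun p _ => setLIntegral_congr_fun hTm fun x hx => ?_
    simp [hHidef, htU hx]

end Interpolation

/-! ### Lipschitz domains -/

section LipschitzDomain

/-- A Lipschitz domain has no slits: moving a boundary point across the graph lands in an open set
disjoint from the domain, so the point is not interior to the closure. -/
theorem IsLipschitzDomain.interior_closure_subset {Ω : Set R2} (h : IsLipschitzDomain Ω) :
    interior (closure Ω) ⊆ Ω := by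
  intro x hx
  by_contra hxΩ
  have hfr : x ∈ frontier Ω := by
    rw [h.1.frontier_eq]
    exact ⟨interior_subset hx, hxΩ⟩
  obtain ⟨e, L, g, r, hg, hr, hiff⟩ := h.2.2.2 x hfr
  have hgc : Continuous g := hg.continuous
  set u : R2 := e.symm (e2 1) with hu
  have hlim : Tendsto (fun τ : ℝ => x + τ • u) (𝓝[>] 0) (𝓝 x) := by
    have : Continuous fun τ : ℝ => x + τ • u := by fun_prop
    have h2 := this.tendsto 0
    rw [zero_smul, add_zero] at h2
    exact h2.mono_left nhdsWithin_le_nhds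
  have hev : ∀ᶠ τ : ℝ in 𝓝[>] 0, x + τ • u ∈ interior (closure Ω) ∩ Metric.ball x r :=
    hlim.eventually (inter_mem (isOpen_interior.mem_nhds hx) (Metric.ball_mem_nhds x hr))
  obtain ⟨τ, ⟨hτ1, hτ2⟩, hτ0⟩ := (hev.and self_mem_nhdsWithin).exists
  have hτ0 : 0 < τ := hτ0
  have hx1 : g ((e x) 0) ≤ (e x) 1 := by
    have := (hiff x (Metric.mem_ball_self hr)).not.1 hxΩ
    exact not_lt.1 this
  set O : Set R2 := Metric.ball x r ∩ {y | g ((e y) 0) < (e y) 1} with hO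
  have hOo : IsOpen O := by
    apply Metric.isOpen_ball.inter
    apply isOpen_lt
    · exact hgc.comp ((EuclideanSpace.proj (0 : Fin 2) : R2 →L[ℝ] ℝ).continuous.comp e.continuous)
    · exact (EuclideanSpace.proj (1 : Fin 2) : R2 →L[ℝ] ℝ).continuous.comp e.continuous
  have hyO : x + τ • u ∈ O := by
    refine ⟨hτ2, ?_⟩
    have e1 : e (x + τ • u) = e x + τ • e2 1 := by simp [hu]
    simp only [mem_ofPred_eq, e1]
    simp
    linarith
  have hdis : Disjoint O Ω := by
    rw [Set.disjoint_left]
    rintro y ⟨hy1, hy2⟩ hy3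
    have := (hiff y hy1).1 hy3
    exact lt_asymm this hy2
  exact Set.disjoint_left.1 (hdis.closure_right hOo) hyO (interior_subset hτ1)

/-- In graph coordinates take a box that is tall compared with the oscillation of the graph over its
base. Every point of the domain in the box can be joined vertically to a horizontal line below the
graph, and then along this line to the point below `x`. -/
theorem IsLipschitzDomain.exists_isPreconnected_inter {Ω : Set R2} (h : IsLipschitzDomain Ω)
    {x : R2} (hx : x ∈ frontier Ω) {W : Set R2} (hW : W ∈ 𝓝 x) :
    ∃ W' ∈ 𝓝 x, W' ⊆ W ∧ IsPreconnected (W' ∩ Ω) := by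
  obtain ⟨e, L, g, r, hg, hr, hiff⟩ := h.2.2.2 x hx
  obtain ⟨r₀, hr₀, hr₀W⟩ := Metric.mem_nhds_iff.1 (inter_mem hW (Metric.ball_mem_nhds x hr))
  have hgc : Continuous g := hg.continuous
  have hc : ∀ i : Fin 2, Continuous fun y : R2 => (e y) i := fun i =>
    (EuclideanSpace.proj i : R2 →L[ℝ] ℝ).continuous.comp e.continuous
  have hx1 : (e x) 1 ≤ g ((e x) 0) := by
    have hxc : x ∈ closure (Ω ∩ Metric.ball x r) :=
      mem_closure_iff_nhdsWithin_neBot.2 (by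
        rw [inter_comm, nhdsWithin_inter_of_mem (mem_nhdsWithin_of_mem_nhds (Metric.ball_mem_nhds x hr))]
        exact mem_closure_iff_nhdsWithin_neBot.1 (frontier_subset_closure hx))
    have hcl : IsClosed {y : R2 | (e y) 1 ≤ g ((e y) 0)} := isClosed_le (hc 1) (hgc.comp (hc 0))
    refine closure_minimal ?_ hcl hxc
    rintro y ⟨hy1, hy2⟩
    exact ((hiff y hy2).1 hy1).le
  -- Half-width `δ` and half-height `η = 2 (L + 1) δ`: half of `η` exceeds the oscillation `L δ` of
  -- the graph, and `δ + η = r₀` keeps the box in the ball.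
  set δ : ℝ := r₀ / (2 * L + 3) with hδ
  have hL : (0 : ℝ) ≤ L := L.coe_nonneg
  have hδ0 : 0 < δ := by positivity
  set η : ℝ := 2 * (L + 1) * δ with hη
  have hη0 : 0 < η := by positivity
  have hsum : δ + η = r₀ := by
    rw [hη, hδ]; field_simp; ring
  set W' : Set R2 := {y | |(e y) 0 - (e x) 0| < δ ∧ |(e y) 1 - (e x) 1| < η} with hW'
  have hW'ball : W' ⊆ Metric.ball x r₀ := by
    rintro y ⟨hy0, hy1⟩
    rw [Metric.mem_ball, ← e.dist_map, dist_eq_norm]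
    have h2 : e y - e x = (e y - e x) 0 • e2 0 + (e y - e x) 1 • e2 1 := eq_smul_e2_add _
    calc ‖e y - e x‖ ≤ ‖(e y - e x) 0 • e2 0‖ + ‖(e y - e x) 1 • e2 1‖ := by
          conv_lhs => rw [h2]
          exact norm_add_le _ _
      _ = |(e y) 0 - (e x) 0| + |(e y) 1 - (e x) 1| := by simp [norm_smul]
      _ < r₀ := by linarith
  have hW'o : W' ∈ 𝓝 x := by
    apply IsOpen.mem_nhds
    · apply IsOpen.inter
      · exact isOpen_lt ((hc 0).sub continuous_const).abs continuous_const
      · exact isOpen_lt ((hc 1).sub continuous_const).abs continuous_const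
    · simp [hW', hδ0, hη0]
  refine ⟨W', hW'o, fun y hy => (hr₀W (hW'ball hy)).1, ?_⟩
  have hmem : ∀ y, y ∈ W' ∩ Ω ↔ y ∈ W' ∧ (e y) 1 < g ((e y) 0) := fun y => by
    constructor
    · rintro ⟨h1, h2⟩
      exact ⟨h1, (hiff y (hr₀W (hW'ball h1)).2).1 h2⟩
    · rintro ⟨h1, h2⟩
      exact ⟨h1, (hiff y (hr₀W (hW'ball h1)).2).2 h2⟩
  -- points on the base line
  set ℓ : ℝ := (e x) 1 - η / 2 with hℓ
  have hbase : ∀ s, |s - (e x) 0| < δ → ℓ < g s := by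
    intro s hs
    have h1 : dist (g s) (g ((e x) 0)) ≤ L * dist s ((e x) 0) := hg.dist_le_mul _ _
    rw [Real.dist_eq, Real.dist_eq] at h1
    have h2 := (abs_le.1 h1).1
    have h3 : (L : ℝ) * |s - (e x) 0| ≤ L * δ := by gcongr
    have : η / 2 = L * δ + δ := by rw [hη]; ring
    rw [hℓ]
    linarith
  set q : ℝ → R2 := fun s => e.symm (!₂[s, ℓ]) with hq
  have hq0 : ∀ s, (e (q s)) 0 = s := fun s => by simp [hq]
  have hq1 : ∀ s, (e (q s)) 1 = ℓ := fun s => by simp [hq]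
  apply isPreconnected_of_forall (q ((e x) 0))
  intro y hy
  rw [hmem] at hy
  obtain ⟨⟨hy0, hy1⟩, hy2⟩ := hy
  have hcomb : ∀ (a b : ℝ) (z₁ z₂ : R2) (i : Fin 2),
      (e (a • z₁ + b • z₂)) i = a * (e z₁) i + b * (e z₂) i := fun a b z₁ z₂ i => by simp
  refine ⟨segment ℝ (q ((e x) 0)) (q ((e y) 0)) ∪ segment ℝ (q ((e y) 0)) y, ?_, ?_, ?_, ?_⟩
  · rintro z (hz | hz)
    · obtain ⟨a, b, ha, hb, hab, rfl⟩ := hz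
      have z0 : (e (a • q ((e x) 0) + b • q ((e y) 0))) 0 - (e x) 0 =
          b * ((e y) 0 - (e x) 0) := by
        rw [hcomb, hq0, hq0]; linear_combination ((e x) 0) * hab
      have z1 : (e (a • q ((e x) 0) + b • q ((e y) 0))) 1 = ℓ := by
        rw [hcomb, hq1, hq1, ← add_mul, hab, one_mul]
      have hz0 : |(e (a • q ((e x) 0) + b • q ((e y) 0))) 0 - (e x) 0| < δ := by
        rw [z0, abs_mul, abs_of_nonneg hb]
        have hb1 : b ≤ 1 := by linarith
        calc b * |(e y) 0 - (e x) 0| ≤ 1 * |(e y) 0 - (e x) 0| := by gcongr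
          _ < δ := by linarith
      rw [hmem]
      refine ⟨⟨hz0, ?_⟩, ?_⟩
      · rw [z1, hℓ, abs_lt]; constructor <;> linarith
      · rw [z1]; exact hbase _ hz0
    · obtain ⟨a, b, ha, hb, hab, rfl⟩ := hz
      have z0 : (e (a • q ((e y) 0) + b • y)) 0 = (e y) 0 := by
        rw [hcomb, hq0, ← add_mul, hab, one_mul]
      have z1 : (e (a • q ((e y) 0) + b • y)) 1 = a * ℓ + b * (e y) 1 := by
        rw [hcomb, hq1]
      have h3 := abs_lt.1 hy1
      have hconv : ∀ (c : ℝ), ℓ < c → (e y) 1 < c → a * ℓ + b * (e y) 1 < c := by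
        intro c h1 h2
        exact convex_Iio c h1 h2 ha hb hab
      have hconv' : ∀ (c : ℝ), c < ℓ → c < (e y) 1 → c < a * ℓ + b * (e y) 1 := by
        intro c h1 h2
        exact convex_Ioi c h1 h2 ha hb hab
      rw [hmem]
      refine ⟨⟨by rw [z0]; exact hy0, ?_⟩, ?_⟩
      · rw [z1, abs_lt]
        constructor
        · have := hconv' ((e x) 1 - η) (by rw [hℓ]; linarith) (by linarith)
          linarith
        · have := hconv ((e x) 1 + η) (by rw [hℓ]; linarith) (by linarith)
          linarith
      · rw [z0, z1]
        exact hconv _ (hbase _ hy0) hy2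
  · exact Or.inl (left_mem_segment ℝ _ _)
  · exact Or.inr (right_mem_segment ℝ _ _)
  · exact (convex_segment _ _).isPreconnected.union (q ((e y) 0)) (right_mem_segment ℝ _ _)
      (left_mem_segment ℝ _ _) (convex_segment _ _).isPreconnected

end LipschitzDomain

/-! ### Triangles -/

section Triangles

/-- Barycentric coordinates of a nondegenerate triangle. -/
theorem exists_barycentric {t : Finset R2} (hc : t.card = 3)
    (hi : AffineIndependent ℝ ((↑) : t → R2)) :
    ∃ lam : R2 → (R2 →ᵃ[ℝ] ℝ), (∀ z ∈ t, lam z z = 1) ∧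
      (∀ z ∈ t, ∀ y ∈ t, y ≠ z → lam z y = 0) ∧
      (∀ x, x ∈ convexHull ℝ (t : Set R2) ↔ ∀ z ∈ t, 0 ≤ lam z x) ∧
      (∀ x, x ∈ interior (convexHull ℝ (t : Set R2)) ↔ ∀ z ∈ t, 0 < lam z x) := by
  classical
  have hspan : affineSpan ℝ (range ((↑) : t → R2)) = ⊤ := by
    rw [hi.affineSpan_eq_top_iff_card_eq_finrank_add_one]
    simp [hc]
  let b : AffineBasis t ℝ R2 := ⟨(↑), hi, hspan⟩
  have hb : ∀ i : t, b i = (i : R2) := fun i => rfl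
  have hrange : range b = (t : Set R2) := by
    ext x
    simp [hb]
  refine ⟨fun z => if h : z ∈ t then b.coord ⟨z, h⟩ else 0, ?_, ?_, ?_, ?_⟩
  · intro z hz
    simp only [hz, dite_true]
    exact b.coord_apply_eq ⟨z, hz⟩
  · intro z hz y hy hyz
    simp only [hz, dite_true]
    exact b.coord_apply_ne (i := ⟨z, hz⟩) (j := ⟨y, hy⟩) (by simpa using hyz.symm)
  · intro x
    rw [← hrange, b.convexHull_eq_nonneg_coord, mem_ofPred_eq]
    constructor
    · intro h z hz
      simpa only [hz, dite_true] using h ⟨z, hz⟩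
    · intro h i
      simpa only [i.2, dite_true] using h i i.2
  · intro x
    rw [← hrange, b.interior_convexHull, mem_ofPred_eq]
    constructor
    · intro h z hz
      simpa only [hz, dite_true] using h ⟨z, hz⟩
    · intro h i
      simpa only [i.2, dite_true] using h i i.2

/-- The prescribed values are weighted with the barycentric coordinates. -/
theorem exists_affine_interpolant {t : Finset R2} (hi : AffineIndependent ℝ ((↑) : t → R2))
    (hc : t.card = 3) (Q : R2 → R3) : ∃ A : R2 →ᵃ[ℝ] R3, ∀ z ∈ t, A z = Q z := by
  obtain ⟨lam, h1, h2, -, -⟩ := exists_barycentric hc hi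
  refine ⟨∑ z ∈ t, (LinearMap.toSpanSingleton ℝ R3 (Q z)).toAffineMap.comp (lam z),
    fun y hy => ?_⟩
  have : ∀ (s : Finset R2), (∑ z ∈ s, (LinearMap.toSpanSingleton ℝ R3 (Q z)).toAffineMap.comp
      (lam z)) y = ∑ z ∈ s, lam z y • Q z := by
    intro s
    classical
    induction s using Finset.induction_on with
    | empty => simp
    | insert a s ha ih => rw [Finset.sum_insert ha, Finset.sum_insert ha, ← ih]; simp
  rw [this, Finset.sum_eq_single y]
  · rw [h1 y hy, one_smul]
  · intro z hz hzy
    rw [h2 z hz y hy hzy.symm, zero_smul]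
  · exact fun h => absurd hy h

theorem AffineMap.eq_zero_of_mem_convexHull {F : Type*} [AddCommGroup F] [Module ℝ F] {s : Set R2}
    (f : R2 →ᵃ[ℝ] F) (hf : ∀ z ∈ s, f z = 0) {x : R2} (hx : x ∈ convexHull ℝ s) : f x = 0 := by
  have : convexHull ℝ s ⊆ f ⁻¹' {0} :=
    convexHull_min (fun z hz => hf z hz) ((convex_singleton 0).affine_preimage f)
  exact this hx

end Triangles

/-! ### Incidence properties of conforming triangulations -/

namespace Triangulation

variable {ω : Set R2} (T : Triangulation ω)

theorem isCompact_hull (t : Finset R2) : IsCompact (convexHull ℝ (t : Set R2)) :=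
  t.finite_toSet.isCompact_convexHull (𝕜 := ℝ)

/-- There are no hanging nodes: by conformity the point lies in the hull of the common vertices,
where its own barycentric coordinate would vanish if it were not one of them. -/
theorem mem_of_mem_hull {s t : Finset R2} (hs : s ∈ T.tri) (ht : t ∈ T.tri) {z : R2} (hz : z ∈ t)
    (hzs : z ∈ convexHull ℝ (s : Set R2)) : z ∈ s := by
  obtain ⟨lam, h1, h2, -, -⟩ := exists_barycentric (T.card_eq t ht) (T.indep t ht)
  by_contra h
  have := T.conforming s hs t ht ⟨hzs, subset_convexHull ℝ _ hz⟩
  have h0 : lam z z = 0 := (lam z).eq_zero_of_mem_convexHull (fun y hy =>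
    h2 z hz y hy.2 (fun hyz => h (hyz ▸ hy.1))) this
  rw [h1 z hz] at h0
  exact one_ne_zero h0

theorem exists_mem_notMem {s t : Finset R2} (hs : s ∈ T.tri) (ht : t ∈ T.tri) (hst : s ≠ t) :
    ∃ z ∈ t, z ∉ s := by
  by_contra! h
  exact hst (Finset.eq_of_subset_of_card_le h (by rw [T.card_eq s hs, T.card_eq t ht])).symm

/-- Some vertex of `t` is missing from `s`. Its barycentric coordinate vanishes on the common face
but is positive in the interior of `t`. -/
theorem notMem_hull_of_mem_interior {s t : Finset R2} (hs : s ∈ T.tri) (ht : t ∈ T.tri)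
    (hst : s ≠ t) {x : R2} (hx : x ∈ interior (convexHull ℝ (t : Set R2))) :
    x ∉ convexHull ℝ (s : Set R2) := by
  intro hxs
  obtain ⟨lam, h1, h2, -, h4⟩ := exists_barycentric (T.card_eq t ht) (T.indep t ht)
  obtain ⟨z, hzt, hzs⟩ := T.exists_mem_notMem hs ht hst
  have := T.conforming s hs t ht ⟨hxs, interior_subset hx⟩
  have h0 : lam z x = 0 := (lam z).eq_zero_of_mem_convexHull (fun y hy =>
    h2 z hzt y hy.2 (fun hyz => hzs (hyz ▸ hy.1))) this
  have := (h4 x).1 hx z hzt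
  linarith

theorem interior_hull_nonempty {t : Finset R2} (ht : t ∈ T.tri) :
    (interior (convexHull ℝ (t : Set R2))).Nonempty := by
  rw [interior_convexHull_nonempty_iff_affineSpan_eq_top]
  have := (T.indep t ht).affineSpan_eq_top_iff_card_eq_finrank_add_one
  simp only [Subtype.range_coe_subtype, Finset.setOfPred_mem] at this
  rw [this]
  simp [T.card_eq t ht]

theorem hull_subset_closure_interior {t : Finset R2} (ht : t ∈ T.tri) :
    convexHull ℝ (t : Set R2) ⊆ closure (interior (convexHull ℝ (t : Set R2))) := by
  rw [(convex_convexHull ℝ _).closure_interior_eq_closure_of_nonempty_interior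
    (T.interior_hull_nonempty ht)]
  exact subset_closure

theorem exists_mem_closure_inter {S : Set R2} (hS : S ⊆ closure ω) {z : R2} (hz : z ∈ closure S) :
    ∃ t ∈ T.tri, z ∈ convexHull ℝ (t : Set R2) ∧ z ∈ closure (S ∩ convexHull ℝ (t : Set R2)) := by
  have h1 : S = ⋃ t ∈ T.tri, S ∩ convexHull ℝ (t : Set R2) := by
    rw [← inter_iUnion₂, T.cover, inter_eq_self_of_subset_left hS]
  rw [h1, T.tri.closure_biUnion, mem_iUnion₂] at hz
  obtain ⟨t, ht, hzt⟩ := hz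
  refine ⟨t, ht, ?_, hzt⟩
  exact closure_minimal inter_subset_right (isCompact_hull t).isClosed hzt

/-- An edge with a point in the open set `ω` belongs to a second triangle. -/
theorem exists_neighbour (hω : IsOpen ω) {s : Finset R2} (hs : s ∈ T.tri) {p a q : R2} (hp : p ∈ s)
    (ha : a ∈ s) (hq : q ∈ s) (hpa : p ≠ a) (hqp : q ≠ p) (hqa : q ≠ a) {x : R2}
    (hx : x ∈ openSegment ℝ p a) (hxω : x ∈ ω) : ∃ t ∈ T.tri, t ≠ s ∧ p ∈ t ∧ a ∈ t := by
  obtain ⟨lam, h1, h2, h3, -⟩ := exists_barycentric (T.card_eq s hs) (T.indep s hs)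
  obtain ⟨c, d, hc, hd, hcd, rfl⟩ := hx
  set x := c • p + d • a with hx
  have hlam : ∀ z, lam z x = c * lam z p + d * lam z a := by
    intro z
    have := Convex.combo_affine_apply (f := lam z) (x := p) (y := a) hcd
    rw [hx, this, smul_eq_mul, smul_eq_mul]
  have hxq : lam q x = 0 := by
    rw [hlam, h2 q hq p hp hqp.symm, h2 q hq a ha hqa.symm]; ring
  have hxp : 0 < lam p x := by
    rw [hlam, h1 p hp, h2 p hp a ha hpa.symm]; linarith
  have hxa : 0 < lam a x := by
    rw [hlam, h1 a ha, h2 a ha p hp hpa]; linarith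
  -- The part of `ω` across the edge opposite to `q`. It accumulates at `x`, and a triangle that
  -- meets it cannot be `s`.
  set S := ω ∩ {y | lam q y < 0} with hS
  have hxS : x ∈ closure S := by
    have hlim : Tendsto (fun ε : ℝ => AffineMap.lineMap x q (-ε) : ℝ → R2) (𝓝[>] 0) (𝓝 x) := by
      have hcont : Continuous fun ε : ℝ => (AffineMap.lineMap x q (-ε) : R2) := by
        simp only [AffineMap.lineMap_apply]
        fun_prop
      have := hcont.tendsto 0
      simp only [neg_zero, AffineMap.lineMap_apply_zero] at this
      exact this.mono_left nhdsWithin_le_nhds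
    apply mem_closure_of_tendsto hlim
    filter_upwards [hlim.eventually (hω.mem_nhds hxω), self_mem_nhdsWithin] with ε hε hε0
    refine ⟨hε, ?_⟩
    have hε0 : 0 < ε := hε0
    rw [mem_ofPred_eq, AffineMap.apply_lineMap, hxq, h1 q hq, AffineMap.lineMap_apply]
    simp [hε0]
  obtain ⟨t, ht, hxt, hcl⟩ := T.exists_mem_closure_inter
    (inter_subset_left.trans subset_closure) hxS
  obtain ⟨y, hyS, hyt⟩ := closure_nonempty_iff.1 ⟨x, hcl⟩
  have hts : t ≠ s := by
    rintro rfl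
    exact absurd ((h3 y).1 hyt q hq) (not_le.2 hyS.2)
  have hxs : x ∈ convexHull ℝ (s : Set R2) :=
    convex_convexHull ℝ _ (subset_convexHull ℝ _ hp) (subset_convexHull ℝ _ ha) hc.le hd.le hcd
  have hxst := T.conforming s hs t ht ⟨hxs, hxt⟩
  -- The point `x` lies in the common face, so a vertex that carries a positive coordinate of `x`
  -- must be shared.
  have key : ∀ z ∈ s, 0 < lam z x → z ∈ t := by
    intro z hz hpos
    by_contra hzt
    have h0 : lam z x = 0 := (lam z).eq_zero_of_mem_convexHull (fun y hy =>
      h2 z hz y hy.1 (fun hyz => hzt (hyz ▸ hy.2))) hxst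
    linarith
  exact ⟨t, ht, hts, key p hp hxp, key a ha hxa⟩

/-- The triangles only tile the closure of `ω`; the absence of slits puts their interiors into `ω`
itself. -/
theorem interior_hull_subset (hω : IsLipschitzDomain ω) {t : Finset R2} (ht : t ∈ T.tri) :
    interior (convexHull ℝ (t : Set R2)) ⊆ ω := by
  refine subset_trans (interior_mono ?_) hω.interior_closure_subset
  rw [← T.cover]
  exact subset_biUnion_of_mem (u := fun t : Finset R2 => convexHull ℝ (t : Set R2)) ht

end Triangulation

/-! ### Nodal values on creased meshes -/

namespace CreaseMesh

variable {ω : Set R2} {b : ℝ → R2} {α β : ℝ} (M : CreaseMesh ω b α β)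

theorem isClosed_fatCrease : IsClosed M.fatCrease :=
  M.creaseTri.finite_toSet.isClosed_biUnion fun t _ => (Triangulation.isCompact_hull t).isClosed

theorem isOpen_perforated (hω : IsOpen ω) : IsOpen M.perforated :=
  hω.sdiff M.isClosed_fatCrease

theorem perforated_subset : M.perforated ⊆ ω := sdiff_subset

theorem interior_hull_subset_perforated (hω : IsLipschitzDomain ω) {t : Finset R2} (ht : t ∈ M.tri)
    (htc : t ∉ M.creaseTri) : interior (convexHull ℝ (t : Set R2)) ⊆ M.perforated := by
  intro x hx
  refine ⟨M.interior_hull_subset hω ht hx, ?_⟩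
  simp only [fatCrease, mem_iUnion, not_exists]
  intro s hs
  exact M.notMem_hull_of_mem_interior (M.crease_subset hs) ht (fun h => htc (h ▸ hs)) hx

theorem exists_tri_of_mem_perforated {x : R2} (hx : x ∈ M.perforated) :
    ∃ t ∈ M.tri, t ∉ M.creaseTri ∧ x ∈ convexHull ℝ (t : Set R2) := by
  have h1 : x ∈ ⋃ t ∈ M.tri, convexHull ℝ (t : Set R2) := by
    rw [M.cover]
    exact subset_closure (M.perforated_subset hx)
  obtain ⟨t, ht, hxt⟩ := mem_iUnion₂.1 h1
  exact ⟨t, ht, fun h => hx.2 (mem_iUnion₂.2 ⟨t, h, hxt⟩), hxt⟩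

/-- On a triangle outside the fattened crease, a function that is Lipschitz along segments has a
Lipschitz extension to the closed triangle. -/
theorem exists_extension (hω : IsLipschitzDomain ω) {w : R2 → R3}
    (hw : ∀ x y, segment ℝ x y ⊆ M.perforated → ‖w x - w y‖ ≤ 2 * ‖x - y‖)
    {t : Finset R2} (ht : t ∈ M.tri) (htc : t ∉ M.creaseTri) :
    ∃ g : R2 → R3, Continuous g ∧
      (∀ x ∈ interior (convexHull ℝ (t : Set R2)), w x = g x) ∧
      (∀ x ∈ M.perforated, x ∈ convexHull ℝ (t : Set R2) → w x = g x) ∧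
      ∀ x ∈ convexHull ℝ (t : Set R2), ∀ y ∈ convexHull ℝ (t : Set R2),
        ‖g x - g y‖ ≤ 2 * ‖x - y‖ := by
  set I := interior (convexHull ℝ (t : Set R2)) with hI
  have hIP : I ⊆ M.perforated := M.interior_hull_subset_perforated hω ht htc
  have hIconv : Convex ℝ I := (convex_convexHull ℝ _).interior
  have hlip : LipschitzOnWith 2 w I := by
    apply LipschitzOnWith.of_dist_le_mul
    intro x hx y hy
    rw [dist_eq_norm, dist_eq_norm]
    exact hw x y ((hIconv.segment_subset hx hy).trans hIP)
  obtain ⟨g, hg, hgw⟩ := hlip.extend_finite_dimension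
  have hcl := M.hull_subset_closure_interior ht
  have hwc : ContinuousOn w M.perforated :=
    continuousOn_of_segment_lipschitz (M.isOpen_perforated hω.1) hw
  refine ⟨g, hg.continuous, hgw, fun x hxP hxt => ?_, ?_⟩
  · have h1 : Tendsto w (𝓝[I] x) (𝓝 (w x)) :=
      ((hwc x hxP).mono hIP).tendsto
    have h2 : Tendsto w (𝓝[I] x) (𝓝 (g x)) := by
      refine Tendsto.congr' ?_ ((hg.continuous.tendsto x).mono_left nhdsWithin_le_nhds)
      filter_upwards [self_mem_nhdsWithin] with y hy
      exact (hgw hy).symm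
    have : (𝓝[I] x).NeBot := mem_closure_iff_nhdsWithin_neBot.1 (hcl hxt)
    exact tendsto_nhds_unique h1 h2
  · intro x hx y hy
    have hclosed : IsClosed {p : R2 × R2 | ‖g p.1 - g p.2‖ ≤ 2 * ‖p.1 - p.2‖} := by
      have := hg.continuous
      apply isClosed_le <;> fun_prop
    have hsub : closure (I ×ˢ I) ⊆ {p : R2 × R2 | ‖g p.1 - g p.2‖ ≤ 2 * ‖p.1 - p.2‖} := by
      apply closure_minimal _ hclosed
      rintro ⟨p, q⟩ ⟨hp, hq⟩
      simp only [mem_ofPred_eq, ← hgw hp, ← hgw hq]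
      exact hw p q ((hIconv.segment_subset hp hq).trans hIP)
    have : (x, y) ∈ closure (I ×ˢ I) := by
      rw [closure_prod_eq]
      exact Set.mk_mem_prod (hcl hx) (hcl hy)
    have h := hsub this
    rwa [mem_ofPred_eq] at h

/-- At a node where the perforated domain is not pinched, functions that are Lipschitz along
segments have a limit. -/
theorem exists_tendsto_of_connected (hω : IsLipschitzDomain ω) {w : R2 → R3}
    (hw : ∀ x y, segment ℝ x y ⊆ M.perforated → ‖w x - w y‖ ≤ 2 * ‖x - y‖) {z : R2}
    (hz : ∃ s ∈ M.tri, z ∈ s)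
    (hconn : ∀ᶠ r in 𝓝[>] (0 : ℝ), IsConnected (Metric.ball z r ∩ M.perforated)) :
    ∃ l : R3, Tendsto w (𝓝[M.perforated] z) (𝓝 l) := by
  choose! g hgc hgI hgw hgl using fun t ht htc => M.exists_extension hω hw (t := t) ht htc
  obtain ⟨s₀, hs₀, hzs₀⟩ := hz
  have ev1 : ∀ᶠ r in 𝓝[>] (0 : ℝ), ∀ t ∈ M.tri, z ∉ t →
      Metric.ball z r ⊆ (convexHull ℝ (t : Set R2))ᶜ := by
    rw [M.tri.eventually_all]
    intro t ht
    by_cases hzt : z ∈ t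
    · exact Eventually.of_forall fun r h => absurd hzt h
    · have hzh : z ∉ convexHull ℝ (t : Set R2) := fun h => hzt (M.mem_of_mem_hull ht hs₀ hzs₀ h)
      have hmem : (convexHull ℝ (t : Set R2))ᶜ ∈ 𝓝 z :=
        (Triangulation.isCompact_hull t).isClosed.isOpen_compl.mem_nhds hzh
      obtain ⟨ε, hε, hsub⟩ := Metric.mem_nhds_iff.1 hmem
      filter_upwards [Ioo_mem_nhdsGT hε] with r hr _
      exact (Metric.ball_subset_ball hr.2.le).trans hsub
  -- The candidates for the limit are the finitely many values `g t z`; for crease triangles `g t`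
  -- is arbitrary, which is harmless. On the small set `X` the function stays within `2 * r` of some
  -- candidate. Distinct candidates more than `4 * r` apart give disjoint balls, so connectedness
  -- allows only one.
  have ev2 : ∀ᶠ r in 𝓝[>] (0 : ℝ), ∀ t ∈ M.tri, ∀ t' ∈ M.tri, g t z ≠ g t' z →
      4 * r < ‖g t z - g t' z‖ := by
    rw [M.tri.eventually_all]
    intro t _
    rw [M.tri.eventually_all]
    intro t' _
    by_cases h : g t z = g t' z
    · exact Eventually.of_forall fun r h' => absurd h h'
    · have hpos : 0 < ‖g t z - g t' z‖ / 4 := by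
        have := norm_pos_iff.2 (sub_ne_zero.2 h)
        positivity
      filter_upwards [Ioo_mem_nhdsGT hpos] with r hr _
      linarith [hr.2]
  obtain ⟨r, ⟨⟨hX, h1⟩, h2⟩, hr⟩ :=
    (((hconn.and ev1).and ev2).and self_mem_nhdsWithin).exists
  have hr : 0 < r := hr
  set X := Metric.ball z r ∩ M.perforated with hXdef
  have hloc : ∀ x ∈ X, ∃ t ∈ M.tri, ‖w x - g t z‖ ≤ 2 * ‖x - z‖ := by
    rintro x ⟨hxb, hxP⟩
    obtain ⟨t, ht, htc, hxt⟩ := M.exists_tri_of_mem_perforated hxP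
    have hzt : z ∈ t := by
      by_contra h
      exact h1 t ht h hxb hxt
    refine ⟨t, ht, ?_⟩
    rw [hgw t ht htc x hxP hxt]
    exact hgl t ht htc x hxt z (subset_convexHull ℝ _ hzt)
  have hnorm : ∀ x ∈ X, ‖x - z‖ < r := fun x hx => by
    rw [← dist_eq_norm]; exact hx.1
  obtain ⟨x₀, hx₀⟩ := hX.nonempty
  obtain ⟨t₀, ht₀, hxt₀⟩ := hloc x₀ hx₀
  have hwc : ContinuousOn w X :=
    (continuousOn_of_segment_lipschitz (M.isOpen_perforated hω.1) hw).mono inter_subset_right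
  have himg : w '' X ⊆ Metric.ball (g t₀ z) (2 * r) := by
    refine (hX.isPreconnected.image w hwc).subset_left_of_subset_union
      (v := ⋃ t ∈ {t ∈ M.tri | g t z ≠ g t₀ z}, Metric.ball (g t z) (2 * r))
      Metric.isOpen_ball (isOpen_biUnion fun _ _ => Metric.isOpen_ball) ?_ ?_ ?_
    · rw [Set.disjoint_left]
      intro y hy hy'
      obtain ⟨t, ht, hyt⟩ := mem_iUnion₂.1 hy'
      obtain ⟨ht1, ht2⟩ : t ∈ M.tri ∧ g t z ≠ g t₀ z := by simpa using ht
      have h3 := h2 t ht1 t₀ ht₀ ht2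
      rw [Metric.mem_ball] at hy hyt
      rw [← dist_eq_norm] at h3
      have h4 := dist_triangle_left (g t z) (g t₀ z) y
      linarith
    · rintro _ ⟨x, hx, rfl⟩
      obtain ⟨t, ht, hxt⟩ := hloc x hx
      have hb : w x ∈ Metric.ball (g t z) (2 * r) := by
        rw [Metric.mem_ball, dist_eq_norm]
        linarith [hnorm x hx]
      by_cases h : g t z = g t₀ z
      · left; rwa [← h]
      · right
        exact mem_iUnion₂.2 ⟨t, by simpa using ⟨ht, h⟩, hb⟩
    · refine ⟨w x₀, ⟨x₀, hx₀, rfl⟩, ?_⟩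
      rw [Metric.mem_ball, dist_eq_norm]
      linarith [hnorm x₀ hx₀]
  have hfin : ∀ x ∈ X, ‖w x - g t₀ z‖ ≤ 2 * ‖x - z‖ := by
    intro x hx
    obtain ⟨t, ht, hxt⟩ := hloc x hx
    by_cases h : g t z = g t₀ z
    · rwa [← h]
    · exfalso
      have h3 := h2 t ht t₀ ht₀ h
      have h4 : dist (w x) (g t₀ z) < 2 * r := himg ⟨x, hx, rfl⟩
      have h5 : dist (w x) (g t z) < 2 * r := by
        rw [dist_eq_norm]; linarith [hnorm x hx]
      rw [← dist_eq_norm] at h3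
      have h6 := dist_triangle_left (g t z) (g t₀ z) (w x)
      linarith
  refine ⟨g t₀ z, ?_⟩
  rw [tendsto_iff_norm_sub_tendsto_zero]
  have hlim : Tendsto (fun x => 2 * ‖x - z‖) (𝓝[M.perforated] z) (𝓝 0) := by
    have : Continuous fun x : R2 => 2 * ‖x - z‖ := by fun_prop
    have h3 := this.tendsto z
    rw [sub_self, norm_zero, mul_zero] at h3
    exact h3.mono_left nhdsWithin_le_nhds
  refine squeeze_zero' (Eventually.of_forall fun x => norm_nonneg _) ?_ hlim
  filter_upwards [self_mem_nhdsWithin,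
    mem_nhdsWithin_of_mem_nhds (Metric.ball_mem_nhds z hr)] with x hx hxb
  exact hfin x ⟨hxb, hx⟩

/-- The nodal values coincide with those of the Lipschitz extension, since the interior of the
triangle is perforated domain that accumulates at each of its vertices. -/
theorem norm_sub_le_of_not_crease (hω : IsLipschitzDomain ω) {w Q : R2 → R3}
    (hw : ∀ x y, segment ℝ x y ⊆ M.perforated → ‖w x - w y‖ ≤ 2 * ‖x - y‖)
    (hQ : ∀ z ∈ M.nodes, Tendsto w (𝓝[M.perforated] z) (𝓝 (Q z)))
    {t : Finset R2} (ht : t ∈ M.tri) (htc : t ∉ M.creaseTri) {z z' : R2} (hz : z ∈ t)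
    (hz' : z' ∈ t) : ‖Q z - Q z'‖ ≤ 2 * ‖z - z'‖ := by
  obtain ⟨g, hgc, hgI, -, hgl⟩ := M.exists_extension hω hw ht htc
  have key : ∀ y ∈ t, Q y = g y := by
    intro y hy
    have hyh : y ∈ convexHull ℝ (t : Set R2) := subset_convexHull ℝ _ hy
    have h1 : Tendsto w (𝓝[interior (convexHull ℝ (t : Set R2))] y) (𝓝 (Q y)) :=
      (hQ y ⟨t, ht, hy⟩).mono_left
        (nhdsWithin_mono _ (M.interior_hull_subset_perforated hω ht htc))
    have h2 : Tendsto w (𝓝[interior (convexHull ℝ (t : Set R2))] y) (𝓝 (g y)) := by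
      refine Tendsto.congr' ?_ ((hgc.tendsto y).mono_left nhdsWithin_le_nhds)
      filter_upwards [self_mem_nhdsWithin] with x hx
      exact (hgI x hx).symm
    have : (𝓝[interior (convexHull ℝ (t : Set R2))] y).NeBot :=
      mem_closure_iff_nhdsWithin_neBot.1 (M.hull_subset_closure_interior ht hyh)
    exact tendsto_nhds_unique h1 h2
  rw [key z hz, key z' hz']
  exact hgl z (subset_convexHull ℝ _ hz) z' (subset_convexHull ℝ _ hz')

end CreaseMesh

theorem exists_mem_openSegment {ω : Set R2} (hω : IsOpen ω) {p : R2} (hp : p ∈ ω) (a : R2) :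
    ∃ x ∈ openSegment ℝ p a, x ∈ ω := by
  have hlim : Tendsto (fun ε : ℝ => (AffineMap.lineMap p a ε : R2)) (𝓝[>] 0) (𝓝 p) := by
    have hcont : Continuous fun ε : ℝ => (AffineMap.lineMap p a ε : R2) :=
      AffineMap.lineMap_continuous
    have := hcont.tendsto 0
    rw [AffineMap.lineMap_apply_zero] at this
    exact this.mono_left nhdsWithin_le_nhds
  obtain ⟨ε, hε, hε1⟩ := ((hlim.eventually (hω.mem_nhds hp)).and
    (Ioo_mem_nhdsGT (show (0 : ℝ) < 1 by norm_num))).exists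
  refine ⟨_, ?_, hε⟩
  rw [openSegment_eq_image_lineMap]
  exact ⟨ε, hε1, rfl⟩

/-- The edges of a triangle are at least as long as the diameter of an inscribed disc. -/
theorem Triangulation.two_mul_radius_le {ω : Set R2} (T : Triangulation ω) {t : Finset R2}
    (ht : t ∈ T.tri) {x : R2} {ρ : ℝ} (hρ : 0 < ρ)
    (hball : Metric.closedBall x ρ ⊆ convexHull ℝ (t : Set R2)) {p q : R2} (hp : p ∈ t)
    (hq : q ∈ t) (hpq : p ≠ q) : 2 * ρ ≤ ‖p - q‖ := by
  obtain ⟨lam, h1, h2, h3, -⟩ := exists_barycentric (T.card_eq t ht) (T.indep t ht)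
  have hpos : 0 < ‖p - q‖ := norm_pos_iff.2 (sub_ne_zero.2 hpq)
  set c : ℝ := ρ / ‖p - q‖ with hc
  have hc0 : 0 < c := by positivity
  have hnorm : ‖c • (p - q)‖ = ρ := by
    rw [norm_smul, Real.norm_of_nonneg hc0.le, hc]; field_simp
  have hm1 : x + c • (p - q) ∈ convexHull ℝ (t : Set R2) := hball (by simp [hnorm])
  have hm2 : x - c • (p - q) ∈ convexHull ℝ (t : Set R2) := hball (by simp [hnorm])
  have hle1 : ∀ y ∈ convexHull ℝ (t : Set R2), lam p y ≤ 1 := by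
    intro y hy
    have : convexHull ℝ (t : Set R2) ⊆ lam p ⁻¹' Iic 1 := by
      apply convexHull_min _ ((convex_Iic 1).affine_preimage (lam p))
      intro z hz
      by_cases hzp : z = p
      · rw [hzp]; exact (h1 p hp).le
      · rw [mem_preimage, h2 p hp z hz hzp]; simp
    exact this hy
  have hlin : (lam p).linear (p - q) = 1 := by
    have := (lam p).linearMap_vsub p q
    rw [vsub_eq_sub, vsub_eq_sub, h1 p hp, h2 p hp q hq hpq.symm] at this
    simpa using this
  have hdiff : lam p (x + c • (p - q)) - lam p (x - c • (p - q)) = 2 * c := by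
    have := (lam p).linearMap_vsub (x + c • (p - q)) (x - c • (p - q))
    rw [vsub_eq_sub, vsub_eq_sub] at this
    rw [← this, show x + c • (p - q) - (x - c • (p - q)) = (2 * c) • (p - q) by module, map_smul,
      hlin, smul_eq_mul, mul_one]
  have a1 := hle1 _ hm1
  have a2 := (h3 _).1 hm2 p hp
  have : 2 * c ≤ 1 := by linarith
  rw [hc, ← mul_div_assoc, div_le_one hpos] at this
  exact this

/-! ### Nodal values on the triangles of the fattened crease -/

namespace CreaseMesh

variable {ω : Set R2} {b : ℝ → R2} {α β : ℝ} (M : CreaseMesh ω b α β)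

/-- At the end point `q` of a segment of the polygonal crease, the triangles at this segment cannot
fill the whole domain. -/
theorem exists_openSegment_of_forall_crease (hω : IsLipschitzDomain ω) {p q : R2}
    (hqv : ∃ i, q = b (M.t i)) (hpq : p ≠ q)
    (hex : ∃ s ∈ M.tri, p ∈ s ∧ q ∈ s)
    (hall : ∀ t ∈ M.tri, p ∈ t → q ∈ t → t ∈ M.creaseTri) :
    ∃ t ∈ M.tri, p ∈ t ∧ q ∈ t ∧ ∃ a ∈ t, a ≠ p ∧ a ≠ q ∧ ∃ x ∈ openSegment ℝ q a, x ∈ ω := by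
  classical
  by_contra! hcon
  obtain ⟨s, hs, hps, hqs⟩ := hex
  have third : ∀ t ∈ M.tri, p ∈ t → q ∈ t → ∃ a ∈ t, a ≠ p ∧ a ≠ q ∧ t = {p, q, a} := by
    intro t ht hpt hqt
    have hcard : ({p, q} : Finset R2).card < t.card := by
      rw [M.card_eq t ht, Finset.card_pair hpq]; norm_num
    obtain ⟨a, hat, ha⟩ := Finset.exists_mem_notMem_of_card_lt_card hcard
    simp only [Finset.mem_insert, Finset.mem_singleton, not_or] at ha
    refine ⟨a, hat, ha.1, ha.2, ?_⟩
    symm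
    apply Finset.eq_of_subset_of_card_le
    · intro y hy
      simp only [Finset.mem_insert, Finset.mem_singleton] at hy
      rcases hy with rfl | rfl | rfl <;> assumption
    · rw [M.card_eq t ht, Finset.card_eq_three.2 ⟨p, q, a, hpq, Ne.symm ha.1, Ne.symm ha.2, rfl⟩]
  have hqω : q ∉ ω := by
    intro hq
    obtain ⟨a, has, hap, haq, -⟩ := third s hs hps hqs
    obtain ⟨x, hx, hxω⟩ := exists_mem_openSegment hω.1 hq a
    exact hcon s hs hps hqs a has hap haq x hx hxω
  have hqP : q ∈ closure M.perforated := by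
    obtain ⟨i, hi⟩ := hqv
    rw [hi]
    exact M.vertex_mem_closure i
  have hqfr : q ∈ frontier ω := by
    rw [hω.1.frontier_eq]
    exact ⟨closure_mono M.perforated_subset hqP, hqω⟩
  set A : Set R2 := ⋃ t ∈ {t ∈ M.tri | p ∈ t ∧ q ∈ t}, convexHull ℝ (t : Set R2) with hA
  have hmemA : ∀ x, x ∈ A ↔ ∃ t ∈ M.tri, p ∈ t ∧ q ∈ t ∧ x ∈ convexHull ℝ (t : Set R2) := by
    intro x
    simp only [hA, mem_iUnion, exists_prop, Finset.mem_filter, and_assoc]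
  have hAcl : IsClosed A := by
    apply Set.Finite.isClosed_biUnion
    · exact Finset.finite_toSet _
    · exact fun t _ => (Triangulation.isCompact_hull t).isClosed
  -- Near `q` only triangles with vertex `q` occur, and no other vertex does.
  have hW : {y | ∀ t ∈ M.tri, (q ∉ t → y ∉ convexHull ℝ (t : Set R2)) ∧
      ∀ a ∈ t, a ≠ q → y ≠ a} ∈ 𝓝 q := by
    change ∀ᶠ y in 𝓝 q, ∀ t ∈ M.tri, _
    rw [M.tri.eventually_all]
    intro t ht
    apply Eventually.and
    · by_cases hqt : q ∈ t
      · exact Eventually.of_forall fun _ h => absurd hqt h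
      · have hqh : q ∉ convexHull ℝ (t : Set R2) := fun h => hqt (M.mem_of_mem_hull ht hs hqs h)
        filter_upwards [(Triangulation.isCompact_hull t).isClosed.isOpen_compl.mem_nhds hqh]
          with y hy _ using hy
    · rw [t.eventually_all]
      intro a _
      by_cases haq : a = q
      · exact Eventually.of_forall fun _ h => absurd haq h
      · filter_upwards [isOpen_ne.mem_nhds (Ne.symm haq)] with y hy _ using hy
  obtain ⟨W', hW'n, hW'W, hpre⟩ := hω.exists_isPreconnected_inter hqfr hW
  -- a point of the crease and a point outside
  obtain ⟨x, hxW, hxI⟩ := mem_closure_iff_nhds.1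
    (M.hull_subset_closure_interior hs (subset_convexHull ℝ _ hqs)) W' hW'n
  obtain ⟨y, hyW, hyP⟩ := mem_closure_iff_nhds.1 hqP W' hW'n
  have hxA : x ∈ A := (hmemA x).2 ⟨s, hs, hps, hqs, interior_subset hxI⟩
  have hyA : y ∉ A := by
    intro h
    obtain ⟨t, ht, hpt, hqt, hyt⟩ := (hmemA y).1 h
    exact hyP.2 (mem_iUnion₂.2 ⟨t, hall t ht hpt hqt, hyt⟩)
  -- Near `q` the domain is connected. It contains interior points of `s` and, as `q` is a limit of
  -- the perforated domain, points outside `A`; hence it crosses the boundary of `A`.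
  obtain ⟨z, ⟨hzW, hzω⟩, hzfr⟩ : (W' ∩ ω ∩ frontier A).Nonempty := by
    by_contra hne
    have hInt : ∀ c ∈ W' ∩ ω, c ∈ A → c ∈ interior A := fun c hc hcA =>
      by_contra fun h => hne ⟨c, hc, subset_closure hcA, h⟩
    have hxC : x ∈ W' ∩ ω := ⟨hxW, M.interior_hull_subset hω hs hxI⟩
    obtain ⟨c, -, h1, h2⟩ := hpre (interior A) Aᶜ isOpen_interior hAcl.isOpen_compl
      (fun c hc => (em (c ∈ A)).imp (hInt c hc) id) ⟨x, hxC, hInt x hxC hxA⟩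
      ⟨y, ⟨hyW, M.perforated_subset hyP⟩, hyA⟩
    exact h2 (interior_subset h1)
  have hzA : z ∈ A := hAcl.frontier_subset hzfr
  have hzAc : z ∈ closure (ω ∩ Aᶜ) := by
    have h1 : z ∈ closure Aᶜ := by
      rw [frontier_eq_closure_inter_closure] at hzfr
      exact hzfr.2
    rw [mem_closure_iff_nhdsWithin_neBot] at h1 ⊢
    rwa [nhdsWithin_inter_of_mem (mem_nhdsWithin_of_mem_nhds (hω.1.mem_nhds hzω))]
  obtain ⟨t, ht, hzt, hcl⟩ := M.exists_mem_closure_inter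
    (inter_subset_left.trans subset_closure) hzAc
  obtain ⟨y', ⟨-, hy'A⟩, hy't⟩ := closure_nonempty_iff.1 ⟨z, hcl⟩
  have hqt : q ∈ t := by
    by_contra h
    exact (hW'W hzW t ht).1 h hzt
  have hpt : p ∉ t := fun h => hy'A ((hmemA y').2 ⟨t, ht, h, hqt, hy't⟩)
  obtain ⟨s', hs', hps', hqs', hzs'⟩ := (hmemA z).1 hzA
  obtain ⟨a, has', hap, haq, hs'eq⟩ := third s' hs' hps' hqs'
  have hzint := M.conforming s' hs' t ht ⟨hzs', hzt⟩
  -- Triangle `t` has vertex `q` but not `p`, so its common face with `s'` lies in the edge from `q`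
  -- to the apex. As `z` is neither end, this edge has an inner point in `ω`, against the
  -- assumption.
  have hzseg : z ∈ segment ℝ q a := by
    rw [← convexHull_pair (𝕜 := ℝ)]
    refine convexHull_mono ?_ hzint
    rintro c ⟨hc1, hc2⟩
    rw [hs'eq] at hc1
    simp only [Finset.coe_insert, Finset.coe_singleton, mem_insert_iff, mem_singleton_iff] at hc1 ⊢
    rcases hc1 with rfl | h
    · exact absurd hc2 hpt
    · exact h
  have hzq : z ≠ q := fun h => hqω (h ▸ hzω)
  have hza : z ≠ a := (hW'W hzW s' hs').2 a has' haq
  have hopen : z ∈ openSegment ℝ q a := mem_openSegment_of_ne_left_right hzq.symm hza.symm hzseg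
  exact hcon s' hs' hps' hqs' a has' hap haq z hopen hzω

/-- The nodal values on a crease triangle with an edge `[p, q]` of the polygonal crease such that
`p` is an inner point. -/
theorem norm_sub_le_of_crease (hω : IsLipschitzDomain ω) {κ : ℝ} (hκ : M.ShapeRegular κ)
    {Q : R2 → R3}
    (hQ : ∀ t ∈ M.tri, t ∉ M.creaseTri → ∀ z ∈ t, ∀ z' ∈ t, ‖Q z - Q z'‖ ≤ 2 * ‖z - z'‖)
    {s : Finset R2} (hs : s ∈ M.creaseTri) {p q a : R2} (hpv : ∃ i, p = b (M.t i))
    (hqv : ∃ i, q = b (M.t i)) (hp : p ∈ s) (hq : q ∈ s) (ha : a ∈ s) (hpq : p ≠ q)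
    (hav : ∀ i, a ≠ b (M.t i)) (hpω : p ∈ ω) :
    ‖Q p - Q a‖ ≤ 2 * ‖p - a‖ ∧ ‖Q p - Q q‖ ≤ (2 + 2 * κ) * ‖p - q‖ := by
  -- Since `p` is inner, the edge from `p` to the apex meets `ω` and has a second triangle. The apex
  -- lies in no other crease triangle, so this neighbour is outside the crease and the Lipschitz
  -- bound holds along the edge.
  have inner : ∀ s ∈ M.creaseTri, p ∈ s → q ∈ s → ∀ a ∈ s, a ≠ p → a ≠ q →
      ((∀ s' ∈ M.creaseTri, a ∈ s' → s' = s) ∧ ‖Q p - Q a‖ ≤ 2 * ‖p - a‖) := by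
    intro s hs hp hq a ha hap haq
    have hau : ∀ s' ∈ M.creaseTri, a ∈ s' → s' = s := by
      obtain ⟨j, a', hsa', hav', hau'⟩ := M.crease_shape s hs
      have ha's : a' ∈ s := by
        have : a' ∈ (s : Set R2) := by rw [hsa']; simp
        exact this
      have hap' : a' ≠ p := fun h => by obtain ⟨i, hi⟩ := hpv; exact hav' i (h.trans hi)
      have haq' : a' ≠ q := fun h => by obtain ⟨i, hi⟩ := hqv; exact hav' i (h.trans hi)
      have : a = a' := by
        classical
        by_contra hne
        have hsub : ({p, q, a, a'} : Finset R2) ⊆ s := by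
          intro y hy
          simp only [Finset.mem_insert, Finset.mem_singleton] at hy
          rcases hy with rfl | rfl | rfl | rfl <;> assumption
        have := Finset.card_le_card hsub
        rw [M.card_eq s (M.crease_subset hs), Finset.card_insert_of_notMem,
          Finset.card_eq_three.2 ⟨q, a, a', haq.symm, haq'.symm, hne, rfl⟩] at this
        · omega
        · simp [hpq, hap.symm, hap'.symm]
      exact this ▸ hau'
    refine ⟨hau, ?_⟩
    obtain ⟨x, hx, hxω⟩ := exists_mem_openSegment hω.1 hpω a
    obtain ⟨t, ht, hts, hpt, hat⟩ := M.exists_neighbour hω.1 (M.crease_subset hs) hp ha hq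
      hap.symm hpq.symm haq.symm hx hxω
    exact hQ t ht (fun h => hts (hau t h hat)) p hpt a hat
  have hap : a ≠ p := fun h => by obtain ⟨i, hi⟩ := hpv; exact hav i (h.trans hi)
  have haq : a ≠ q := fun h => by obtain ⟨i, hi⟩ := hqv; exact hav i (h.trans hi)
  have hκ0 : 0 ≤ κ := by
    obtain ⟨x, ρ, hρ, -, hd⟩ := hκ s (M.crease_subset hs)
    exact nonneg_of_mul_nonneg_left (Metric.diam_nonneg.trans hd) hρ
  refine ⟨(inner s hs hp hq a ha hap haq).2, ?_⟩
  by_cases hall : ∀ t ∈ M.tri, p ∈ t → q ∈ t → t ∈ M.creaseTri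
  -- With only crease triangles at the edge, the comparison goes from `p` to an apex `a'` and on to
  -- `q`. The apex is chosen such that the second leg also borders a triangle outside the crease.
  · obtain ⟨t, ht, hpt, hqt, a', hat, hap', haq', x, hx, hxω⟩ :=
      M.exists_openSegment_of_forall_crease hω hqv hpq ⟨s, M.crease_subset hs, hp, hq⟩ hall
    obtain ⟨hau', hpa'⟩ := inner t (hall t ht hpt hqt) hpt hqt a' hat hap' haq'
    obtain ⟨t', ht', htt', hqt', hat'⟩ := M.exists_neighbour hω.1 ht hqt hat hpt
      haq'.symm hpq hap'.symm hx hxω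
    have hqa' := hQ t' ht' (fun h => htt' (hau' t' h hat')) q hqt' a' hat'
    obtain ⟨x₀, ρ, hρ, hball, hdiam⟩ := hκ t ht
    have hbd := (Triangulation.isCompact_hull t).isBounded
    have hedge := M.two_mul_radius_le ht hρ hball hpt hqt hpq
    have d1 : ‖p - a'‖ ≤ κ * ρ := by
      rw [← dist_eq_norm]
      exact (Metric.dist_le_diam_of_mem hbd (subset_convexHull ℝ _ hpt)
        (subset_convexHull ℝ _ hat)).trans hdiam
    have d2 : ‖q - a'‖ ≤ κ * ρ := by
      rw [← dist_eq_norm]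
      exact (Metric.dist_le_diam_of_mem hbd (subset_convexHull ℝ _ hqt)
        (subset_convexHull ℝ _ hat)).trans hdiam
    have tri : ‖Q p - Q q‖ ≤ ‖Q p - Q a'‖ + ‖Q q - Q a'‖ := by
      have := norm_sub_le (Q p - Q a') (Q q - Q a')
      rwa [sub_sub_sub_cancel_right] at this
    -- Each leg has length at most `κ * ρ` and costs a factor 2. The total `4 * κ * ρ` is at most `2
    -- * κ * ‖p - q‖`, because an edge is at least as long as an inscribed diameter.
    have h1 : κ * (2 * ρ) ≤ κ * ‖p - q‖ := mul_le_mul_of_nonneg_left hedge hκ0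
    nlinarith [norm_nonneg (p - q)]
  · push Not at hall
    obtain ⟨t, ht, hpt, hqt, htc⟩ := hall
    have := hQ t ht htc p hpt q hqt
    nlinarith [norm_nonneg (p - q)]

/-- The nodal values on all triangles are controlled by the diameter, provided that each segment of
the polygonal crease has an inner end point. -/
theorem norm_sub_le_of_inner_vertex (hω : IsLipschitzDomain ω) {κ : ℝ} (hκ : M.ShapeRegular κ)
    (hin : ∀ j : Fin M.N, b (M.t j.castSucc) ≠ b (M.t j.succ) →
      (∃ s ∈ M.creaseTri, b (M.t j.castSucc) ∈ s ∧ b (M.t j.succ) ∈ s) →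
      b (M.t j.castSucc) ∈ ω ∨ b (M.t j.succ) ∈ ω)
    {Q : R2 → R3}
    (hQ : ∀ t ∈ M.tri, t ∉ M.creaseTri → ∀ z ∈ t, ∀ z' ∈ t, ‖Q z - Q z'‖ ≤ 2 * ‖z - z'‖)
    {s : Finset R2} (hs : s ∈ M.tri) {z z' : R2} (hz : z ∈ s) (hz' : z' ∈ s) :
    ‖Q z - Q z'‖ ≤ (4 + 2 * κ) * Metric.diam (convexHull ℝ (s : Set R2)) := by
  have hκ0 : 0 ≤ κ := by
    obtain ⟨x, ρ, hρ, -, hd⟩ := hκ s hs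
    exact nonneg_of_mul_nonneg_left (Metric.diam_nonneg.trans hd) hρ
  set D := Metric.diam (convexHull ℝ (s : Set R2)) with hD
  have hD0 : 0 ≤ D := Metric.diam_nonneg
  have hdist : ∀ z ∈ s, ∀ z' ∈ s, ‖z - z'‖ ≤ D := by
    intro z hz z' hz'
    rw [← dist_eq_norm]
    exact Metric.dist_le_diam_of_mem (Triangulation.isCompact_hull s).isBounded
      (subset_convexHull ℝ _ hz) (subset_convexHull ℝ _ hz')
  by_cases hsc : s ∈ M.creaseTri
  · -- reduce to an inner vertex `p`
    obtain ⟨p, q, a, hseq, hpa, hpq⟩ : ∃ p q a, (s : Set R2) = {p, q, a} ∧ ‖Q p - Q a‖ ≤ 2 * D ∧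
        ‖Q p - Q q‖ ≤ (2 + 2 * κ) * D := by
      obtain ⟨j, a, hsa, hav, -⟩ := M.crease_shape s hsc
      have m1 : b (M.t j.castSucc) ∈ s := by
        have : b (M.t j.castSucc) ∈ (s : Set R2) := by rw [hsa]; simp
        exact this
      have m2 : b (M.t j.succ) ∈ s := by
        have : b (M.t j.succ) ∈ (s : Set R2) := by rw [hsa]; simp
        exact this
      have m3 : a ∈ s := by
        have : a ∈ (s : Set R2) := by rw [hsa]; simp
        exact this
      have hne : b (M.t j.castSucc) ≠ b (M.t j.succ) := by
        classical
        intro h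
        have h2 : s = {b (M.t j.succ), a} := by
          apply Finset.coe_injective
          rw [hsa, h]; simp
        have h3 := M.card_eq s hs
        rw [h2] at h3
        have := Finset.card_le_two (a := b (M.t j.succ)) (b := a)
        omega
      rcases hin j hne ⟨s, hsc, m1, m2⟩ with hω1 | hω2
      · obtain ⟨h1, h2⟩ := M.norm_sub_le_of_crease hω hκ hQ hsc ⟨_, rfl⟩ ⟨_, rfl⟩ m1 m2 m3 hne
          hav hω1
        refine ⟨_, _, a, hsa, h1.trans ?_, h2.trans ?_⟩
        · exact mul_le_mul_of_nonneg_left (hdist _ m1 _ m3) (by norm_num)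
        · exact mul_le_mul_of_nonneg_left (hdist _ m1 _ m2) (by positivity)
      · obtain ⟨h1, h2⟩ := M.norm_sub_le_of_crease hω hκ hQ hsc ⟨_, rfl⟩ ⟨_, rfl⟩ m2 m1 m3 hne.symm
          hav hω2
        refine ⟨_, _, a, hsa.trans (insert_comm _ _ _), h1.trans ?_, h2.trans ?_⟩
        · exact mul_le_mul_of_nonneg_left (hdist _ m2 _ m3) (by norm_num)
        · exact mul_le_mul_of_nonneg_left (hdist _ m2 _ m1) (by positivity)
    have hcase : ∀ y ∈ s, y = p ∨ y = q ∨ y = a := by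
      intro y hy
      have : y ∈ (s : Set R2) := hy
      rw [hseq] at this
      simpa using this
    -- The worst pair of vertices is compared through `p`, whence `2 + (2 + 2 * κ)`.
    have hqa : ‖Q q - Q a‖ ≤ (4 + 2 * κ) * D := by
      have := norm_sub_le (Q p - Q a) (Q p - Q q)
      rw [sub_sub_sub_cancel_left] at this
      linarith
    have hκD : 0 ≤ κ * D := mul_nonneg hκ0 hD0
    rcases hcase z hz with rfl | rfl | rfl <;> rcases hcase z' hz' with rfl | rfl | rfl <;>
      first
      | (rw [sub_self, norm_zero]; nlinarith)
      | linarith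
      | (rw [norm_sub_rev]; linarith)
  · have h1 := hQ s hs hsc z hz z' hz'
    have h2 := hdist z hz z' hz'
    nlinarith

end CreaseMesh

/-! ### Piecewise affine functions -/

section PiecewiseAffine

/-- Continuous induction: the parameters up to which the bound holds form a closed set that can
always be extended to the right. Only estimates centred at each point are required, not a Lipschitz
bound between neighbours. -/
theorem norm_sub_le_of_eventually {h : ℝ → R3} {K : ℝ}
    (hloc : ∀ s₀ ∈ Icc (0 : ℝ) 1, ∀ᶠ s in 𝓝[Icc 0 1] s₀, ‖h s - h s₀‖ ≤ K * |s - s₀|) :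
    ‖h 1 - h 0‖ ≤ K := by
  have hcont : ContinuousOn h (Icc 0 1) := by
    intro s₀ hs₀
    rw [ContinuousWithinAt, tendsto_iff_norm_sub_tendsto_zero]
    have hlim : Tendsto (fun s : ℝ => K * |s - s₀|) (𝓝[Icc 0 1] s₀) (𝓝 0) := by
      have : Continuous fun s : ℝ => K * |s - s₀| := by fun_prop
      have h3 := this.tendsto s₀
      rw [sub_self, abs_zero, mul_zero] at h3
      exact h3.mono_left nhdsWithin_le_nhds
    exact squeeze_zero' (Eventually.of_forall fun s => norm_nonneg _) (hloc s₀ hs₀) hlim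
  set S : Set ℝ := {s | ‖h s - h 0‖ ≤ K * s} with hS
  have hcl : IsClosed (S ∩ Icc 0 1) := by
    have h1 : ContinuousOn (fun s => K * s - ‖h s - h 0‖) (Icc 0 1) :=
      (continuousOn_const.mul continuousOn_id).sub (hcont.sub continuousOn_const).norm
    have h2 := h1.preimage_isClosed_of_isClosed isClosed_Icc (isClosed_Ici (a := (0 : ℝ)))
    convert! h2 using 1
    ext s
    simp only [hS, mem_inter_iff, mem_ofPred_eq, mem_preimage, mem_Ici, sub_nonneg]
    exact and_comm
  have hsub := hcl.Icc_subset_of_forall_exists_gt (by simp [hS]) (by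
    rintro s ⟨hsS, hs⟩ y hy
    have hy : s < y := hy
    have hev := hloc s ⟨hs.1, hs.2.le⟩
    have hle : 𝓝[>] s ≤ 𝓝[Icc 0 1] s := by
      rw [nhdsWithin_le_iff]
      filter_upwards [Ioo_mem_nhdsGT hs.2] with u hu
      exact ⟨hs.1.trans hu.1.le, hu.2.le⟩
    obtain ⟨u, hu1, hu2⟩ := ((hev.filter_mono hle).and (Ioo_mem_nhdsGT hy)).exists
    refine ⟨u, ?_, hu2.1, hu2.2.le⟩
    have hsS : ‖h s - h 0‖ ≤ K * s := hsS
    rw [abs_of_pos (sub_pos.2 hu2.1)] at hu1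
    have := norm_add_le (h u - h s) (h s - h 0)
    rw [sub_add_sub_cancel] at this
    show ‖h u - h 0‖ ≤ K * u
    linarith)
  have := hsub (right_mem_Icc.2 zero_le_one)
  simpa [hS] using this

namespace Triangulation

variable {ω : Set R2} (T : Triangulation ω)

/-- Boundaries of convex sets are null sets, and there are finitely many triangles. -/
theorem ae_mem_interior : ∀ᵐ x ∂(volume.restrict ω),
    ∃ t ∈ T.tri, x ∈ interior (convexHull ℝ (t : Set R2)) := by
  have h1 : ∀ᵐ x, ∀ t ∈ T.tri, x ∉ frontier (convexHull ℝ (t : Set R2)) := by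
    rw [Finset.eventually_all]
    intro t _
    exact measure_eq_zero_iff_ae_notMem.1 ((convex_convexHull ℝ _).addHaar_frontier volume)
  have h2 : ∀ᵐ x ∂(volume.restrict ω), x ∈ closure ω := by
    refine ae_mono (Measure.restrict_mono_set volume subset_closure)
      (ae_restrict_mem isClosed_closure.measurableSet)
  filter_upwards [ae_restrict_of_ae h1, h2] with x hx hxω
  rw [← T.cover] at hxω
  obtain ⟨t, ht, hxt⟩ := mem_iUnion₂.1 hxω
  refine ⟨t, ht, ?_⟩
  by_contra h
  exact hx t ht ⟨subset_closure hxt, h⟩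

/-- The piecewise constant gradient of a piecewise affine function. -/
noncomputable def pwGrad (A : Finset R2 → (R2 →ᵃ[ℝ] R3)) (i : Fin 2) (x : R2) : R3 :=
  ∑ t ∈ T.tri, (interior (convexHull ℝ (t : Set R2))).indicator (fun _ => (A t).linear (e2 i)) x

variable {T} {A : Finset R2 → (R2 →ᵃ[ℝ] R3)} {q : R2 → R3}

theorem pwGrad_eq {t : Finset R2} (ht : t ∈ T.tri) {x : R2}
    (hx : x ∈ interior (convexHull ℝ (t : Set R2))) (i : Fin 2) :
    T.pwGrad A i x = (A t).linear (e2 i) := by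
  rw [pwGrad, Finset.sum_eq_single t]
  · rw [indicator_of_mem hx]
  · intro s hs hst
    apply indicator_of_notMem
    intro h
    exact T.notMem_hull_of_mem_interior hs ht hst hx (interior_subset h)
  · exact fun h => absurd ht h

theorem measurable_pwGrad (i : Fin 2) : StronglyMeasurable (T.pwGrad A i) := by
  have : T.pwGrad A i = ∑ t ∈ T.tri,
      (interior (convexHull ℝ (t : Set R2))).indicator (fun _ => (A t).linear (e2 i)) := by
    ext1 x
    simp [pwGrad, Finset.sum_apply]
  rw [this]
  apply Finset.stronglyMeasurable_sum
  intro t _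
  exact stronglyMeasurable_const.indicator isOpen_interior.measurableSet

theorem norm_pwGrad_le {C : ℝ} (hC : 0 ≤ C) (hA : ∀ t ∈ T.tri, ∀ e, ‖(A t).linear e‖ ≤ C * ‖e‖)
    (i : Fin 2) (x : R2) : ‖T.pwGrad A i x‖ ≤ C := by
  by_cases h : ∃ t ∈ T.tri, x ∈ interior (convexHull ℝ (t : Set R2))
  · obtain ⟨t, ht, hx⟩ := h
    rw [pwGrad_eq ht hx]
    simpa using hA t ht (e2 i)
  · push Not at h
    rw [pwGrad, Finset.sum_eq_zero fun t ht => indicator_of_notMem (h t ht) _, norm_zero]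
    exact hC

/-- Near a point of the segment only triangles containing that point occur, so a nearby point shares
a triangle with it and the affine bound applies. Continuous induction along the segment does the
rest. -/
theorem segment_lipschitz {C : ℝ} (hq : ∀ t ∈ T.tri, EqOn q (A t) (convexHull ℝ (t : Set R2)))
    (hA : ∀ t ∈ T.tri, ∀ e, ‖(A t).linear e‖ ≤ C * ‖e‖) {x y : R2}
    (hxy : segment ℝ x y ⊆ ω) : ‖q x - q y‖ ≤ C * ‖x - y‖ := by
  have hmem : ∀ s ∈ Icc (0 : ℝ) 1, (AffineMap.lineMap y x s : R2) ∈ ω := by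
    intro s hs
    apply hxy
    rw [segment_symm, segment_eq_image_lineMap]
    exact ⟨s, hs, rfl⟩
  have hline : Continuous fun s : ℝ => (AffineMap.lineMap y x s : R2) :=
    AffineMap.lineMap_continuous
  have := norm_sub_le_of_eventually (h := fun s => q (AffineMap.lineMap y x s))
    (K := C * ‖x - y‖) ?_
  · simpa using this
  intro s₀ hs₀
  set x₀ : R2 := AffineMap.lineMap y x s₀ with hx₀
  have hev : ∀ᶠ z in 𝓝 x₀, ∀ t ∈ T.tri, z ∈ convexHull ℝ (t : Set R2) →
      x₀ ∈ convexHull ℝ (t : Set R2) := by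
    rw [T.tri.eventually_all]
    intro t _
    by_cases h : x₀ ∈ convexHull ℝ (t : Set R2)
    · exact Eventually.of_forall fun _ _ => h
    · filter_upwards [(isCompact_hull t).isClosed.isOpen_compl.mem_nhds h] with z hz hz'
      exact absurd hz' hz
  have hev' := (hline.tendsto s₀).eventually hev
  filter_upwards [mem_nhdsWithin_of_mem_nhds hev', self_mem_nhdsWithin] with s hs hsI
  have hcov : (AffineMap.lineMap y x s : R2) ∈ ⋃ t ∈ T.tri, convexHull ℝ (t : Set R2) := by
    rw [T.cover]
    exact subset_closure (hmem s hsI)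
  obtain ⟨t, ht, hst⟩ := mem_iUnion₂.1 hcov
  rw [hq t ht hst, hq t ht (hs t ht hst)]
  have hlin := (A t).linearMap_vsub (AffineMap.lineMap y x s) x₀
  rw [vsub_eq_sub, vsub_eq_sub] at hlin
  rw [← hlin]
  refine (hA t ht _).trans (le_of_eq ?_)
  have : (AffineMap.lineMap y x s : R2) - x₀ = (s - s₀) • (x - y) := by
    rw [hx₀, AffineMap.lineMap_apply, AffineMap.lineMap_apply]
    simp only [vsub_eq_sub, vadd_eq_add]
    module
  rw [this, norm_smul, Real.norm_eq_abs]
  ring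

theorem hasWeakPartial_pwGrad (hω : IsOpen ω) {C : ℝ} (hC : 0 ≤ C)
    (hq : ∀ t ∈ T.tri, EqOn q (A t) (convexHull ℝ (t : Set R2)))
    (hA : ∀ t ∈ T.tri, ∀ e, ‖(A t).linear e‖ ≤ C * ‖e‖) (i : Fin 2) :
    HasWeakPartial ω i q (T.pwGrad A i) := by
  apply HasWeakPartial.of_lipschitz hω (fun x y hxy => segment_lipschitz hq hA hxy)
  · apply LocallyIntegrable.locallyIntegrableOn
    apply (locallyIntegrable_const C).mono (measurable_pwGrad i).aestronglyMeasurable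
    refine Eventually.of_forall fun x => ?_
    rw [Real.norm_of_nonneg hC]
    exact norm_pwGrad_le hC hA i x
  · filter_upwards [T.ae_mem_interior] with x hx
    obtain ⟨t, ht, hxt⟩ := hx
    rw [pwGrad_eq ht hxt]
    have hd : HasFDerivAt (A t) (LinearMap.toContinuousLinearMap (A t).linear) x := by
      have h1 : HasFDerivAt (fun y => LinearMap.toContinuousLinearMap (A t).linear y + (A t) 0)
          (LinearMap.toContinuousLinearMap (A t).linear) x :=
        (ContinuousLinearMap.hasFDerivAt _).add_const _
      refine h1.congr_of_eventuallyEq (Eventually.of_forall fun y => ?_)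
      have := congrFun (A t).decomp y
      simpa using this
    have hd' : HasFDerivAt q (LinearMap.toContinuousLinearMap (A t).linear) x := by
      apply hd.congr_of_eventuallyEq
      filter_upwards [isOpen_interior.mem_nhds hxt] with y hy
      exact hq t ht (interior_subset hy)
    exact hd'.hasLineDerivAt (e2 i)

theorem bounded_of_piecewiseAffine (hq : ∀ t ∈ T.tri, EqOn q (A t) (convexHull ℝ (t : Set R2))) :
    ∃ B : ℝ, ∀ x ∈ ω, ‖q x‖ ≤ B := by
  have h1 : ∀ t : Finset R2, ∃ B : ℝ, 0 ≤ B ∧ ∀ x ∈ convexHull ℝ (t : Set R2), ‖A t x‖ ≤ B := by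
    intro t
    obtain ⟨B, hB⟩ := ((isCompact_hull t).image
      (A t).continuous_of_finiteDimensional).isBounded.exists_norm_le
    refine ⟨max B 0, le_max_right _ _, fun x hx => (hB _ ⟨x, hx, rfl⟩).trans (le_max_left _ _)⟩
  choose B hB0 hB using h1
  refine ⟨∑ t ∈ T.tri, B t, fun x hx => ?_⟩
  have hx' : x ∈ closure ω := subset_closure hx
  rw [← T.cover] at hx'
  obtain ⟨t, ht, hxt⟩ := mem_iUnion₂.1 hx'
  rw [hq t ht hxt]
  exact (hB t x hxt).trans (Finset.single_le_sum (fun t _ => hB0 t) ht)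

/-- The classical piecewise gradient is the weak one because the function is Lipschitz along
segments. The factor 2 is a crude bound for the Frobenius norm of two columns. -/
theorem memW1p_of_piecewiseAffine (hω : IsOpen ω) {C : ℝ} (hC : 0 ≤ C)
    (hq : ∀ t ∈ T.tri, EqOn q (A t) (convexHull ℝ (t : Set R2)))
    (hA : ∀ t ∈ T.tri, ∀ e, ‖(A t).linear e‖ ≤ C * ‖e‖) :
    MemW1p ω ∞ q ∧
      eLpNorm (weakGrad ω q) ∞ (volume.restrict ω) ≤ ENNReal.ofReal (2 * C) := by
  have hqc : ContinuousOn q ω :=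
    continuousOn_of_segment_lipschitz hω fun x y hxy => segment_lipschitz hq hA hxy
  have hwp := fun i => hasWeakPartial_pwGrad hω hC hq hA i
  have hae := fun i => weakPartial_ae_eq hω (hwp i)
  have hgb : ∀ᵐ x ∂(volume.restrict ω), ‖weakGrad ω q x‖ ≤ 2 * C := by
    filter_upwards [hae 0, hae 1] with x h0 h1
    rw [weakGrad, PiLp.norm_eq_of_L2, Fin.sum_univ_two]
    simp only [h0, h1]
    have b0 := norm_pwGrad_le hC hA 0 x
    have b1 := norm_pwGrad_le hC hA 1 x
    apply Real.sqrt_le_iff.2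
    refine ⟨by positivity, ?_⟩
    nlinarith [norm_nonneg (T.pwGrad A 0 x), norm_nonneg (T.pwGrad A 1 x)]
  obtain ⟨B, hB⟩ := bounded_of_piecewiseAffine hq
  refine ⟨⟨?_, fun i => ⟨_, hwp i⟩, ?_⟩, ?_⟩
  · refine memLp_top_of_bound (hqc.aestronglyMeasurable hω.measurableSet) B ?_
    filter_upwards [ae_restrict_mem hω.measurableSet] with x hx using hB x hx
  · rw [memLp_piLp_iff]
    intro i
    refine memLp_top_of_bound ?_ C ?_
    · exact (measurable_pwGrad i).aestronglyMeasurable.congr (hae i).symm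
    · filter_upwards [hae i] with x hx
      change ‖weakPartial ω i q x‖ ≤ C
      rw [hx]
      exact norm_pwGrad_le hC hA i x
  · rw [eLpNorm_exponent_top]
    refine eLpNormEssSup_le_of_ae_bound ?_
    exact hgb

/-- The affine pieces agree on overlaps: by conformity an overlap lies in the hull of common
vertices, where both take the prescribed values. -/
theorem exists_interpolant (T : Triangulation ω) (Q : R2 → R3) :
    ∃ (q : R2 → R3) (A : Finset R2 → (R2 →ᵃ[ℝ] R3)),
      (∀ t ∈ T.tri, EqOn q (A t) (convexHull ℝ (t : Set R2))) ∧
      (∀ t ∈ T.tri, ∀ z ∈ t, A t z = Q z) ∧ ∀ z ∈ T.nodes, q z = Q z := by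
  classical
  choose! A hA using fun t ht => exists_affine_interpolant (T.indep t ht) (T.card_eq t ht) Q
  set q : R2 → R3 := fun x =>
    if h : ∃ t ∈ T.tri, x ∈ convexHull ℝ (t : Set R2) then A h.choose x else 0 with hq
  have hqA : ∀ t ∈ T.tri, EqOn q (A t) (convexHull ℝ (t : Set R2)) := by
    intro t ht x hx
    have hex : ∃ t ∈ T.tri, x ∈ convexHull ℝ (t : Set R2) := ⟨t, ht, hx⟩
    simp only [hq, hex, dite_true]
    obtain ⟨hs, hxs⟩ := hex.choose_spec
    set s := hex.choose
    have h0 : (A s - A t) x = 0 := by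
      apply AffineMap.eq_zero_of_mem_convexHull _ _ (T.conforming s hs t ht ⟨hxs, hx⟩)
      intro z hz
      simp [hA s hs z hz.1, hA t ht z hz.2]
    simpa [sub_eq_zero] using h0
  refine ⟨q, A, hqA, hA, ?_⟩
  rintro z ⟨t, ht, hz⟩
  rw [hqA t ht (subset_convexHull ℝ _ hz), hA t ht z hz]

end Triangulation

end PiecewiseAffine

/-! ### Relaxed admissible deformations -/

section Relaxed

theorem IsLipschitzDomain.volume_ne_top {Ω : Set R2} (h : IsLipschitzDomain Ω) : volume Ω ≠ ∞ :=
  h.2.2.1.measure_lt_top.ne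

theorem IsIsometric.norm_eq_one {U : Set R2} {v : R2 → R3} (h : IsIsometric U v) (i : Fin 2) :
    ∀ᵐ x ∂(volume.restrict U), ‖weakPartial U i v x‖ = 1 := by
  filter_upwards [h] with x hx
  have := hx i i
  rw [if_pos rfl, real_inner_self_eq_norm_sq] at this
  nlinarith [norm_nonneg (weakPartial U i v x)]

variable {U : Set R2} {v : R2 → R3}

theorem MemH2.integrableOn (h : MemH2 U v) (hU : volume U ≠ ∞) : IntegrableOn v U volume := by
  have : IsFiniteMeasure (volume.restrict U) := isFiniteMeasure_restrict.2 hU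
  exact h.1.1.integrable (by norm_num)

theorem MemH2.memLp_weakPartial (h : MemH2 U v) (i : Fin 2) :
    MemLp (weakPartial U i v) 2 (volume.restrict U) :=
  (memLp_piLp_iff.1 h.1.2.2) i

theorem MemH2.integrableOn_weakPartial (h : MemH2 U v) (hU : volume U ≠ ∞) (i : Fin 2) :
    IntegrableOn (weakPartial U i v) U volume := by
  have : IsFiniteMeasure (volume.restrict U) := isFiniteMeasure_restrict.2 hU
  exact (h.memLp_weakPartial i).integrable (by norm_num)

theorem MemH2.memLp_weakHess (h : MemH2 U v) (i j : Fin 2) :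
    MemLp (weakPartial U i (weakPartial U j v)) 2 (volume.restrict U) :=
  (memLp_piLp_iff.1 h.2.2) (i, j)

theorem MemH2.hasWeakPartial (h : MemH2 U v) (hU : IsOpen U) (i : Fin 2) :
    HasWeakPartial U i v (weakPartial U i v) :=
  hasWeakPartial_weakPartial hU (h.1.2.1 i)

theorem MemH2.hasWeakPartial₂ (h : MemH2 U v) (hU : IsOpen U) (i j : Fin 2) :
    HasWeakPartial U i (weakPartial U j v) (weakPartial U i (weakPartial U j v)) :=
  hasWeakPartial_weakPartial hU (h.2.1 i j)

theorem exists_lipschitz_contRep {ω : Set R2} {b : ℝ → R2} {α β : ℝ} (hω : IsLipschitzDomain ω)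
    (M : CreaseMesh ω b α β) {v : R2 → R3} (hv : v ∈ relaxedAdmissible M) :
    ∃ w, IsContRep M.perforated v w ∧
      (∀ x y, segment ℝ x y ⊆ M.perforated → ‖w x - w y‖ ≤ 2 * ‖x - y‖) ∧
      ∀ z ∈ M.nodes, ∃ l, Tendsto w (𝓝[M.perforated] z) (𝓝 l) := by
  obtain ⟨hH2, hiso, w, hw, hlim⟩ := hv
  have hP := M.isOpen_perforated hω.1
  have hvol : volume M.perforated ≠ ∞ :=
    ne_top_of_le_ne_top hω.volume_ne_top (measure_mono M.perforated_subset)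
  have hlip : ∀ x y, segment ℝ x y ⊆ M.perforated → ‖w x - w y‖ ≤ 2 * ‖x - y‖ := fun x y hxy =>
    hw.norm_sub_le hP (hH2.integrableOn hvol) (fun i => hH2.hasWeakPartial hP i)
      (fun i => (hiso.norm_eq_one i).mono fun x hx => hx.le) hxy
  refine ⟨w, hw, hlip, fun z hz => ?_⟩
  by_cases h : ∃ i, z = b (M.t i)
  · obtain ⟨i, rfl⟩ := h
    exact hlim i
  · push Not at h
    exact M.exists_tendsto_of_connected hω hlip hz (M.node_connected z hz h)

end Relaxed

/-! ### The nodal interpolants and their convergence -/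

section NodalInterpolants

variable {ω : Set R2} {b : ℝ → R2} {α β : ℝ}

/-- The data of a nodal interpolant: the interpolant `q`, the affine functions `A` on the triangles
and the continuous representative `w` of the interpolated function `v`, with Lipschitz bounds. -/
structure InterpolantData (M : CreaseMesh ω b α β) (v q w : R2 → R3)
    (A : Finset R2 → (R2 →ᵃ[ℝ] R3)) (C : ℝ) : Prop where
  contRep : IsContRep M.perforated v w
  lip : ∀ x y, segment ℝ x y ⊆ M.perforated → ‖w x - w y‖ ≤ 2 * ‖x - y‖
  tendsto : ∀ z ∈ M.nodes, Tendsto w (𝓝[M.perforated] z) (𝓝 (q z))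
  eqOn : ∀ t ∈ M.tri, EqOn q (A t) (convexHull ℝ (t : Set R2))
  bound : ∀ t ∈ M.tri, ∀ e, ‖(A t).linear e‖ ≤ C * ‖e‖

theorem InterpolantData.mono {M : CreaseMesh ω b α β} {v q w : R2 → R3}
    {A : Finset R2 → (R2 →ᵃ[ℝ] R3)} {C C' : ℝ} (h : InterpolantData M v q w A C) (hC : C ≤ C') :
    InterpolantData M v q w A C' :=
  { h with bound := fun t ht e =>
      (h.bound t ht e).trans (mul_le_mul_of_nonneg_right hC (norm_nonneg e)) }

theorem InterpolantData.isNodalInterpolant {M : CreaseMesh ω b α β} {v q w : R2 → R3}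
    {A : Finset R2 → (R2 →ᵃ[ℝ] R3)} {C : ℝ} (h : InterpolantData M v q w A C) :
    IsNodalInterpolant M v q :=
  ⟨fun s hs => ⟨A s, h.eqOn s hs⟩, w, h.contRep, h.tendsto⟩

/-- In the interior of the perforated domain, the interpolant agrees with `w` in the nodes. -/
theorem InterpolantData.eq_of_mem {M : CreaseMesh ω b α β} {v q w : R2 → R3}
    {A : Finset R2 → (R2 →ᵃ[ℝ] R3)} {C : ℝ} (h : InterpolantData M v q w A C)
    {z : R2} (hz : z ∈ M.nodes) (hzP : z ∈ M.perforated) : q z = w z := by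
  have h1 : Tendsto w (𝓝[M.perforated] z) (𝓝 (w z)) := h.contRep.1 z hzP
  have : (𝓝[M.perforated] z).NeBot :=
    mem_closure_iff_nhdsWithin_neBot.1 (subset_closure hzP)
  exact tendsto_nhds_unique (h.tendsto z hz) h1

/-- The same interpolant receives two bounds: some constant on any mesh, and a constant depending on
`κ` alone if the crease segments have inner ends. The latter is the oscillation `(4 + 2 * κ)` times
the diameter, divided by the inscribed radius. The absolute value keeps it nonnegative, since `0 ≤
κ` is known only once there is a triangle. -/
theorem exists_interpolantData (hω : IsLipschitzDomain ω) (M : CreaseMesh ω b α β)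
    {v : R2 → R3} (hv : v ∈ relaxedAdmissible M) :
    ∃ q w A, (∃ C, 0 ≤ C ∧ InterpolantData M v q w A C) ∧
      ∀ κ, M.ShapeRegular κ →
        (∀ j : Fin M.N, b (M.t j.castSucc) ≠ b (M.t j.succ) →
          (∃ s ∈ M.creaseTri, b (M.t j.castSucc) ∈ s ∧ b (M.t j.succ) ∈ s) →
          b (M.t j.castSucc) ∈ ω ∨ b (M.t j.succ) ∈ ω) →
        InterpolantData M v q w A ((4 + 2 * |κ|) * |κ|) := by
  obtain ⟨w, hw, hlip, hlim⟩ := exists_lipschitz_contRep hω M hv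
  choose! Q hQ using hlim
  obtain ⟨q, A, hqA, hAQ, hqQ⟩ := M.toTriangulation.exists_interpolant Q
  have htend : ∀ z ∈ M.nodes, Tendsto w (𝓝[M.perforated] z) (𝓝 (q z)) := fun z hz => by
    rw [hqQ z hz]; exact hQ z hz
  refine ⟨q, w, A, ?_, ?_⟩
  · refine ⟨∑ t ∈ M.tri, ‖LinearMap.toContinuousLinearMap (A t).linear‖,
      Finset.sum_nonneg fun t _ => norm_nonneg _, ⟨hw, hlip, htend, hqA, fun t ht e => ?_⟩⟩
    refine ((LinearMap.toContinuousLinearMap (A t).linear).le_opNorm e).trans ?_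
    refine mul_le_mul_of_nonneg_right ?_ (norm_nonneg e)
    exact Finset.single_le_sum
      (f := fun t : Finset R2 => ‖LinearMap.toContinuousLinearMap (A t).linear‖)
      (fun t _ => norm_nonneg _) ht
  · intro κ hκ hin
    refine ⟨hw, hlip, htend, hqA, fun t ht e => ?_⟩
    obtain ⟨x, ρ, hρ, hball, hdiam⟩ := hκ t ht
    have hκ0 : 0 ≤ κ := nonneg_of_mul_nonneg_left (Metric.diam_nonneg.trans hdiam) hρ
    rw [abs_of_nonneg hκ0]
    have hosc := fun z hz z' hz' => M.norm_sub_le_of_inner_vertex hω hκ hin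
      (fun t ht htc z hz z' hz' => M.norm_sub_le_of_not_crease hω hlip hQ ht htc hz hz') ht
      (z := z) (z' := z') hz hz'
    obtain ⟨z₀, hz₀⟩ : t.Nonempty := by
      rw [← Finset.card_pos, M.card_eq t ht]; norm_num
    by_cases he : e = 0
    · simp [he]
    have hpos : 0 < ‖e‖ := norm_pos_iff.2 he
    have hunit : ‖(‖e‖⁻¹ • e)‖ = 1 := by
      rw [norm_smul, norm_inv, norm_norm, inv_mul_cancel₀ hpos.ne']
    have key := norm_linear_le_of_norm_le_on_vertices hρ hball
      (A t - AffineMap.const ℝ R2 (Q z₀))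
      (m := (4 + 2 * κ) * Metric.diam (convexHull ℝ (t : Set R2))) (fun z hz => by
        have hz : z ∈ t := hz
        simp only [AffineMap.coe_sub, Pi.sub_apply, AffineMap.const_apply, hAQ t ht z hz]
        exact hosc z hz z₀ hz₀) hunit
    have hlin : (A t - AffineMap.const ℝ R2 (Q z₀)).linear (‖e‖⁻¹ • e) =
        ‖e‖⁻¹ • (A t).linear e := by simp
    rw [hlin, norm_smul, norm_inv, norm_norm, inv_mul_le_iff₀ hpos] at key
    refine key.trans ?_
    rw [mul_comm]
    refine mul_le_mul_of_nonneg_right ?_ hpos.le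
    rw [div_le_iff₀ hρ, mul_assoc]
    exact mul_le_mul_of_nonneg_left hdiam (by positivity)

theorem Triangulation.ediam_le_meshSize (T : Triangulation ω) {t : Finset R2} (ht : t ∈ T.tri) :
    Metric.ediam (convexHull ℝ (t : Set R2)) ≤ T.meshSize :=
  Finset.le_sup (f := fun t : Finset R2 => Metric.ediam (convexHull ℝ (t : Set R2))) ht

theorem CreaseMesh.t_mem_Icc (M : CreaseMesh ω b α β) (i : Fin (M.N + 1)) : M.t i ∈ Icc α β :=
  ⟨M.t_zero.symm.le.trans (M.t_strictMono.monotone (Fin.zero_le _)),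
    (M.t_strictMono.monotone (Fin.le_last _)).trans M.t_last.le⟩

/-- A segment without an inner parameter joins the two ends of the whole curve. If these differ, a
triangle containing both is too large for a fine mesh. -/
theorem eventually_inner_vertex (hin : ∀ t ∈ Ioo α β, b t ∈ ω) (M : ℕ → CreaseMesh ω b α β)
    (hmesh : Tendsto (fun m => (M m).meshSize) atTop (𝓝 0)) :
    ∀ᶠ m in atTop, ∀ j : Fin (M m).N, b ((M m).t j.castSucc) ≠ b ((M m).t j.succ) →
      (∃ s ∈ (M m).creaseTri, b ((M m).t j.castSucc) ∈ s ∧ b ((M m).t j.succ) ∈ s) →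
      b ((M m).t j.castSucc) ∈ ω ∨ b ((M m).t j.succ) ∈ ω := by
  have hev : ∀ᶠ m in atTop, b α ≠ b β → (M m).meshSize < edist (b α) (b β) := by
    by_cases h : b α = b β
    · exact Eventually.of_forall fun m h' => absurd h h'
    · filter_upwards [hmesh.eventually (gt_mem_nhds (edist_pos.2 h))] with m hm _ using hm
  filter_upwards [hev] with m hm j hne hs
  have h0 : α ≤ (M m).t j.castSucc := ((M m).t_mem_Icc _).1
  have h1 : (M m).t j.castSucc < (M m).t j.succ := (M m).t_strictMono (Fin.castSucc_lt_succ)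
  have h2 : (M m).t j.succ ≤ β := ((M m).t_mem_Icc _).2
  rcases eq_or_lt_of_le h0 with h0 | h0
  · rcases eq_or_lt_of_le h2 with h2 | h2
    · exfalso
      rw [← h0, h2] at hne hs
      obtain ⟨s, hs, hs1, hs2⟩ := hs
      have := hm hne
      have h3 : edist (b α) (b β) ≤ Metric.ediam (convexHull ℝ (s : Set R2)) :=
        Metric.edist_le_ediam_of_mem (subset_convexHull ℝ _ hs1) (subset_convexHull ℝ _ hs2)
      exact absurd (h3.trans ((M m).ediam_le_meshSize ((M m).crease_subset hs))) (not_le.2 this)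
    · right
      exact hin _ ⟨h0.le.trans_lt h1, h2⟩
  · left
    exact hin _ ⟨h0, h1.trans_le h2⟩

/-- The uniform constant is available only for large `m`; adding the individual constants of the
remaining finitely many meshes covers all of them. -/
theorem exists_interpolantData_seq (hω : IsLipschitzDomain ω) (hin : ∀ t ∈ Ioo α β, b t ∈ ω)
    (M : ℕ → CreaseMesh ω b α β) {κ : ℝ} (hreg : ∀ m, (M m).ShapeRegular κ)
    (hmesh : Tendsto (fun m => (M m).meshSize) atTop (𝓝 0))
    {v : ℕ → R2 → R3} (hv : ∀ m, v m ∈ relaxedAdmissible (M m)) :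
    ∃ (q w : ℕ → R2 → R3) (A : ℕ → Finset R2 → (R2 →ᵃ[ℝ] R3)) (C : ℝ), 0 ≤ C ∧
      ∀ m, InterpolantData (M m) (v m) (q m) (w m) (A m) C := by
  choose q w A hC hκ using fun m => exists_interpolantData hω (M m) (hv m)
  choose Cm hCm0 hCm using hC
  obtain ⟨N, hN⟩ := eventually_atTop.1 (eventually_inner_vertex hin M hmesh)
  have hK : 0 ≤ (4 + 2 * |κ|) * |κ| := by positivity
  have hS : 0 ≤ ∑ m ∈ Finset.range N, Cm m := Finset.sum_nonneg fun m _ => hCm0 m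
  refine ⟨q, w, A, (4 + 2 * |κ|) * |κ| + ∑ m ∈ Finset.range N, Cm m, by positivity, fun m => ?_⟩
  by_cases hm : N ≤ m
  · exact (hκ m κ (hreg m) (hN m hm)).mono (by linarith)
  · refine (hCm m).mono ?_
    have := Finset.single_le_sum (f := Cm) (fun m _ => hCm0 m)
      (Finset.mem_range.2 (not_le.1 hm))
    linarith

/-- If the mesh is fine, then the triangles near a compact subset of `ω \ γ` do not meet the
fattened crease. -/
theorem eventually_hull_subset_perforated (hω : IsOpen ω) (hb : ContinuousOn b (Icc α β))
    (M : ℕ → CreaseMesh ω b α β)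
    (hmesh : Tendsto (fun m => (M m).meshSize) atTop (𝓝 0)) {K : Set R2} (hK : IsCompact K)
    (hKω : K ⊆ ω \ b '' Icc α β) :
    ∀ᶠ m in atTop, K ⊆ (M m).perforated ∧ ∀ t ∈ (M m).tri,
      (convexHull ℝ (t : Set R2) ∩ K).Nonempty →
        convexHull ℝ (t : Set R2) ⊆ (M m).perforated := by
  have hγ : IsCompact (b '' Icc α β) := isCompact_Icc.image_of_continuousOn hb
  obtain ⟨δ, hδ, hδω⟩ := hK.exists_cthickening_subset_open (hω.sdiff hγ.isClosed) hKω
  have hpos : (0 : ℝ≥0∞) < ENNReal.ofReal (δ / 2) := by simpa using hδ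
  filter_upwards [hmesh.eventually (gt_mem_nhds hpos)] with m hm
  have hdist : ∀ t ∈ (M m).tri, ∀ x ∈ convexHull ℝ (t : Set R2),
      ∀ y ∈ convexHull ℝ (t : Set R2), dist x y ≤ δ / 2 := by
    intro t ht x hx y hy
    have h1 : edist x y ≤ ENNReal.ofReal (δ / 2) :=
      (Metric.edist_le_ediam_of_mem hx hy).trans (((M m).ediam_le_meshSize ht).trans hm.le)
    rw [edist_dist] at h1
    exact (ENNReal.ofReal_le_ofReal_iff (by positivity)).1 h1
  have main : ∀ t ∈ (M m).tri, (convexHull ℝ (t : Set R2) ∩ K).Nonempty →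
      convexHull ℝ (t : Set R2) ⊆ (M m).perforated := by
    rintro t ht ⟨k, hkt, hkK⟩ x hx
    have hxk := hdist t ht x hx k hkt
    refine ⟨(hδω (Metric.mem_cthickening_of_dist_le x k δ K hkK (by linarith))).1, ?_⟩
    intro hfat
    obtain ⟨s, hs, hxs⟩ := mem_iUnion₂.1 hfat
    obtain ⟨j, a, hsa, -, -⟩ := (M m).crease_shape s hs
    have hc : b ((M m).t j.castSucc) ∈ convexHull ℝ (s : Set R2) := by
      apply subset_convexHull
      rw [hsa]; simp
    have hcx := hdist s ((M m).crease_subset hs) _ hc x hxs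
    have hcγ : b ((M m).t j.castSucc) ∈ b '' Icc α β := ⟨_, (M m).t_mem_Icc _, rfl⟩
    -- Two triangles of diameter at most `δ / 2` lead from `k` to a crease vertex, which lies on the
    -- curve, although the `δ`-thickening of `K` avoids the curve.
    refine (hδω (Metric.mem_cthickening_of_dist_le _ k δ K hkK ?_)).2 hcγ
    have := dist_triangle (b ((M m).t j.castSucc)) x k
    linarith
  refine ⟨fun k hk => ?_, main⟩
  have hkω : k ∈ closure ω := subset_closure (hKω hk).1
  rw [← (M m).cover] at hkω
  obtain ⟨t, ht, hkt⟩ := mem_iUnion₂.1 hkω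
  exact main t ht ⟨k, hkt, hk⟩ hkt

theorem lintegral_weakHess_sq_le (hω : IsLipschitzDomain ω) (M : CreaseMesh ω b α β) {v : R2 → R3}
    (hv : v ∈ relaxedAdmissible M) {c : ℝ} (hc : relaxedEnergy M v ≤ c) :
    ∫⁻ x in M.perforated, ‖weakHess M.perforated v x‖ₑ ^ 2 ≤ ENNReal.ofReal (2 * c) := by
  have hP := M.isOpen_perforated hω.1
  have hmem := hv.1.2.2
  have hInt : Integrable (fun x => ‖weakHess M.perforated v x‖ ^ 2)
      (volume.restrict M.perforated) := hmem.integrable_norm_pow (by norm_num)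
  have h1 : ∫ x in M.perforated, ‖weakHess M.perforated v x‖ ^ 2 ≤ 2 * c := by
    have : (1 / 2 : ℝ) * ∫ x in M.perforated, ‖weakHess M.perforated v x‖ ^ 2 ≤ c := hc
    linarith
  refine le_trans (le_of_eq ?_) (ENNReal.ofReal_le_ofReal h1)
  rw [ofReal_integral_eq_lintegral_ofReal hInt (Eventually.of_forall fun x => by positivity)]
  congr 1; ext1 x
  rw [ENNReal.ofReal_pow (norm_nonneg _), ofReal_norm]

theorem enorm_weakHess_sq (U : Set R2) (v : R2 → R3) (x : R2) :
    ‖weakHess U v x‖ₑ ^ 2 =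
      ∑ p : Fin 2 × Fin 2, ‖weakPartial U p.1 (weakPartial U p.2 v) x‖ₑ ^ 2 := by
  rw [← ofReal_norm, ← ENNReal.ofReal_pow (norm_nonneg _), PiLp.norm_sq_eq_of_L2,
    ENNReal.ofReal_sum_of_nonneg fun p _ => by positivity]
  refine Finset.sum_congr rfl fun p _ => ?_
  rw [ENNReal.ofReal_pow (norm_nonneg _), ofReal_norm]
  rfl

/-- The gradient error of the interpolants away from the crease. -/
theorem InterpolantData.lintegral_grad_error_le (hω : IsLipschitzDomain ω)
    {M : CreaseMesh ω b α β} {κ : ℝ} (hreg : M.ShapeRegular κ) {v q w : R2 → R3}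
    {A : Finset R2 → (R2 →ᵃ[ℝ] R3)} {C : ℝ} (h : InterpolantData M v q w A C)
    (hv : v ∈ relaxedAdmissible M) {c : ℝ} (hc : relaxedEnergy M v ≤ c) {W : Set R2}
    (hW : W ⊆ ω) (hWt : ∀ t ∈ M.tri, (convexHull ℝ (t : Set R2) ∩ W).Nonempty →
      convexHull ℝ (t : Set R2) ⊆ M.perforated)
    {d : ℝ} (hd : ∀ t ∈ M.tri, Metric.diam (convexHull ℝ (t : Set R2)) ≤ d) (j : Fin 2) :
    ∫⁻ x in W, ‖M.pwGrad A j x - weakPartial M.perforated j v x‖ₑ ^ 2 ≤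
      ENNReal.ofReal (72 * κ ^ 2 * d ^ 2) * ENNReal.ofReal (2 * c) := by
  classical
  have hP := M.isOpen_perforated hω.1
  have hvol : volume M.perforated ≠ ∞ :=
    ne_top_of_le_ne_top hω.volume_ne_top (measure_mono M.perforated_subset)
  have hH2 := hv.1
  set S : Finset (Finset R2) :=
    {t ∈ M.tri | (convexHull ℝ (t : Set R2) ∩ W).Nonempty} with hS
  set I : Finset R2 → Set R2 := fun t => interior (convexHull ℝ (t : Set R2)) with hI
  have hIm : ∀ t, MeasurableSet (I t) := fun t => isOpen_interior.measurableSet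
  have hdis : (S : Set (Finset R2)).PairwiseDisjoint I := by
    intro s hs t ht hst
    rw [Function.onFun, Set.disjoint_left]
    intro x hxs hxt
    exact M.notMem_hull_of_mem_interior (Finset.mem_filter.1 hs).1 (Finset.mem_filter.1 ht).1 hst
      hxt (interior_subset hxs)
  have hSP : ∀ t ∈ S, convexHull ℝ (t : Set R2) ⊆ M.perforated := fun t ht =>
    hWt t (Finset.mem_filter.1 ht).1 (Finset.mem_filter.1 ht).2
  -- Up to a null set, `W` is covered by the disjoint interiors of the triangles that meet it.
  have hWI : volume.restrict W ≤ volume.restrict (⋃ t ∈ S, I t) := by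
    apply Measure.restrict_mono'
    · have hae : ∀ᵐ x ∂(volume : Measure R2), ∀ t ∈ M.tri,
          x ∉ frontier (convexHull ℝ (t : Set R2)) := by
        rw [Finset.eventually_all]
        intro t _
        exact measure_eq_zero_iff_ae_notMem.1 ((convex_convexHull ℝ _).addHaar_frontier volume)
      filter_upwards [hae] with x hx hxW
      have hxω : x ∈ closure ω := subset_closure (hW hxW)
      rw [← M.cover] at hxω
      obtain ⟨t, ht, hxt⟩ := mem_iUnion₂.1 hxω
      refine mem_iUnion₂.2 ⟨t, Finset.mem_filter.2 ⟨ht, x, hxt, hxW⟩, ?_⟩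
      by_contra hn
      exact hx t ht ⟨subset_closure hxt, hn⟩
    · exact le_rfl
  set H : Fin 2 → Fin 2 → R2 → R3 := fun i j =>
    weakPartial M.perforated i (weakPartial M.perforated j v) with hH
  calc ∫⁻ x in W, ‖M.pwGrad A j x - weakPartial M.perforated j v x‖ₑ ^ 2
      ≤ ∫⁻ x in ⋃ t ∈ S, I t, ‖M.pwGrad A j x - weakPartial M.perforated j v x‖ₑ ^ 2 :=
        lintegral_mono' hWI le_rfl
    _ = ∑ t ∈ S, ∫⁻ x in I t, ‖M.pwGrad A j x - weakPartial M.perforated j v x‖ₑ ^ 2 :=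
        lintegral_biUnion_finset hdis (fun t _ => hIm t) _
    _ ≤ ∑ t ∈ S, ENNReal.ofReal (72 * κ ^ 2 * d ^ 2) *
        ∫⁻ x in I t, ‖weakHess M.perforated v x‖ₑ ^ 2 := by
        apply Finset.sum_le_sum
        intro t htS
        have ht : t ∈ M.tri := (Finset.mem_filter.1 htS).1
        obtain ⟨x₀, ρ, hρ, hball, hdiam⟩ := hreg t ht
        have hdt := hd t ht
        set dt := Metric.diam (convexHull ℝ (t : Set R2)) with hdt'
        have hdt0 : 0 ≤ dt := Metric.diam_nonneg
        have hkey := lintegral_interpolation_error_le hP (hH2.integrableOn hvol)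
          (fun i => hH2.integrableOn_weakPartial hvol i) (fun i j => hH2.memLp_weakHess i j)
          (fun i => hH2.hasWeakPartial hP i) (fun i j => hH2.hasWeakPartial₂ hP i j) h.contRep
          (M.card_eq t ht) hρ hball (hSP t htS) le_rfl (A t) (fun z hz => by
            have hzh : z ∈ convexHull ℝ (t : Set R2) := subset_convexHull ℝ _ hz
            rw [← h.eqOn t ht hzh]
            exact h.eq_of_mem ⟨t, ht, hz⟩ (hSP t htS hzh)) j
        have hres : volume.restrict (convexHull ℝ (t : Set R2)) = volume.restrict (I t) := by
          apply Measure.restrict_congr_set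
          exact ((convex_convexHull ℝ _).addHaar_frontier volume |>
            interior_ae_eq_of_null_frontier).symm
        rw [hres] at hkey
        -- Two of the four powers of the diameter are absorbed by shape regularity; the other two
        -- give the rate.
        have hconst : 72 * dt ^ 4 / ρ ^ 2 ≤ 72 * κ ^ 2 * d ^ 2 := by
          rw [div_le_iff₀ (by positivity)]
          have h1 : dt ^ 2 ≤ (κ * ρ) ^ 2 := by gcongr
          have h2 : dt ^ 2 ≤ d ^ 2 := by gcongr
          calc 72 * dt ^ 4 = 72 * (dt ^ 2 * dt ^ 2) := by ring
            _ ≤ 72 * ((κ * ρ) ^ 2 * d ^ 2) := by gcongr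
            _ = _ := by ring
        calc ∫⁻ x in I t, ‖M.pwGrad A j x - weakPartial M.perforated j v x‖ₑ ^ 2
            = ∫⁻ x in I t, ‖(A t).linear (e2 j) - weakPartial M.perforated j v x‖ₑ ^ 2 := by
              apply setLIntegral_congr_fun (hIm t)
              intro x hx
              simp only [Triangulation.pwGrad_eq ht hx]
          _ ≤ ENNReal.ofReal (72 * dt ^ 4 / ρ ^ 2) *
              ∑ p : Fin 2 × Fin 2, ∫⁻ x in I t, ‖H p.1 p.2 x‖ₑ ^ 2 := hkey
          _ = ENNReal.ofReal (72 * dt ^ 4 / ρ ^ 2) *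
              ∫⁻ x in I t, ‖weakHess M.perforated v x‖ₑ ^ 2 := by
              congr 1
              simp_rw [enorm_weakHess_sq]
              rw [lintegral_finsetSum']
              intro p _
              have := (hH2.memLp_weakHess p.1 p.2).aestronglyMeasurable.enorm.pow_const 2
              exact this.mono_measure (Measure.restrict_mono_set volume
                (interior_subset.trans (hSP t htS)))
          _ ≤ _ := mul_le_mul_left (ENNReal.ofReal_le_ofReal hconst) _
    _ = ENNReal.ofReal (72 * κ ^ 2 * d ^ 2) *
        ∫⁻ x in ⋃ t ∈ S, I t, ‖weakHess M.perforated v x‖ₑ ^ 2 := by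
        rw [← Finset.mul_sum, lintegral_biUnion_finset hdis (fun t _ => hIm t)]
    _ ≤ _ := by
        refine mul_le_mul_right ?_ _
        refine le_trans (lintegral_mono_set ?_) (lintegral_weakHess_sq_le hω M hv hc)
        exact iUnion₂_subset fun t ht => interior_subset.trans (hSP t ht)

end NodalInterpolants

/-! ### Convergence of the interpolants away from the crease -/

section InterpolationConvergence

variable {ω : Set R2} {b : ℝ → R2} {α β : ℝ}

theorem weakGrad_apply (U : Set R2) (f : R2 → R3) (x : R2) (i : Fin 2) :
    weakGrad U f x i = weakPartial U i f x := rfl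

theorem eLpNorm_weakGrad_le {U : Set R2} {f : R2 → R3} {μ : Measure R2}
    (hf : MemLp (weakGrad U f) 2 μ) :
    eLpNorm (weakGrad U f) 2 μ ≤
      eLpNorm (weakPartial U 0 f) 2 μ + eLpNorm (weakPartial U 1 f) 2 μ := by
  have hm : ∀ i, AEStronglyMeasurable (weakPartial U i f) μ := fun i =>
    ((memLp_piLp_iff.1 hf) i).aestronglyMeasurable
  have h1 : eLpNorm (weakGrad U f) 2 μ ≤
      eLpNorm ((fun x => ‖weakPartial U 0 f x‖) + fun x => ‖weakPartial U 1 f x‖) 2 μ := by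
    apply eLpNorm_mono_real
    intro x
    rw [PiLp.norm_eq_of_L2, Fin.sum_univ_two, weakGrad_apply, weakGrad_apply, Pi.add_apply]
    apply Real.sqrt_le_iff.2
    refine ⟨by positivity, ?_⟩
    nlinarith [norm_nonneg (weakPartial U 0 f x), norm_nonneg (weakPartial U 1 f x)]
  refine h1.trans ((eLpNorm_add_le (hm 0).norm (hm 1).norm (by norm_num)).trans ?_)
  rw [eLpNorm_norm, eLpNorm_norm]

theorem eLpNorm_two_eq {E : Type*} [NormedAddCommGroup E] {f : R2 → E} {μ : Measure R2} :
    eLpNorm f 2 μ = (∫⁻ x, ‖f x‖ₑ ^ 2 ∂μ) ^ (1 / 2 : ℝ) := by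
  rw [eLpNorm_eq_lintegral_rpow_enorm_toReal (by simp) (by simp)]
  simp

/-- The pointwise error of the interpolants away from the crease. -/
theorem InterpolantData.norm_sub_le {M : CreaseMesh ω b α β} {v q w : R2 → R3}
    {A : Finset R2 → (R2 →ᵃ[ℝ] R3)} {C : ℝ} (hC : 0 ≤ C) (h : InterpolantData M v q w A C)
    {t : Finset R2} (ht : t ∈ M.tri) (htP : convexHull ℝ (t : Set R2) ⊆ M.perforated) {x : R2}
    (hx : x ∈ convexHull ℝ (t : Set R2)) :
    ‖q x - w x‖ ≤ (C + 2) * Metric.diam (convexHull ℝ (t : Set R2)) := by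
  obtain ⟨z, hz⟩ : t.Nonempty := by
    rw [← Finset.card_pos, M.card_eq t ht]; norm_num
  have hzh : z ∈ convexHull ℝ (t : Set R2) := subset_convexHull ℝ _ hz
  have hqz : q z = w z := h.eq_of_mem ⟨t, ht, hz⟩ (htP hzh)
  have hxz : ‖x - z‖ ≤ Metric.diam (convexHull ℝ (t : Set R2)) := by
    rw [← dist_eq_norm]
    exact Metric.dist_le_diam_of_mem (Triangulation.isCompact_hull t).isBounded hx hzh
  have h1 : ‖q x - q z‖ ≤ C * ‖x - z‖ := by
    rw [h.eqOn t ht hx, h.eqOn t ht hzh]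
    have := (A t).linearMap_vsub x z
    rw [vsub_eq_sub, vsub_eq_sub] at this
    rw [← this]
    exact h.bound t ht _
  have h2 : ‖w x - w z‖ ≤ 2 * ‖x - z‖ :=
    h.lip x z (((convex_convexHull ℝ _).segment_subset hx hzh).trans htP)
  have h3 := _root_.norm_sub_le (q x - q z) (w x - w z)
  rw [hqz, sub_sub_sub_cancel_right] at h3
  rw [hqz] at h1
  nlinarith

theorem IsCompact.volume_ne_top_of_closure {W : Set R2} (h : IsCompact (closure W)) :
    volume W ≠ ∞ :=
  ne_top_of_le_ne_top h.measure_lt_top.ne (measure_mono subset_closure)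

theorem InterpolantData.hasWeakPartial_sub (hω : IsLipschitzDomain ω)
    {M : CreaseMesh ω b α β} {v q w : R2 → R3}
    {A : Finset R2 → (R2 →ᵃ[ℝ] R3)} {C : ℝ} (hC : 0 ≤ C) (h : InterpolantData M v q w A C)
    (hv : v ∈ relaxedAdmissible M) {W : Set R2} (hW : IsOpen W) (hWP : W ⊆ M.perforated)
    (j : Fin 2) :
    HasWeakPartial W j (q - M.perforated.indicator v)
      (M.pwGrad A j - weakPartial M.perforated j v) := by
  have hP := M.isOpen_perforated hω.1
  have h1 : HasWeakPartial W j q (M.pwGrad A j) :=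
    (Triangulation.hasWeakPartial_pwGrad hω.1 hC h.eqOn h.bound j).mono
      (hWP.trans M.perforated_subset)
  have h2 : HasWeakPartial W j v (weakPartial M.perforated j v) :=
    (hv.1.hasWeakPartial hP j).mono hWP
  have h3 : HasWeakPartial W j (M.perforated.indicator v) (weakPartial M.perforated j v) := by
    refine h2.congr hW ?_ EventuallyEq.rfl
    filter_upwards [ae_restrict_mem hW.measurableSet] with x hx
    rw [indicator_of_mem (hWP hx)]
  exact h1.sub h3

theorem InterpolantData.memW1p_sub (hω : IsLipschitzDomain ω)
    {M : CreaseMesh ω b α β} {v q w : R2 → R3}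
    {A : Finset R2 → (R2 →ᵃ[ℝ] R3)} {C : ℝ} (hC : 0 ≤ C) (h : InterpolantData M v q w A C)
    (hv : v ∈ relaxedAdmissible M) {W : Set R2} (hW : IsOpen W) (hWP : W ⊆ M.perforated) :
    MemW1p W 2 (q - M.perforated.indicator v) := by
  have hP := M.isOpen_perforated hω.1
  have hvol : volume W ≠ ∞ := ne_top_of_le_ne_top hω.volume_ne_top
    (measure_mono (hWP.trans M.perforated_subset))
  have : IsFiniteMeasure (volume.restrict W) := isFiniteMeasure_restrict.2 hvol
  have hwp := fun j => h.hasWeakPartial_sub hω hC hv hW hWP j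
  have hPW : volume.restrict W ≤ volume.restrict M.perforated :=
    Measure.restrict_mono_set volume hWP
  refine ⟨MemLp.sub ?_ ?_, fun j => ⟨_, hwp j⟩, ?_⟩
  · have := (Triangulation.memW1p_of_piecewiseAffine hω.1 hC h.eqOn h.bound).1.1
    exact (this.mono_measure (Measure.restrict_mono_set volume
      (hWP.trans M.perforated_subset))).mono_exponent le_top
  · refine (hv.1.1.1.mono_measure hPW).ae_eq ?_
    filter_upwards [ae_restrict_mem hW.measurableSet] with x hx
    rw [indicator_of_mem (hWP hx)]
  · rw [memLp_piLp_iff]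
    intro j
    have h1 : MemLp (M.pwGrad A j - weakPartial M.perforated j v) 2 (volume.restrict W) := by
      refine MemLp.sub ?_ ((hv.1.memLp_weakPartial j).mono_measure hPW)
      exact MemLp.of_bound (Triangulation.measurable_pwGrad j).aestronglyMeasurable C
        (Eventually.of_forall fun x => Triangulation.norm_pwGrad_le hC h.bound j x)
    exact h1.ae_eq (weakPartial_ae_eq hW (hwp j)).symm

theorem tendstoZeroH1_interpolants (hω : IsLipschitzDomain ω) (hb : ContinuousOn b (Icc α β))
    (M : ℕ → CreaseMesh ω b α β) {κ : ℝ} (hreg : ∀ m, (M m).ShapeRegular κ)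
    (hmesh : Tendsto (fun m => (M m).meshSize) atTop (𝓝 0))
    {v : ℕ → R2 → R3} (hv : ∀ m, v m ∈ relaxedAdmissible (M m))
    {c : ℝ} (hc : ∀ m, relaxedEnergy (M m) (v m) ≤ c)
    {q w : ℕ → R2 → R3} {A : ℕ → Finset R2 → (R2 →ᵃ[ℝ] R3)} {C : ℝ} (hC : 0 ≤ C)
    (h : ∀ m, InterpolantData (M m) (v m) (q m) (w m) (A m) C)
    {W : Set R2} (hW : IsOpen W) (hWc : IsCompact (closure W))
    (hWω : closure W ⊆ ω \ b '' Icc α β) :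
    TendstoZeroH1 W (fun m => q m - (M m).perforated.indicator (v m)) := by
  have hev := eventually_hull_subset_perforated hω.1 hb M hmesh hWc hWω
  have hvol := hWc.volume_ne_top_of_closure
  refine ⟨?_, ?_⟩
  · filter_upwards [hev] with m hm
    exact (h m).memW1p_sub hω hC (hv m) hW (subset_closure.trans hm.1)
  set d : ℕ → ℝ := fun m => ((M m).meshSize).toReal with hd
  have hdlim : Tendsto d atTop (𝓝 0) := by
    have := (ENNReal.tendsto_toReal ENNReal.zero_ne_top).comp hmesh
    rw [ENNReal.toReal_zero] at this
    exact this
  -- The first term turns the uniform error of the values into an L² bound; the other two are the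
  -- gradient errors in the two coordinate directions.
  set B : ℕ → ℝ≥0∞ := fun m =>
    (volume.restrict W) univ ^ (2 : ℝ≥0∞).toReal⁻¹ * ENNReal.ofReal ((C + 2) * d m) +
    ((ENNReal.ofReal (72 * κ ^ 2 * d m ^ 2) * ENNReal.ofReal (2 * c)) ^ (1 / 2 : ℝ) +
    (ENNReal.ofReal (72 * κ ^ 2 * d m ^ 2) * ENNReal.ofReal (2 * c)) ^ (1 / 2 : ℝ)) with hB
  have hBlim : Tendsto B atTop (𝓝 0) := by
    have l1 : Tendsto (fun m => ENNReal.ofReal ((C + 2) * d m)) atTop (𝓝 0) := by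
      have := ENNReal.tendsto_ofReal (hdlim.const_mul (C + 2))
      simpa using this
    have l2 : Tendsto (fun m => ENNReal.ofReal (72 * κ ^ 2 * d m ^ 2)) atTop (𝓝 0) := by
      have := ENNReal.tendsto_ofReal ((hdlim.pow 2).const_mul (72 * κ ^ 2))
      simpa using this
    have l3 := (ENNReal.Tendsto.mul_const l2 (Or.inr (ENNReal.ofReal_ne_top (r := 2 * c))))
    have l4 := l3.ennrpow_const (1 / 2 : ℝ)
    have l5 := ENNReal.Tendsto.const_mul (a := (volume.restrict W) univ ^ (2 : ℝ≥0∞).toReal⁻¹) l1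
      (Or.inr (ENNReal.rpow_ne_top_of_nonneg (by simp)
        (by rw [Measure.restrict_apply_univ]; exact hvol)))
    rw [zero_mul, ENNReal.zero_rpow_of_pos (by norm_num)] at l4
    rw [mul_zero] at l5
    have l6 := l5.add (l4.add l4)
    rw [add_zero, add_zero] at l6
    exact l6
  refine tendsto_of_tendsto_of_tendsto_of_le_of_le' tendsto_const_nhds hBlim
    (Eventually.of_forall fun m => zero_le) ?_
  filter_upwards [hev, hmesh.eventually (gt_mem_nhds ENNReal.zero_lt_top)] with m hm hmtop
  have hWP : W ⊆ (M m).perforated := subset_closure.trans hm.1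
  have hdm : ∀ t ∈ (M m).tri, Metric.diam (convexHull ℝ (t : Set R2)) ≤ d m := fun t ht =>
    ENNReal.toReal_mono hmtop.ne ((M m).ediam_le_meshSize ht)
  have hP := (M m).isOpen_perforated hω.1
  have hmem := (h m).memW1p_sub hω hC (hv m) hW hWP
  refine add_le_add ?_ ((eLpNorm_weakGrad_le hmem.2.2).trans ?_)
  · apply eLpNorm_le_of_ae_bound
    have hae : ∀ᵐ x ∂(volume.restrict W), v m x = w m x :=
      ae_restrict_of_ae_restrict_of_subset hWP (h m).contRep.2
    filter_upwards [hae, ae_restrict_mem hW.measurableSet] with x hx hxW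
    rw [Pi.sub_apply, indicator_of_mem (hWP hxW), hx]
    have hxω : x ∈ closure ω := subset_closure ((M m).perforated_subset (hWP hxW))
    rw [← (M m).cover] at hxω
    obtain ⟨t, ht, hxt⟩ := mem_iUnion₂.1 hxω
    refine ((h m).norm_sub_le hC ht (hm.2 t ht ⟨x, hxt, subset_closure hxW⟩) hxt).trans ?_
    exact mul_le_mul_of_nonneg_left (hdm t ht) (by positivity)
  · have hj : ∀ j, eLpNorm (weakPartial W j (q m - (M m).perforated.indicator (v m))) 2
        (volume.restrict W) ≤
        (ENNReal.ofReal (72 * κ ^ 2 * d m ^ 2) * ENNReal.ofReal (2 * c)) ^ (1 / 2 : ℝ) := by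
      intro j
      rw [eLpNorm_congr_ae (weakPartial_ae_eq hW ((h m).hasWeakPartial_sub hω hC (hv m) hW hWP j)),
        eLpNorm_two_eq]
      refine ENNReal.rpow_le_rpow ?_ (by norm_num)
      exact (h m).lintegral_grad_error_le hω (hreg m) (hv m) (hc m)
        (hWP.trans (M m).perforated_subset)
        (fun t ht hne => hm.2 t ht (hne.mono (inter_subset_inter_right _ subset_closure))) hdm j
    exact add_le_add (hj 0) (hj 1)

end InterpolationConvergence

/-! ### The crease is a null set -/

section NullCrease

/-- Continuously differentiable maps do not raise Hausdorff dimension on an interval, so the arc has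
dimension at most one, and Lebesgue measure is absolutely continuous with respect to two-dimensional
Hausdorff measure. -/
theorem ContDiffOn.volume_image_Icc_eq_zero {b : ℝ → R2} {x y : ℝ}
    (h : ContDiffOn ℝ 1 b (Icc x y)) : volume (b '' Icc x y) = 0 := by
  have hac : (volume : Measure R2) ≪ μH[((2 : ℕ) : ℝ)] :=
    Measure.absolutelyContinuous_isAddHaarMeasure _ _
  refine measure_zero_of_dimH_lt (d := 2) (by exact_mod_cast hac) ?_
  calc dimH (b '' Icc x y) ≤ dimH (Icc x y) := h.dimH_image_le (convex_Icc x y) Subset.rfl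
    _ ≤ dimH (univ : Set ℝ) := dimH_mono (subset_univ _)
    _ = 1 := Real.dimH_univ
    _ < ((2 : ℝ≥0) : ℝ≥0∞) := by norm_num

/-- Apart from finitely many parameters, each one lies in an interval with rational ends that avoids
the break points; countably many such arcs suffice. -/
theorem IsPiecewiseC1Arclength.volume_image_eq_zero {b : ℝ → R2} {α β : ℝ}
    (h : IsPiecewiseC1Arclength b α β) : volume (b '' Icc α β) = 0 := by
  obtain ⟨hαβ, -, S, hS, hC1, -⟩ := h
  set I : Set (ℚ × ℚ) := {p | Icc (p.1 : ℝ) p.2 ⊆ Icc α β ∧ (p.1 : ℝ) < p.2 ∧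
    Disjoint (Ioo (p.1 : ℝ) p.2) S} with hI
  have hsub : b '' Icc α β ⊆ b '' (S ∪ {α, β}) ∪ ⋃ p ∈ I, b '' Icc (p.1 : ℝ) p.2 := by
    rintro _ ⟨t, ht, rfl⟩
    by_cases hts : t ∈ S ∪ {α, β}
    · exact Or.inl ⟨t, hts, rfl⟩
    right
    simp only [mem_union, mem_insert_iff, mem_singleton_iff, not_or] at hts
    have hnhds : Ioo α β ∩ Sᶜ ∈ 𝓝 t := (isOpen_Ioo.inter hS.isClosed.isOpen_compl).mem_nhds
      ⟨⟨lt_of_le_of_ne ht.1 (Ne.symm hts.2.1), lt_of_le_of_ne ht.2 hts.2.2⟩, hts.1⟩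
    obtain ⟨r, hr, hrs⟩ := Metric.mem_nhds_iff.1 hnhds
    obtain ⟨x, hx1, hx2⟩ := exists_rat_btwn (show t - r < t by linarith)
    obtain ⟨y, hy1, hy2⟩ := exists_rat_btwn (show t < t + r by linarith)
    have hxy : Icc (x : ℝ) y ⊆ Ioo α β ∩ Sᶜ := by
      intro s hs
      apply hrs
      rw [Metric.mem_ball, Real.dist_eq, abs_lt]
      constructor <;> linarith [hs.1, hs.2]
    refine mem_iUnion₂.2 ⟨(x, y), ⟨fun s hs => Ioo_subset_Icc_self (hxy hs).1, hx2.trans hy1, ?_⟩,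
      ⟨t, ⟨hx2.le, hy1.le⟩, rfl⟩⟩
    rw [Set.disjoint_left]
    exact fun s hs => (hxy (Ioo_subset_Icc_self hs)).2
  refine measure_mono_null hsub (measure_union_null ?_ ?_)
  · exact ((hS.union (toFinite _)).image b).measure_zero volume
  · refine (measure_biUnion_null_iff I.to_countable).2 fun p hp => ?_
    exact (hC1 _ _ hp.2.1 hp.1 hp.2.2).volume_image_Icc_eq_zero

end NullCrease

/-! ### Weak convergence in `L²` -/

section WeakConvergence

theorem tendsto_eLpNorm_two_zero_of_bounded {X F : Type*} [MeasurableSpace X]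
    {μ : Measure X} [NormedAddCommGroup F] [IsFiniteMeasure μ] {f : ℕ → X → F} {B : ℝ}
    (hf : ∀ n, AEStronglyMeasurable (f n) μ) (hB : ∀ n, ∀ᵐ x ∂μ, ‖f n x‖ ≤ B)
    (hlim : ∀ᵐ x ∂μ, Tendsto (fun n => f n x) atTop (𝓝 0)) :
    Tendsto (fun n => eLpNorm (f n) 2 μ) atTop (𝓝 0) := by
  have h1 : Tendsto (fun n => ∫⁻ x, ‖f n x‖ₑ ^ (2 : ℝ) ∂μ) atTop (𝓝 (∫⁻ x, 0 ∂μ)) := by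
    refine tendsto_lintegral_of_dominated_convergence' (fun _ => ENNReal.ofReal B ^ (2 : ℝ))
      (fun n => (hf n).enorm.pow_const _) (fun n => ?_) ?_ ?_
    · filter_upwards [hB n] with x hx
      refine ENNReal.rpow_le_rpow ?_ (by norm_num)
      rw [← ofReal_norm]
      exact ENNReal.ofReal_le_ofReal hx
    · rw [lintegral_const]
      exact ENNReal.mul_ne_top (ENNReal.rpow_ne_top_of_nonneg (by norm_num) ENNReal.ofReal_ne_top)
        (measure_ne_top μ _)
    · filter_upwards [hlim] with x hx
      have := hx.enorm.ennrpow_const (2 : ℝ)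
      rwa [enorm_zero, ENNReal.zero_rpow_of_pos (by norm_num)] at this
  have h2 := h1.ennrpow_const (1 / 2 : ℝ)
  rw [lintegral_zero, ENNReal.zero_rpow_of_pos (by norm_num)] at h2
  refine h2.congr fun n => ?_
  rw [eLpNorm_eq_lintegral_rpow_enorm_toReal (by simp) (by simp), ENNReal.toReal_ofNat]

variable {X : Type*} [MeasurableSpace X] {μ : Measure X}
  {E : Type*} [NormedAddCommGroup E] [InnerProductSpace ℝ E]

theorem MeasureTheory.MemLp.inner_toLp {f g : X → E} (hf : MemLp f 2 μ) (hg : MemLp g 2 μ) :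
    inner ℝ (hf.toLp f) (hg.toLp g) = ∫ x, inner ℝ (f x) (g x) ∂μ := by
  rw [L2.inner_def]
  apply integral_congr_ae
  filter_upwards [hf.coeFn_toLp, hg.coeFn_toLp] with x h1 h2
  rw [h1, h2]

theorem MeasureTheory.MemLp.norm_integral_inner_le {f g : X → E} (hf : MemLp f 2 μ)
    (hg : MemLp g 2 μ) :
    ‖∫ x, inner ℝ (f x) (g x) ∂μ‖ ≤ (eLpNorm f 2 μ).toReal * (eLpNorm g 2 μ).toReal := by
  rw [← hf.inner_toLp hg, ← Lp.norm_toLp f hf, ← Lp.norm_toLp g hg]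
  exact norm_inner_le_norm _ _

theorem MeasureTheory.MemLp.integrable_inner {f g : X → E} (hf : MemLp f 2 μ)
    (hg : MemLp g 2 μ) : Integrable (fun x => inner ℝ (f x) (g x)) μ := by
  refine (hf.norm.integrable_mul hg.norm).mono'
    (hf.aestronglyMeasurable.inner hg.aestronglyMeasurable)
    (Eventually.of_forall fun x => norm_inner_le_norm _ _)

theorem tendsto_integral_inner_zero {f g : ℕ → X → E} {B : ℝ≥0∞} (hB : B ≠ ∞)
    (hf : ∀ᶠ n in atTop, MemLp (f n) 2 μ) (hf0 : Tendsto (fun n => eLpNorm (f n) 2 μ) atTop (𝓝 0))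
    (hg : ∀ᶠ n in atTop, MemLp (g n) 2 μ) (hgB : ∀ᶠ n in atTop, eLpNorm (g n) 2 μ ≤ B) :
    Tendsto (fun n => ∫ x, inner ℝ (f n x) (g n x) ∂μ) atTop (𝓝 0) := by
  have h1 : Tendsto (fun n => (eLpNorm (f n) 2 μ).toReal * B.toReal) atTop (𝓝 0) := by
    have := ((ENNReal.tendsto_toReal ENNReal.zero_ne_top).comp hf0).mul_const B.toReal
    rw [ENNReal.toReal_zero, zero_mul] at this
    exact this
  refine squeeze_zero_norm' ?_ h1
  filter_upwards [hf, hg, hgB] with n h2 h3 h4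
  exact (h2.norm_integral_inner_le h3).trans
    (mul_le_mul_of_nonneg_left (ENNReal.toReal_mono hB h4) ENNReal.toReal_nonneg)

/-- The product of a bounded, almost everywhere convergent sequence and a weakly convergent one. -/
theorem tendsto_integral_inner_of_bounded_of_weak [IsFiniteMeasure μ] {f g : ℕ → X → E}
    {f' g' : X → E} {B : ℝ} {D : ℝ≥0∞} (hD : D ≠ ∞)
    (hf : ∀ n, AEStronglyMeasurable (f n) μ) (hB : ∀ n, ∀ᵐ x ∂μ, ‖f n x‖ ≤ B)
    (hlim : ∀ᵐ x ∂μ, Tendsto (fun n => f n x) atTop (𝓝 (f' x)))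
    (hg : ∀ n, MemLp (g n) 2 μ) (hgD : ∀ n, eLpNorm (g n) 2 μ ≤ D)
    (hweak : ∀ Φ, MemLp Φ 2 μ → Tendsto (fun n => ∫ x, inner ℝ (g n x) (Φ x) ∂μ) atTop
      (𝓝 (∫ x, inner ℝ (g' x) (Φ x) ∂μ))) :
    Tendsto (fun n => ∫ x, inner ℝ (f n x) (g n x) ∂μ) atTop
      (𝓝 (∫ x, inner ℝ (f' x) (g' x) ∂μ)) := by
  have hf'm : AEStronglyMeasurable f' μ := aestronglyMeasurable_of_tendsto_ae _ hf hlim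
  have hf'B : ∀ᵐ x ∂μ, ‖f' x‖ ≤ B := by
    filter_upwards [hlim, ae_all_iff.2 hB] with x h1 h2
    exact le_of_tendsto h1.norm (Eventually.of_forall h2)
  have hfL : ∀ n, MemLp (f n) 2 μ := fun n => MemLp.of_bound (hf n) B (hB n)
  have hf'L : MemLp f' 2 μ := MemLp.of_bound hf'm B hf'B
  -- Boundedness upgrades pointwise to strong L² convergence. The difference paired with the bounded
  -- `g n` vanishes, and `f'` serves as a test function for the weak convergence.
  have h0 : Tendsto (fun n => eLpNorm (f n - f') 2 μ) atTop (𝓝 0) := by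
    refine tendsto_eLpNorm_two_zero_of_bounded (B := B + B) (fun n => (hf n).sub hf'm)
      (fun n => ?_) ?_
    · filter_upwards [hB n, hf'B] with x h1 h2
      exact (norm_sub_le _ _).trans (add_le_add h1 h2)
    · filter_upwards [hlim] with x hx
      have := hx.sub_const (f' x)
      rwa [sub_self] at this
  have h1 := tendsto_integral_inner_zero hD (Eventually.of_forall fun n => (hfL n).sub hf'L) h0
    (Eventually.of_forall hg) (Eventually.of_forall hgD)
  have h2 := h1.add (hweak f' hf'L)
  rw [zero_add] at h2
  simp only [real_inner_comm] at h2 ⊢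
  refine h2.congr fun n => ?_
  rw [← integral_add]
  · congr 1; ext1 x
    rw [Pi.sub_apply, inner_sub_right, sub_add_cancel, real_inner_comm]
  · exact (hg n).integrable_inner ((hfL n).sub hf'L)
  · exact (hg n).integrable_inner hf'L

/-- Bounded sequences in `L²` have weakly convergent subsequences. -/
theorem exists_weak_limit [CompleteSpace E] [SecondCountableTopology E] [MeasureTheory.IsSeparable μ]
    {Y : ℕ → X → E} {B : ℝ≥0∞}
    (hB : B ≠ ∞) (hY : ∀ n, MemLp (Y n) 2 μ) (hYB : ∀ n, eLpNorm (Y n) 2 μ ≤ B) :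
    ∃ (Z : X → E) (s : ℕ → ℕ), MemLp Z 2 μ ∧ StrictMono s ∧
      ∀ Φ, MemLp Φ 2 μ → Tendsto (fun n => ∫ x, inner ℝ (Y (s n) x) (Φ x) ∂μ) atTop
        (𝓝 (∫ x, inner ℝ (Z x) (Φ x) ∂μ)) := by
  have : Fact ((2 : ℝ≥0∞) ≠ ∞) := ⟨by simp⟩
  -- By the Riesz isomorphism the sequence lies in a dual ball, which is weak-star sequentially
  -- compact because L² is separable here.
  set F : ℕ → WeakDual ℝ (Lp E 2 μ) := fun n =>
    StrongDual.toWeakDual (InnerProductSpace.toDual ℝ (Lp E 2 μ) ((hY n).toLp (Y n))) with hF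
  have hmem : ∀ n, F n ∈ WeakDual.toStrongDual ⁻¹'
      Metric.closedBall (0 : StrongDual ℝ (Lp E 2 μ)) B.toReal := by
    intro n
    refine (mem_closedBall_zero_iff (E := StrongDual ℝ (Lp E 2 μ))).2 ?_
    change ‖InnerProductSpace.toDual ℝ (Lp E 2 μ) ((hY n).toLp (Y n))‖ ≤ _
    rw [LinearIsometryEquiv.norm_map, Lp.norm_toLp]
    exact ENNReal.toReal_mono hB (hYB n)
  obtain ⟨G, -, s, hs, hlim⟩ := WeakDual.isSeqCompact_closedBall ℝ (Lp E 2 μ) 0 B.toReal hmem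
  set Z : Lp E 2 μ := (InnerProductSpace.toDual ℝ (Lp E 2 μ)).symm (WeakDual.toStrongDual G) with hZ
  refine ⟨Z, s, Lp.memLp Z, hs, fun Φ hΦ => ?_⟩
  have h1 := ((WeakDual.eval_continuous (hΦ.toLp Φ)).tendsto G).comp hlim
  have h2 : G (hΦ.toLp Φ) = ∫ x, inner ℝ (Z x) (Φ x) ∂μ := by
    have : G (hΦ.toLp Φ) = inner ℝ Z (hΦ.toLp Φ) := by
      rw [hZ, InnerProductSpace.toDual_symm_apply]; rfl
    rw [this, L2.inner_def]
    apply integral_congr_ae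
    filter_upwards [hΦ.coeFn_toLp] with x hx
    rw [hx]
  rw [h2] at h1
  refine h1.congr fun n => ?_
  exact (hY (s n)).inner_toLp hΦ

end WeakConvergence

/-! ### Limits of equi-Lipschitz sequences and of isometries -/

section Limits

theorem cauchySeq_of_forall_approx {a : ℕ → ℝ}
    (h : ∀ ε > 0, ∃ (c : ℕ → ℝ) (l : ℝ), Tendsto c atTop (𝓝 l) ∧ ∀ n, |a n - c n| ≤ ε) :
    CauchySeq a := by
  rw [Metric.cauchySeq_iff]
  intro ε hε
  obtain ⟨c, l, hc, hac⟩ := h (ε / 4) (by positivity)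
  obtain ⟨N, hN⟩ := Metric.cauchySeq_iff.1 hc.cauchySeq (ε / 4) (by positivity)
  refine ⟨N, fun m hm n hn => ?_⟩
  have h1 := hN m hm n hn
  have h2 := abs_le.1 (hac m)
  have h3 := abs_le.1 (hac n)
  rw [Real.dist_eq, abs_lt] at h1 ⊢
  constructor <;> linarith [h1.1, h1.2, h2.1, h2.2, h3.1, h3.2]

variable {W : Set R2} {w : ℕ → R2 → R3} {u : R2 → R3} {L : ℝ}

theorem continuousOn_of_norm_sub_le {f : R2 → R3} (hL : 0 ≤ L)
    (hf : ∀ x ∈ W, ∀ y ∈ W, ‖f x - f y‖ ≤ L * ‖x - y‖) : ContinuousOn f W := by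
  refine LipschitzOnWith.continuousOn (K := ⟨L, hL⟩) (LipschitzOnWith.of_dist_le_mul ?_)
  intro x hx y hy
  rw [dist_eq_norm, dist_eq_norm]
  exact hf x hx y hy

/-- Averages over a small ball around `x` converge, by testing with its indicator. The
equi-Lipschitz bound makes them close to the point values uniformly in `n`, so the point values form
a Cauchy sequence. -/
theorem exists_tendsto_inner_of_weak (hW : IsOpen W) (hL : 0 ≤ L)
    (hlip : ∀ n, ∀ x ∈ W, ∀ y ∈ W, ‖w n x - w n y‖ ≤ L * ‖x - y‖)
    (hweak : ∀ Φ, MemLp Φ 2 (volume.restrict W) →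
      Tendsto (fun n => ∫ x in W, inner ℝ (w n x) (Φ x)) atTop
        (𝓝 (∫ x in W, inner ℝ (u x) (Φ x)))) {x : R2} (hx : x ∈ W) (e : R3) :
    ∃ l, Tendsto (fun n => inner ℝ (w n x) e) atTop (𝓝 l) := by
  refine cauchySeq_tendsto_of_complete (cauchySeq_of_forall_approx fun ε hε => ?_)
  obtain ⟨r, hr, hrW⟩ := Metric.isOpen_iff.1 hW x hx
  set δ := min r (ε / (L * ‖e‖ + 1)) with hδ
  have hpos : 0 < L * ‖e‖ + 1 := by positivity
  have hδ0 : 0 < δ := lt_min hr (by positivity)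
  have hδε : L * δ * ‖e‖ ≤ ε := by
    have : δ * (L * ‖e‖ + 1) ≤ ε := (le_div_iff₀ hpos).1 (min_le_right _ _)
    nlinarith
  set S := Metric.ball x δ with hS
  have hSW : S ⊆ W := (Metric.ball_subset_ball (min_le_left _ _)).trans hrW
  have hSm : MeasurableSet S := measurableSet_ball
  have hStop : volume S ≠ ∞ := measure_ball_lt_top.ne
  have hS0 : 0 < volume.real S :=
    ENNReal.toReal_pos (Metric.measure_ball_pos volume x hδ0).ne' hStop
  have hΦ : MemLp (S.indicator fun _ => e) 2 (volume.restrict W) := by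
    refine memLp_indicator_const 2 hSm e (Or.inr ?_)
    exact ne_top_of_le_ne_top hStop (Measure.restrict_apply_le _ _)
  have heq : ∀ f : R2 → R3, ∫ y in W, inner ℝ (f y) (S.indicator (fun _ => e) y) =
      ∫ y in S, inner ℝ (f y) e := by
    intro f
    have : (fun y => inner ℝ (f y) (S.indicator (fun _ => e) y)) =
        S.indicator fun y => inner ℝ (f y) e := by
      ext1 y
      by_cases hy : y ∈ S <;> simp [hy]
    rw [this, setIntegral_indicator hSm, inter_eq_self_of_subset_right hSW]
  have h1 := (hweak _ hΦ).const_mul (volume.real S)⁻¹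
  simp only [heq] at h1
  refine ⟨_, _, h1, fun n => ?_⟩
  have hcont : ContinuousOn (w n) W := continuousOn_of_norm_sub_le hL (hlip n)
  have hbd : ∀ y ∈ S, ‖inner ℝ (w n x) e - inner ℝ (w n y) e‖ ≤ ε := by
    intro y hy
    rw [← inner_sub_left]
    refine (norm_inner_le_norm _ _).trans (le_trans ?_ hδε)
    refine mul_le_mul_of_nonneg_right ((hlip n x hx y (hSW hy)).trans ?_) (norm_nonneg _)
    rw [← dist_eq_norm, dist_comm]
    exact mul_le_mul_of_nonneg_left (Metric.mem_ball.1 hy).le hL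
  have hInt : IntegrableOn (fun y => inner ℝ (w n y) e) S := by
    have : IsFiniteMeasure (volume.restrict S) := isFiniteMeasure_restrict.2 hStop
    refine Integrable.of_bound ?_ (‖inner ℝ (w n x) e‖ + ε) ?_
    · exact (ContinuousOn.inner (𝕜 := ℝ) (hcont.mono hSW) continuousOn_const).aestronglyMeasurable hSm
    · filter_upwards [ae_restrict_mem hSm] with y hy
      have h3 := hbd y hy
      rw [norm_sub_rev] at h3
      have h4 := norm_sub_norm_le (inner ℝ (w n y) e) (inner ℝ (w n x) e)
      linarith
  have h2 : inner ℝ (w n x) e - (volume.real S)⁻¹ * ∫ y in S, inner ℝ (w n y) e =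
      (volume.real S)⁻¹ * ∫ y in S, (inner ℝ (w n x) e - inner ℝ (w n y) e) := by
    have hconst : IntegrableOn (fun _ : R2 => inner ℝ (w n x) e) S :=
      integrableOn_const hStop (by simp)
    rw [integral_sub hconst hInt, setIntegral_const, smul_eq_mul, mul_sub,
      inv_mul_cancel_left₀ hS0.ne']
  rw [h2, abs_mul, abs_of_pos (inv_pos.2 hS0), inv_mul_le_iff₀ hS0, mul_comm]
  exact norm_setIntegral_le_of_norm_le_const hStop.lt_top hbd

/-- Weak convergence of an equi-Lipschitz sequence implies bounded pointwise convergence. -/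
theorem exists_pointwise_limit_of_weak (hW : IsOpen W) (hWb : Bornology.IsBounded W) (hL : 0 ≤ L)
    (hlip : ∀ n, ∀ x ∈ W, ∀ y ∈ W, ‖w n x - w n y‖ ≤ L * ‖x - y‖)
    (hu : MemLp u 2 (volume.restrict W))
    (hweak : ∀ Φ, MemLp Φ 2 (volume.restrict W) →
      Tendsto (fun n => ∫ x in W, inner ℝ (w n x) (Φ x)) atTop
        (𝓝 (∫ x in W, inner ℝ (u x) (Φ x)))) :
    (∀ᵐ x ∂(volume.restrict W), Tendsto (fun n => w n x) atTop (𝓝 (u x))) ∧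
      ∃ B, 0 ≤ B ∧ ∀ n, ∀ x ∈ W, ‖w n x‖ ≤ B := by
  have hfin : IsFiniteMeasure (volume.restrict W) :=
    isFiniteMeasure_restrict.2 hWb.measure_lt_top.ne
  have hex : ∀ x ∈ W, ∃ l : R3, Tendsto (fun n => w n x) atTop (𝓝 l) := by
    intro x hx
    choose l hl using fun i : Fin 3 =>
      exists_tendsto_inner_of_weak hW hL hlip hweak hx (EuclideanSpace.single i 1)
    refine ⟨WithLp.toLp 2 l, ?_⟩
    have h1 : Tendsto (fun n => (fun i => w n x i)) atTop (𝓝 l) := by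
      rw [tendsto_pi_nhds]
      intro i
      refine (hl i).congr fun n => ?_
      simp [EuclideanSpace.inner_single_right]
    exact ((PiLp.continuous_toLp 2 fun _ : Fin 3 => ℝ).tendsto l).comp h1
  choose! u' hu' using hex
  obtain ⟨B, hB0, hB⟩ : ∃ B, 0 ≤ B ∧ ∀ n, ∀ x ∈ W, ‖w n x‖ ≤ B := by
    rcases W.eq_empty_or_nonempty with rfl | ⟨x₀, hx₀⟩
    · exact ⟨0, le_rfl, by simp⟩
    obtain ⟨B, hB⟩ := (Metric.isBounded_range_of_tendsto _ (hu' x₀ hx₀)).exists_norm_le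
    have hB0 : 0 ≤ B := (norm_nonneg _).trans (hB _ ⟨0, rfl⟩)
    have hdn : 0 ≤ Metric.diam W := Metric.diam_nonneg
    refine ⟨B + L * Metric.diam W, by positivity, fun n x hx => ?_⟩
    have h1 := hB _ ⟨n, rfl⟩
    have h2 := hlip n x hx x₀ hx₀
    have h3 : ‖x - x₀‖ ≤ Metric.diam W := by
      rw [← dist_eq_norm]; exact Metric.dist_le_diam_of_mem hWb hx hx₀
    have h4 := norm_sub_norm_le (w n x) (w n x₀)
    have h5 := mul_le_mul_of_nonneg_left h3 hL
    linarith
  have hwm : ∀ n, AEStronglyMeasurable (w n) (volume.restrict W) := fun n =>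
    (continuousOn_of_norm_sub_le hL (hlip n)).aestronglyMeasurable hW.measurableSet
  have hBae : ∀ n, ∀ᵐ x ∂(volume.restrict W), ‖w n x‖ ≤ B := fun n => by
    filter_upwards [ae_restrict_mem hW.measurableSet] with x hx using hB n x hx
  have hlim : ∀ᵐ x ∂(volume.restrict W), Tendsto (fun n => w n x) atTop (𝓝 (u' x)) := by
    filter_upwards [ae_restrict_mem hW.measurableSet] with x hx using hu' x hx
  have hu'm : AEStronglyMeasurable u' (volume.restrict W) :=
    aestronglyMeasurable_of_tendsto_ae _ hwm hlim
  have hu'L : MemLp u' 2 (volume.restrict W) := by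
    refine MemLp.of_bound hu'm B ?_
    filter_upwards [ae_restrict_mem hW.measurableSet] with x hx
    exact le_of_tendsto (hu' x hx).norm (Eventually.of_forall fun n => hB n x hx)
  have hd := hu.sub hu'L
  -- The pointwise limit `u'` is also a weak limit. Testing both weak limits with `u - u'` shows
  -- that it has norm zero.
  have h1 := tendsto_integral_inner_of_bounded_of_weak (g := fun _ => u - u') (g' := u - u')
    hd.2.ne hwm hBae hlim (fun _ => hd) (fun _ => le_rfl) (fun _ _ => tendsto_const_nhds)
  have h2 := tendsto_nhds_unique h1 (hweak _ hd)
  have h3 : ∫ x in W, ‖(u - u') x‖ ^ 2 = 0 := by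
    have : ∀ x, ‖(u - u') x‖ ^ 2 = inner ℝ (u x) ((u - u') x) - inner ℝ (u' x) ((u - u') x) := by
      intro x
      rw [← real_inner_self_eq_norm_sq, ← inner_sub_left]
      rfl
    simp only [this]
    rw [integral_sub (hu.integrable_inner hd) (hu'L.integrable_inner hd), h2, sub_self]
  rw [integral_eq_zero_iff_of_nonneg (fun x => by positivity)
    (hd.integrable_norm_pow (by norm_num))] at h3
  refine ⟨?_, B, hB0, hB⟩
  filter_upwards [h3, hlim] with x hx hlx
  have : u x = u' x := by
    have : ‖(u - u') x‖ ^ 2 = 0 := hx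
    simpa [sub_eq_zero] using this
  rwa [this]

end Limits

/-! ### Stability of second derivatives and of the isometry constraint under weak limits -/

section IsometryLimits

variable {W : Set R2}

theorem integral_mul_inner_of_tsupport_subset {ψ : R2 → ℝ} (hs : tsupport ψ ⊆ W) (f g : R2 → R3) :
    ∫ x, ψ x * inner ℝ (f x) (g x) = ∫ x in W, inner ℝ (ψ x • f x) (g x) := by
  have := setIntegral_smul_of_tsupport_subset hs fun x => inner ℝ (f x) (g x)
  simp only [smul_eq_mul] at this
  rw [← this]
  simp only [real_inner_smul_left]

theorem HasWeakPartial.aestronglyMeasurable {i : Fin 2} {f g : R2 → R3}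
    (h : HasWeakPartial W i f g) :
    AEStronglyMeasurable g (volume.restrict W) :=
  h.2.1.aestronglyMeasurable

/-- Integration by parts passes to weak limits. -/
theorem integral_smul_eq_of_weak_limit (hW : volume W ≠ ∞) {i : Fin 2} {g H : ℕ → R2 → R3}
    {p X : R2 → R3}
    (hgH : ∀ n, HasWeakPartial W i (g n) (H n))
    (hg : ∀ Φ, MemLp Φ 2 (volume.restrict W) →
      Tendsto (fun n => ∫ x in W, inner ℝ (g n x) (Φ x)) atTop
        (𝓝 (∫ x in W, inner ℝ (p x) (Φ x))))
    (hH : ∀ Φ, MemLp Φ 2 (volume.restrict W) →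
      Tendsto (fun n => ∫ x in W, inner ℝ (H n x) (Φ x)) atTop
        (𝓝 (∫ x in W, inner ℝ (X x) (Φ x))))
    (hp : LocallyIntegrableOn p W) (hX : LocallyIntegrableOn X W)
    {φ : R2 → ℝ} (h1 : ContDiff ℝ (⊤ : ℕ∞) φ) (h2 : HasCompactSupport φ) (h3 : tsupport φ ⊆ W) :
    ∫ x, (fderiv ℝ φ x (e2 i)) • p x = - ∫ x, φ x • X x := by
  have hfin : IsFiniteMeasure (volume.restrict W) := isFiniteMeasure_restrict.2 hW
  have hdφ : Continuous fun x => fderiv ℝ φ x (e2 i) :=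
    (h1.continuous_fderiv (by simp)).clm_apply continuous_const
  have hdc : HasCompactSupport fun x => fderiv ℝ φ x (e2 i) := h2.fderiv_apply ℝ _
  have hds := (tsupport_fderiv_apply_subset' (φ := φ) (e2 i)).trans h3
  have key : ∀ (ψ : R2 → ℝ) (_ : Continuous ψ) (_ : HasCompactSupport ψ) (_ : tsupport ψ ⊆ W)
      (f : R2 → R3) (_ : LocallyIntegrableOn f W) (e : R3),
      inner ℝ (∫ x, ψ x • f x) e = ∫ x in W, inner ℝ (f x) (ψ x • e) := by
    intro ψ hψ hψc hψs f hf e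
    rw [real_inner_comm, ← integral_inner (integrable_smul_of_tsupport_subset hψ hψc hψs hf),
      ← integral_congr_ae (Eventually.of_forall fun x => real_inner_comm _ _)]
    have := integral_mul_inner_of_tsupport_subset hψs f fun _ => e
    simp only [real_inner_smul_left, real_inner_smul_right] at this ⊢
    rw [← this]
  have hmem : ∀ (ψ : R2 → ℝ) (_ : Continuous ψ) (_ : HasCompactSupport ψ) (e : R3),
      MemLp (fun x => ψ x • e) 2 (volume.restrict W) := by
    intro ψ hψ hψc e
    obtain ⟨B, hB⟩ := hψc.exists_bound_of_continuous hψ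
    refine MemLp.of_bound (by fun_prop) (B * ‖e‖) (Eventually.of_forall fun x => ?_)
    rw [norm_smul]
    exact mul_le_mul_of_nonneg_right (hB x) (norm_nonneg _)
  -- Pairing with a fixed vector `e` turns both sides into tests against `ψ x • e`, to which weak
  -- convergence applies.
  refine ext_inner_right ℝ fun e => ?_
  rw [inner_neg_left, key _ hdφ hdc hds p hp, key φ h1.continuous h2 h3 X hX]
  refine tendsto_nhds_unique (hg _ (hmem _ hdφ hdc e)) ?_
  refine ((hH _ (hmem φ h1.continuous h2 e)).neg).congr fun n => ?_
  rw [← key _ hdφ hdc hds _ (hgH n).1, ← key φ h1.continuous h2 h3 _ (hgH n).2.1,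
    (hasWeakPartial_iff.1 (hgH n)).2.2 φ h1 h2 h3, inner_neg_left]

/-- Weak limits of isometries with bounded second derivatives are isometries. -/
theorem inner_eq_of_weak_limit (hW : IsOpen W) (hWb : Bornology.IsBounded W)
    {w : ℕ → R2 → R3} {u : R2 → R3} {L : ℝ} (hL : 0 ≤ L)
    (hlip : ∀ n, ∀ x ∈ W, ∀ y ∈ W, ‖w n x - w n y‖ ≤ L * ‖x - y‖)
    {g : ℕ → Fin 2 → R2 → R3} {H : ℕ → Fin 2 → Fin 2 → R2 → R3}
    (hwg : ∀ n i, HasWeakPartial W i (w n) (g n i))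
    (hgH : ∀ n i j, HasWeakPartial W i (g n j) (H n i j))
    (hiso : ∀ n, ∀ᵐ x ∂(volume.restrict W), ∀ i j,
      inner ℝ (g n i x) (g n j x) = if i = j then (1 : ℝ) else 0)
    {D : ℝ≥0∞} (hD : D ≠ ∞) (hHm : ∀ n i j, MemLp (H n i j) 2 (volume.restrict W))
    (hHD : ∀ n i j, eLpNorm (H n i j) 2 (volume.restrict W) ≤ D)
    {p : Fin 2 → R2 → R3} {X : Fin 2 → Fin 2 → R2 → R3}
    (hu : MemLp u 2 (volume.restrict W))
    (hup : ∀ i, HasWeakPartial W i u (p i)) (hpX : ∀ i j, HasWeakPartial W i (p j) (X i j))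
    {C : ℝ} (hC : 0 ≤ C) (hpC : ∀ i, ∀ᵐ x ∂(volume.restrict W), ‖p i x‖ ≤ C)
    (hwweak : ∀ Φ, MemLp Φ 2 (volume.restrict W) →
      Tendsto (fun n => ∫ x in W, inner ℝ (w n x) (Φ x)) atTop
        (𝓝 (∫ x in W, inner ℝ (u x) (Φ x))))
    (hgweak : ∀ j Φ, MemLp Φ 2 (volume.restrict W) →
      Tendsto (fun n => ∫ x in W, inner ℝ (g n j x) (Φ x)) atTop
        (𝓝 (∫ x in W, inner ℝ (p j x) (Φ x))))
    (hHweak : ∀ i j Φ, MemLp Φ 2 (volume.restrict W) →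
      Tendsto (fun n => ∫ x in W, inner ℝ (H n i j x) (Φ x)) atTop
        (𝓝 (∫ x in W, inner ℝ (X i j x) (Φ x)))) :
    ∀ᵐ x ∂(volume.restrict W), ∀ i j,
      inner ℝ (p i x) (p j x) = if i = j then (1 : ℝ) else 0 := by
  have hfin : IsFiniteMeasure (volume.restrict W) :=
    isFiniteMeasure_restrict.2 hWb.measure_lt_top.ne
  obtain ⟨hlim, B, hB0, hB⟩ := exists_pointwise_limit_of_weak hW hWb hL hlip hu hwweak
  have hmemW : ∀ᵐ x ∂(volume.restrict W), x ∈ W := ae_restrict_mem hW.measurableSet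
  have hwm : ∀ n, AEStronglyMeasurable (w n) (volume.restrict W) := fun n =>
    (continuousOn_of_norm_sub_le hL (hlip n)).aestronglyMeasurable hW.measurableSet
  have hBae : ∀ n, ∀ᵐ x ∂(volume.restrict W), ‖w n x‖ ≤ B := fun n => hmemW.mono (hB n)
  have huB : ∀ᵐ x ∂(volume.restrict W), ‖u x‖ ≤ B := by
    filter_upwards [hlim, hmemW] with x hx hxW
    exact le_of_tendsto hx.norm (Eventually.of_forall fun n => hB n x hxW)
  have hg1 : ∀ n i, ∀ᵐ x ∂(volume.restrict W), ‖g n i x‖ ≤ 1 := by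
    intro n i
    filter_upwards [hiso n] with x hx
    have := hx i i
    rw [if_pos rfl, real_inner_self_eq_norm_sq] at this
    nlinarith [norm_nonneg (g n i x)]
  have hgL : ∀ n i, MemLp (g n i) 2 (volume.restrict W) := fun n i =>
    MemLp.of_bound (hwg n i).aestronglyMeasurable 1 (hg1 n i)
  have hgD : ∀ n i, eLpNorm (g n i) 2 (volume.restrict W) ≤
      (volume.restrict W) univ ^ (2 : ℝ≥0∞).toReal⁻¹ * ENNReal.ofReal 1 := fun n i =>
    eLpNorm_le_of_ae_bound (hg1 n i)
  have hD' : (volume.restrict W) univ ^ (2 : ℝ≥0∞).toReal⁻¹ * ENNReal.ofReal 1 ≠ ∞ :=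
    ENNReal.mul_ne_top (ENNReal.rpow_ne_top_of_nonneg (by simp) (measure_ne_top _ _))
      ENNReal.ofReal_ne_top
  -- products of a test function with the two convergent sequences
  have prod : ∀ (ψ : R2 → ℝ) (_ : Continuous ψ) (_ : HasCompactSupport ψ) (_ : tsupport ψ ⊆ W)
      (f : ℕ → R2 → R3) (f' : R2 → R3) (D : ℝ≥0∞) (_ : D ≠ ∞)
      (_ : ∀ n, MemLp (f n) 2 (volume.restrict W))
      (_ : ∀ n, eLpNorm (f n) 2 (volume.restrict W) ≤ D)
      (_ : ∀ Φ, MemLp Φ 2 (volume.restrict W) →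
        Tendsto (fun n => ∫ x in W, inner ℝ (f n x) (Φ x)) atTop
          (𝓝 (∫ x in W, inner ℝ (f' x) (Φ x)))),
      Tendsto (fun n => ∫ x, ψ x * inner ℝ (w n x) (f n x)) atTop
        (𝓝 (∫ x, ψ x * inner ℝ (u x) (f' x))) := by
    intro ψ hψ hψc hψs f f' D hD hf hfD hweak
    obtain ⟨E, hE⟩ := hψc.exists_bound_of_continuous hψ
    simp only [integral_mul_inner_of_tsupport_subset hψs]
    refine tendsto_integral_inner_of_bounded_of_weak (B := E * B) hD
      (fun n => hψ.aestronglyMeasurable.smul (hwm n)) (fun n => ?_) ?_ hf hfD hweak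
    · filter_upwards [hBae n] with x hx
      rw [norm_smul]
      exact mul_le_mul (hE x) hx (norm_nonneg _) ((norm_nonneg _).trans (hE x))
    · filter_upwards [hlim] with x hx using hx.const_smul _
  have huI : IntegrableOn u W := hu.integrable (by norm_num)
  have hpI : ∀ i, IntegrableOn (p i) W := fun i =>
    Integrable.of_bound (hup i).aestronglyMeasurable C (hpC i)
  have hwI : ∀ n, IntegrableOn (w n) W := fun n => Integrable.of_bound (hwm n) B (hBae n)
  have hgI : ∀ n i, IntegrableOn (g n i) W := fun n i => (hgL n i).integrable (by norm_num)
  rw [ae_all_iff]; intro i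
  rw [ae_all_iff]; intro j
  set d : ℝ := if i = j then (1 : ℝ) else 0 with hd
  have hinn : IntegrableOn (fun x => inner ℝ (p i x) (p j x)) W := by
    refine Integrable.of_bound
      ((hup i).aestronglyMeasurable.inner (hup j).aestronglyMeasurable) (C * C) ?_
    filter_upwards [hpC i, hpC j] with x h1 h2
    exact (norm_inner_le_norm _ _).trans (mul_le_mul h1 h2 (norm_nonneg _) hC)
  have hconst : IntegrableOn (fun _ : R2 => d) W := integrable_const d
  have hae : ∀ᵐ x ∂(volume : Measure R2), x ∈ W → inner ℝ (p i x) (p j x) - d = 0 := by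
    refine hW.ae_eq_zero_of_integral_contDiff_smul_eq_zero
      (hinn.sub hconst).locallyIntegrableOn fun φ h1 h2 h3 => ?_
    have hdφ : Continuous fun x => fderiv ℝ φ x (e2 i) :=
      (h1.continuous_fderiv (by simp)).clm_apply continuous_const
    have hdc : HasCompactSupport fun x => fderiv ℝ φ x (e2 i) := h2.fderiv_apply ℝ _
    have hds := (tsupport_fderiv_apply_subset' (φ := φ) (e2 i)).trans h3
    have l1 := prod _ hdφ hdc hds (fun n => g n j) (p j) _ hD' (fun n => hgL n j)
      (fun n => hgD n j) (hgweak j)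
    have l2 := prod φ h1.continuous h2 h3 (fun n => H n i j) (X i j) D hD (fun n => hHm n i j)
      (fun n => hHD n i j) (hHweak i j)
    -- After the product rule every term pairs the boundedly convergent `w n` with a weakly
    -- convergent first or second derivative; no product of two merely weakly convergent factors is
    -- left.
    have l3 := l1.neg.sub l2
    rw [← (hup i).integral_product_rule hW hB0 hC huI (hpX i j) huB (hpC i) (hpI i) h1 h2 h3] at l3
    -- Along the sequence the tested product does not depend on `n`, since each member is isometric.
    have l4 : Tendsto (fun _ : ℕ => ∫ x, φ x * d) atTop
        (𝓝 (∫ x, φ x * inner ℝ (p i x) (p j x))) := by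
      refine l3.congr fun n => ?_
      rw [← (hwg n i).integral_product_rule hW hB0 zero_le_one (hwI n) (hgH n i j) (hBae n)
        (hg1 n i) (hgI n i) h1 h2 h3]
      apply integral_congr_ae
      filter_upwards [(ae_restrict_iff' hW.measurableSet).1 (hiso n)] with x hx
      by_cases hxW : x ∈ W
      · rw [hx hxW i j]
      · rw [image_eq_zero_of_notMem_tsupport fun h => hxW (h3 h), zero_mul, zero_mul]
    have l5 := tendsto_nhds_unique l4 tendsto_const_nhds
    have i1 := integrable_smul_of_tsupport_subset h1.continuous h2 h3 hinn.locallyIntegrableOn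
    have i2 := integrable_smul_of_tsupport_subset h1.continuous h2 h3 hconst.locallyIntegrableOn
    simp only [smul_eq_mul, mul_sub] at i1 i2 ⊢
    rw [integral_sub i1 i2, l5, sub_self]
  rw [ae_restrict_iff' hW.measurableSet]
  filter_upwards [hae] with x hx hxW
  exact sub_eq_zero.1 (hx hxW)

end IsometryLimits

/-! ### Weak limits of deformations and their derivatives -/

section WeakLimits

variable {ω W : Set R2}

theorem inner_toLp_single {ι : Type*} [Fintype ι] [DecidableEq ι] (a : PiLp 2 fun _ : ι => R3)
    (j : ι) (y : R3) : inner ℝ a (WithLp.toLp 2 (Pi.single j y)) = inner ℝ (a j) y := by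
  rw [PiLp.inner_apply, Finset.sum_eq_single j]
  · simp
  · intro i _ hi
    simp [hi]
  · simp

theorem norm_toLp_single {ι : Type*} [Fintype ι] [DecidableEq ι] (j : ι) (y : R3) :
    ‖(WithLp.toLp 2 (Pi.single j y) : PiLp 2 fun _ : ι => R3)‖ = ‖y‖ :=
  PiLp.norm_single 2 (fun _ : ι => R3) j y

theorem aestronglyMeasurable_toLp_single {ι : Type*} [Fintype ι] [DecidableEq ι] (j : ι)
    {f : R2 → R3} {μ : Measure R2} (hf : AEStronglyMeasurable f μ) :
    AEStronglyMeasurable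
      (fun x => (WithLp.toLp 2 (Pi.single j (f x)) : PiLp 2 fun _ : ι => R3)) μ :=
  ((PiLp.continuous_toLp 2 fun _ : ι => R3).comp
    (continuous_single j)).comp_aestronglyMeasurable hf

theorem setIntegral_inner_indicator (hW : MeasurableSet W) (hWω : W ⊆ ω) (f Φ : R2 → R3) :
    ∫ x in ω, inner ℝ (f x) (W.indicator Φ x) = ∫ x in W, inner ℝ (f x) (Φ x) := by
  have : (fun x => inner ℝ (f x) (W.indicator Φ x)) = W.indicator fun x => inner ℝ (f x) (Φ x) := by
    ext1 x
    by_cases hx : x ∈ W <;> simp [hx]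
  rw [this, setIntegral_indicator hW, inter_eq_self_of_subset_right hWω]

theorem MeasureTheory.MemLp.indicator_restrict {p : ℝ≥0∞} (hW : MeasurableSet W) (hWω : W ⊆ ω)
    {E : Type*} [NormedAddCommGroup E] {Φ : R2 → E} (hΦ : MemLp Φ p (volume.restrict W)) :
    MemLp (W.indicator Φ) p (volume.restrict ω) := by
  rw [memLp_indicator_iff_restrict hW, Measure.restrict_restrict hW,
    inter_eq_self_of_subset_left hWω]
  exact hΦ

/-- Weak-star convergence on `ω` and a vanishing `L²` error on `W` give weak convergence on `W`. -/
theorem tendsto_setIntegral_inner_of_weakStar (hω : volume ω ≠ ∞) (hW : MeasurableSet W)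
    (hWω : W ⊆ ω) {f r h : ℕ → R2 → R3} {f' : R2 → R3}
    (hf : ∀ g, Integrable g (volume.restrict ω) →
      Tendsto (fun n => ∫ x in ω, inner ℝ (f n x) (g x)) atTop
        (𝓝 (∫ x in ω, inner ℝ (f' x) (g x))))
    (hfm : ∀ n, MemLp (f n) 2 (volume.restrict ω))
    (hrm : ∀ᶠ n in atTop, MemLp (r n) 2 (volume.restrict W))
    (hr0 : Tendsto (fun n => eLpNorm (r n) 2 (volume.restrict W)) atTop (𝓝 0))
    (hh : ∀ᶠ n in atTop, h n =ᵐ[volume.restrict W] f n - r n)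
    {Φ : R2 → R3} (hΦ : MemLp Φ 2 (volume.restrict W)) :
    Tendsto (fun n => ∫ x in W, inner ℝ (h n x) (Φ x)) atTop
      (𝓝 (∫ x in W, inner ℝ (f' x) (Φ x))) := by
  have hfin : IsFiniteMeasure (volume.restrict ω) := isFiniteMeasure_restrict.2 hω
  have h1 := hf _ ((hΦ.indicator_restrict hW hWω).integrable (by norm_num))
  simp only [setIntegral_inner_indicator hW hWω] at h1
  have h2 := tendsto_integral_inner_zero (g := fun _ => Φ) hΦ.2.ne hrm hr0
    (Eventually.of_forall fun _ => hΦ) (Eventually.of_forall fun _ => le_rfl)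
  have h3 := h1.sub h2
  rw [sub_zero] at h3
  refine h3.congr' ?_
  filter_upwards [hrm, hh] with n hn hhn
  have hfn : MemLp (f n) 2 (volume.restrict W) :=
    (hfm n).mono_measure (Measure.restrict_mono_set volume hWω)
  rw [← integral_sub (hfn.integrable_inner hΦ) (hn.integrable_inner hΦ)]
  apply integral_congr_ae
  filter_upwards [hhn] with x hx
  rw [hx, Pi.sub_apply, inner_sub_left]

theorem tendsto_integral_inner_weakPartial {q : ℕ → R2 → R3} {u : R2 → R3}
    (h : ∀ G : R2 → GradVal, Integrable G (volume.restrict ω) →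
      Tendsto (fun n => ∫ x in ω, inner ℝ (weakGrad ω (q n) x) (G x)) atTop
        (𝓝 (∫ x in ω, inner ℝ (weakGrad ω u x) (G x)))) (j : Fin 2) {g : R2 → R3}
    (hg : Integrable g (volume.restrict ω)) :
    Tendsto (fun n => ∫ x in ω, inner ℝ (weakPartial ω j (q n) x) (g x)) atTop
      (𝓝 (∫ x in ω, inner ℝ (weakPartial ω j u x) (g x))) := by
  have h1 : Integrable (fun x => (WithLp.toLp 2 (Pi.single j (g x)) : GradVal))
      (volume.restrict ω) := by
    refine hg.norm.mono' (aestronglyMeasurable_toLp_single j hg.aestronglyMeasurable)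
      (Eventually.of_forall fun x => ?_)
    rw [norm_toLp_single]
  have h2 := h _ h1
  simp only [inner_toLp_single, weakGrad_apply] at h2
  exact h2

theorem tendsto_setIntegral_inner_apply (hW : MeasurableSet W) (hWω : W ⊆ ω)
    {Y : ℕ → R2 → HessVal} {X : R2 → HessVal}
    (h : ∀ Φ, MemLp Φ 2 (volume.restrict ω) →
      Tendsto (fun n => ∫ x in ω, inner ℝ (Y n x) (Φ x)) atTop
        (𝓝 (∫ x in ω, inner ℝ (X x) (Φ x)))) (p : Fin 2 × Fin 2) {Φ : R2 → R3}
    (hΦ : MemLp Φ 2 (volume.restrict W)) :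
    Tendsto (fun n => ∫ x in W, inner ℝ (Y n x p) (Φ x)) atTop
      (𝓝 (∫ x in W, inner ℝ (X x p) (Φ x))) := by
  have hI := hΦ.indicator_restrict hW hWω
  have h1 : MemLp (fun x => (WithLp.toLp 2 (Pi.single p (W.indicator Φ x)) : HessVal)) 2
      (volume.restrict ω) := by
    refine hI.of_le (aestronglyMeasurable_toLp_single p hI.aestronglyMeasurable)
      (Eventually.of_forall fun x => ?_)
    rw [norm_toLp_single]
  have h2 := h _ h1
  simp only [inner_toLp_single] at h2
  simpa only [setIntegral_inner_indicator hW hWω (fun x => X x p),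
    setIntegral_inner_indicator hW hWω (fun x => Y _ x p)] using h2

theorem MemW1p.memLp_weakPartial {U : Set R2} {p : ℝ≥0∞} {f : R2 → R3} (h : MemW1p U p f)
    (i : Fin 2) : MemLp (weakPartial U i f) p (volume.restrict U) :=
  (memLp_piLp_iff.1 h.2.2) i

theorem eLpNorm_weakPartial_le_weakGrad (U : Set R2) (f : R2 → R3) (i : Fin 2) (μ : Measure R2) :
    eLpNorm (weakPartial U i f) 2 μ ≤ eLpNorm (weakGrad U f) 2 μ :=
  eLpNorm_mono fun x => PiLp.norm_apply_le (weakGrad U f x) i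

theorem eLpNorm_weakPartial_le_weakHess (U : Set R2) (f : R2 → R3) (i j : Fin 2)
    (μ : Measure R2) :
    eLpNorm (weakPartial U i (weakPartial U j f)) 2 μ ≤ eLpNorm (weakHess U f) 2 μ :=
  eLpNorm_mono fun x => PiLp.norm_apply_le (weakHess U f x) (i, j)

theorem MeasureTheory.MemLp.exists_ae_norm_le {f : R2 → R3} {μ : Measure R2} (h : MemLp f ∞ μ) :
    ∃ C, 0 ≤ C ∧ ∀ᵐ x ∂μ, ‖f x‖ ≤ C := by
  refine ⟨(eLpNormEssSup f μ).toReal, ENNReal.toReal_nonneg, ?_⟩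
  have hfin : eLpNormEssSup f μ ≠ ∞ := by
    rw [← eLpNorm_exponent_top]; exact h.2.ne
  filter_upwards [ae_le_eLpNormEssSup (f := f) (μ := μ)] with x hx
  rw [← toReal_enorm]
  exact ENNReal.toReal_mono hfin hx

end WeakLimits

/-! ### Uniform bound for the Hessians extended by zero -/

section HessianBound

variable {ω : Set R2} {b : ℝ → R2} {α β : ℝ}

theorem indicator_weakHess (U : Set R2) (f : R2 → R3) :
    U.indicator (weakHess U f) = weakHess U f := by
  rw [indicator_eq_self]
  intro x hx
  by_contra h
  exact hx (weakHess_eq_zero_of_notMem h)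

theorem memLp_weakHess_perforated (hω : IsLipschitzDomain ω) (M : CreaseMesh ω b α β)
    {v : R2 → R3} (hv : v ∈ relaxedAdmissible M) :
    MemLp (weakHess M.perforated v) 2 (volume.restrict ω) := by
  rw [← indicator_weakHess]
  exact hv.1.2.2.indicator_restrict (M.isOpen_perforated hω.1).measurableSet M.perforated_subset

theorem eLpNorm_weakHess_perforated_le (hω : IsLipschitzDomain ω) (M : CreaseMesh ω b α β)
    {v : R2 → R3} (hv : v ∈ relaxedAdmissible M) {c : ℝ} (hc : relaxedEnergy M v ≤ c) :
    eLpNorm (weakHess M.perforated v) 2 (volume.restrict ω) ≤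
      ENNReal.ofReal (2 * c) ^ (1 / 2 : ℝ) := by
  have hPm := (M.isOpen_perforated hω.1).measurableSet
  rw [← indicator_weakHess, eLpNorm_indicator_eq_eLpNorm_restrict hPm,
    Measure.restrict_restrict hPm, inter_eq_self_of_subset_left M.perforated_subset,
    eLpNorm_two_eq]
  exact ENNReal.rpow_le_rpow (lintegral_weakHess_sq_le hω M hv hc) (by norm_num)

end HessianBound

/-! ### Compactness -/

section Compactness

variable {ω : Set R2} {b : ℝ → R2} {α β : ℝ}

/-! ### Weak convergence of the deformations on sets away from the crease -/

section Local

variable {M : ℕ → CreaseMesh ω b α β} {v q w : ℕ → R2 → R3}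
  {A : ℕ → Finset R2 → (R2 →ᵃ[ℝ] R3)} {C : ℝ} {k : ℕ → ℕ} {u : R2 → R3} {W : Set R2}

theorem tendsto_setIntegral_inner_deformation (hω : IsLipschitzDomain ω)
    (hq : ∀ m, MemW1p ω ∞ (q m)) (hk : Tendsto k atTop atTop)
    (hqu : ∀ g : R2 → R3, Integrable g (volume.restrict ω) →
      Tendsto (fun n => ∫ x in ω, inner ℝ (q (k n) x) (g x)) atTop
        (𝓝 (∫ x in ω, inner ℝ (u x) (g x))))
    (hW : IsOpen W) (hWP : ∀ᶠ m in atTop, W ⊆ (M m).perforated) (hWω : W ⊆ ω)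
    (hz : TendstoZeroH1 W (fun m => q m - (M m).perforated.indicator (v m)))
    {Φ : R2 → R3} (hΦ : MemLp Φ 2 (volume.restrict W)) :
    Tendsto (fun n => ∫ x in W, inner ℝ (v (k n) x) (Φ x)) atTop
      (𝓝 (∫ x in W, inner ℝ (u x) (Φ x))) := by
  have hfin : IsFiniteMeasure (volume.restrict ω) := isFiniteMeasure_restrict.2 hω.volume_ne_top
  refine tendsto_setIntegral_inner_of_weakStar hω.volume_ne_top hW.measurableSet hWω hqu
    (r := fun n => q (k n) - (M (k n)).perforated.indicator (v (k n)))
    (fun n => (hq _).1.mono_exponent le_top) ?_ ?_ ?_ hΦ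
  · exact hk.eventually (hz.1.mono fun m hm => hm.1)
  · exact (tendsto_of_tendsto_of_tendsto_of_le_of_le tendsto_const_nhds hz.2
      (fun _ => zero_le) fun m => le_self_add).comp hk
  · filter_upwards [hk.eventually hWP] with n hn
    filter_upwards [ae_restrict_mem hW.measurableSet] with x hx
    rw [Pi.sub_apply, Pi.sub_apply, indicator_of_mem (hn hx), sub_sub_cancel]

/-- The gradient error is controlled through the weak gradient of the difference on `W`, so the
derivatives taken on three different open sets must first be identified almost everywhere on `W`. -/
theorem tendsto_setIntegral_inner_weakPartial (hω : IsLipschitzDomain ω)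
    (hv : ∀ m, v m ∈ relaxedAdmissible (M m))
    (hq : ∀ m, MemW1p ω ∞ (q m)) (hk : Tendsto k atTop atTop)
    (hqu : ∀ G : R2 → GradVal, Integrable G (volume.restrict ω) →
      Tendsto (fun n => ∫ x in ω, inner ℝ (weakGrad ω (q (k n)) x) (G x)) atTop
        (𝓝 (∫ x in ω, inner ℝ (weakGrad ω u x) (G x))))
    (hW : IsOpen W) (hWP : ∀ᶠ m in atTop, W ⊆ (M m).perforated) (hWω : W ⊆ ω)
    (hz : TendstoZeroH1 W (fun m => q m - (M m).perforated.indicator (v m))) (j : Fin 2)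
    {Φ : R2 → R3} (hΦ : MemLp Φ 2 (volume.restrict W)) :
    Tendsto (fun n => ∫ x in W, inner ℝ (weakPartial (M (k n)).perforated j (v (k n)) x) (Φ x))
      atTop (𝓝 (∫ x in W, inner ℝ (weakPartial ω j u x) (Φ x))) := by
  have hfin : IsFiniteMeasure (volume.restrict ω) := isFiniteMeasure_restrict.2 hω.volume_ne_top
  refine tendsto_setIntegral_inner_of_weakStar hω.volume_ne_top hW.measurableSet hWω
    (fun g hg => tendsto_integral_inner_weakPartial hqu j hg)
    (r := fun n => weakPartial W j (q (k n) - (M (k n)).perforated.indicator (v (k n))))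
    (fun n => ((hq _).memLp_weakPartial j).mono_exponent le_top) ?_ ?_ ?_ hΦ
  · exact hk.eventually (hz.1.mono fun m hm => hm.memLp_weakPartial j)
  · exact (tendsto_of_tendsto_of_tendsto_of_le_of_le tendsto_const_nhds hz.2
      (fun _ => zero_le) fun m =>
        (eLpNorm_weakPartial_le_weakGrad W _ j _).trans le_add_self).comp hk
  · filter_upwards [hk.eventually hWP] with n hn
    have hP := (M (k n)).isOpen_perforated hω.1
    have h1 : HasWeakPartial W j (q (k n)) (weakPartial ω j (q (k n))) :=
      (hasWeakPartial_weakPartial hω.1 ((hq _).2.1 j)).mono hWω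
    have h2 : HasWeakPartial W j ((M (k n)).perforated.indicator (v (k n)))
        (weakPartial (M (k n)).perforated j (v (k n))) := by
      refine (((hv _).1.hasWeakPartial hP j).mono hn).congr hW ?_ EventuallyEq.rfl
      filter_upwards [ae_restrict_mem hW.measurableSet] with x hx
      rw [indicator_of_mem (hn hx)]
    filter_upwards [weakPartial_ae_eq hW (h1.sub h2)] with x hx
    rw [Pi.sub_apply, hx, Pi.sub_apply, sub_sub_cancel]

end Local

/-- All limits are identified locally off the curve, where interpolants and deformations share their
weak limits. The Hessians converge weakly on the whole domain because they are extended by zero. -/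
theorem weakStarAccPt_mem_admissible (hω : IsLipschitzDomain ω)
    (harc : IsPiecewiseC1Arclength b α β)
    {M : ℕ → CreaseMesh ω b α β}
    (hmesh : Tendsto (fun m => (M m).meshSize) atTop (𝓝 0))
    {v : ℕ → R2 → R3} (hv : ∀ m, v m ∈ relaxedAdmissible (M m))
    {c : ℝ} (hc : ∀ m, relaxedEnergy (M m) (v m) ≤ c)
    {q w : ℕ → R2 → R3} (hq : ∀ m, MemW1p ω ∞ (q m))
    (hw : ∀ m, IsContRep (M m).perforated (v m) (w m))
    (hlip : ∀ m x y, segment ℝ x y ⊆ (M m).perforated → ‖w m x - w m y‖ ≤ 2 * ‖x - y‖)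
    (hz : ∀ W : Set R2, IsOpen W → IsCompact (closure W) → closure W ⊆ ω \ b '' Icc α β →
      TendstoZeroH1 W (fun m => q m - (M m).perforated.indicator (v m)))
    {u : R2 → R3} (hu : IsWeakStarAccPt ω q u) :
    u ∈ admissible ω (b '' Icc α β) ∧
      IsWeakL2AccPt ω (fun m => weakHess (M m).perforated (v m))
        (weakHess (ω \ b '' Icc α β) u) := by
  obtain ⟨huW, k₀, hk₀, hqu₀, hQu₀⟩ := hu
  have hfin : IsFiniteMeasure (volume.restrict ω) := isFiniteMeasure_restrict.2 hω.volume_ne_top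
  have hγ0 := harc.volume_image_eq_zero
  have hb := harc.2.1
  have hγ : IsCompact (b '' Icc α β) := isCompact_Icc.image_of_continuousOn hb
  set γ := b '' Icc α β with hγdef
  have hU : IsOpen (ω \ γ) := hω.1.sdiff hγ.isClosed
  have hUω : ω \ γ ⊆ ω := sdiff_subset
  -- The curve is a null set, so integrability and almost everywhere statements on the two domains
  -- may be exchanged.
  have hrestr : volume.restrict (ω \ γ) = volume.restrict ω :=
    Measure.restrict_congr_set (sdiff_null_ae_eq_self hγ0)
  have hP := fun m => (M m).isOpen_perforated hω.1
  -- a weak limit of the Hessians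
  set D : ℝ≥0∞ := ENNReal.ofReal (2 * c) ^ (1 / 2 : ℝ) with hD
  have hDtop : D ≠ ∞ := ENNReal.rpow_ne_top_of_nonneg (by norm_num) ENNReal.ofReal_ne_top
  have hYD := fun m => eLpNorm_weakHess_perforated_le hω (M m) (hv m) (hc m)
  obtain ⟨X, s, hX, hs, hXlim⟩ := exists_weak_limit hDtop
    (fun n => memLp_weakHess_perforated hω (M (k₀ n)) (hv _)) (fun n => hYD (k₀ n))
  -- A further subsequence keeps the weak-star limit `u` and adds the weak limit of the Hessians.
  set k : ℕ → ℕ := fun n => k₀ (s n) with hkdef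
  have hk : StrictMono k := hk₀.comp hs
  have hXp : ∀ p, MemLp (fun x => X x p) 2 (volume.restrict ω) := memLp_piLp_iff.1 hX
  have hpu : ∀ j, HasWeakPartial ω j u (weakPartial ω j u) := fun j =>
    hasWeakPartial_weakPartial hω.1 (huW.2.1 j)
  -- local data along a shifted subsequence
  have hlocal : ∀ W : Set R2, IsOpen W → IsCompact (closure W) → closure W ⊆ ω \ γ →
      ∃ N, (∀ n, W ⊆ (M (k (n + N))).perforated) ∧
        (∀ Φ, MemLp Φ 2 (volume.restrict W) →
          Tendsto (fun n => ∫ x in W, inner ℝ (v (k (n + N)) x) (Φ x)) atTop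
            (𝓝 (∫ x in W, inner ℝ (u x) (Φ x)))) ∧
        (∀ j Φ, MemLp Φ 2 (volume.restrict W) →
          Tendsto (fun n => ∫ x in W,
            inner ℝ (weakPartial (M (k (n + N))).perforated j (v (k (n + N))) x) (Φ x)) atTop
            (𝓝 (∫ x in W, inner ℝ (weakPartial ω j u x) (Φ x)))) ∧
        (∀ i j Φ, MemLp Φ 2 (volume.restrict W) →
          Tendsto (fun n => ∫ x in W, inner ℝ (weakPartial (M (k (n + N))).perforated i
            (weakPartial (M (k (n + N))).perforated j (v (k (n + N)))) x) (Φ x)) atTop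
            (𝓝 (∫ x in W, inner ℝ (X x (i, j)) (Φ x)))) := by
    intro W hW hWc hWω
    have hWP : ∀ᶠ m in atTop, W ⊆ (M m).perforated :=
      (eventually_hull_subset_perforated hω.1 hb M hmesh hWc hWω).mono fun m hm =>
        subset_closure.trans hm.1
    have hWω' : W ⊆ ω := (subset_closure.trans hWω).trans hUω
    -- Dropping finitely many members makes the inclusion in the perforated domain hold for every
    -- index, as the limit lemmas demand.
    obtain ⟨N, hN⟩ := eventually_atTop.1 (hk.tendsto_atTop.eventually hWP)
    refine ⟨N, fun n => hN _ (Nat.le_add_left _ _), fun Φ hΦ => ?_, fun j Φ hΦ => ?_,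
      fun i j Φ hΦ => ?_⟩
    · exact (tendsto_setIntegral_inner_deformation hω hq hk.tendsto_atTop
        (fun g hg => (hqu₀ g hg).comp hs.tendsto_atTop) hW hWP hWω' (hz W hW hWc hWω) hΦ).comp
        (tendsto_add_atTop_nat N)
    · exact (tendsto_setIntegral_inner_weakPartial hω hv hq hk.tendsto_atTop
        (fun g hg => (hQu₀ g hg).comp hs.tendsto_atTop) hW hWP hWω' (hz W hW hWc hWω) j hΦ).comp
        (tendsto_add_atTop_nat N)
    · exact (tendsto_setIntegral_inner_apply hW.measurableSet hWω' hXlim (i, j) hΦ).comp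
        (tendsto_add_atTop_nat N)
  -- second derivatives of the limit
  have hpX : ∀ i j, HasWeakPartial (ω \ γ) i (weakPartial ω j u) (fun x => X x (i, j)) := by
    intro i j
    have hpl := ((hpu j).mono hUω).2.1
    have hXl : LocallyIntegrableOn (fun x => X x (i, j)) (ω \ γ) := by
      have : IntegrableOn (fun x => X x (i, j)) ω := (hXp (i, j)).integrable (by norm_num)
      exact this.locallyIntegrableOn.mono_set hUω
    refine hasWeakPartial_iff.2 ⟨hpl, hXl, fun φ h1 h2 h3 => ?_⟩
    -- Each test function sees only a neighbourhood of its support that is compactly contained off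
    -- the curve, where the local convergence is available.
    obtain ⟨W, hW, hKW, hWU, hWc⟩ := exists_open_between_and_isCompact_closure h2 hU h3
    obtain ⟨N, hWP, -, hg, hH⟩ := hlocal W hW hWc hWU
    have hWU' : W ⊆ ω \ γ := subset_closure.trans hWU
    exact integral_smul_eq_of_weak_limit hWc.volume_ne_top_of_closure
      (fun n => ((hv _).1.hasWeakPartial₂ (hP _) i j).mono (hWP n)) (hg j) (hH i j)
      (hpl.mono_set hWU') (hXl.mono_set hWU') h1 h2 hKW
  have hpU : ∀ j, weakPartial (ω \ γ) j u =ᵐ[volume.restrict (ω \ γ)] weakPartial ω j u :=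
    fun j => weakPartial_mono_ae_eq hω.1 hU hUω (huW.2.1 j)
  have hpX' : ∀ i j, HasWeakPartial (ω \ γ) i (weakPartial (ω \ γ) j u) (fun x => X x (i, j)) :=
    fun i j => (hpX i j).congr hU (hpU j).symm EventuallyEq.rfl
  have hHX : weakHess (ω \ γ) u =ᵐ[volume.restrict ω] X := by
    rw [← hrestr]
    have : ∀ᵐ x ∂(volume.restrict (ω \ γ)), ∀ p : Fin 2 × Fin 2,
        weakPartial (ω \ γ) p.1 (weakPartial (ω \ γ) p.2 u) x = X x p :=
      ae_all_iff.2 fun p => weakPartial_ae_eq hU (hpX' p.1 p.2)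
    filter_upwards [this] with x hx
    ext1 p
    exact hx p
  have hHL : MemLp (weakHess (ω \ γ) u) 2 (volume.restrict ω) := hX.ae_eq hHX.symm
  -- the isometry constraint
  have hisoU : ∀ x ∈ ω \ γ, ∃ r > 0, ∀ᵐ y ∂(volume.restrict (Metric.ball x r)), ∀ i j,
      inner ℝ (weakPartial ω i u y) (weakPartial ω j u y) = if i = j then (1 : ℝ) else 0 := by
    intro x hx
    obtain ⟨r, hr, hrU⟩ := Metric.nhds_basis_closedBall.mem_iff.1 (hU.mem_nhds hx)
    refine ⟨r, hr, ?_⟩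
    set W := Metric.ball x r with hWdef
    have hcl : closure W ⊆ Metric.closedBall x r := Metric.closure_ball_subset_closedBall
    have hWc : IsCompact (closure W) :=
      (isCompact_closedBall x r).of_isClosed_subset isClosed_closure hcl
    obtain ⟨N, hWP, hvl, hg, hH⟩ := hlocal W Metric.isOpen_ball hWc (hcl.trans hrU)
    have hWU : W ⊆ ω \ γ := Metric.ball_subset_closedBall.trans hrU
    have hWω : W ⊆ ω := hWU.trans hUω
    have hle : volume.restrict W ≤ volume.restrict ω := Measure.restrict_mono_set volume hWω
    have hvw : ∀ n, v (k (n + N)) =ᵐ[volume.restrict W] w (k (n + N)) := fun n =>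
      ae_restrict_of_ae_restrict_of_subset (hWP n) (hw _).2
    choose Cp hCp0 hCp using fun i => (huW.memLp_weakPartial i).exists_ae_norm_le
    have hfinW : IsFiniteMeasure (volume.restrict W) :=
      isFiniteMeasure_restrict.2 measure_ball_lt_top.ne
    -- Balls are convex, so the bound along segments is a genuine Lipschitz bound with constant 2.
    -- The continuous representatives replace the deformations, since Lipschitz continuity concerns
    -- every point.
    refine inner_eq_of_weak_limit (u := u) (w := fun n => w (k (n + N))) (L := 2) (D := D)
      (C := Cp 0 + Cp 1)
      (g := fun n j => weakPartial (M (k (n + N))).perforated j (v (k (n + N))))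
      (H := fun n i j => weakPartial (M (k (n + N))).perforated i
        (weakPartial (M (k (n + N))).perforated j (v (k (n + N)))))
      (X := fun i j x => X x (i, j)) Metric.isOpen_ball Metric.isBounded_ball zero_le_two
      (fun n y hy y' hy' => hlip _ y y'
        (((convex_ball x r).segment_subset hy hy').trans (hWP n)))
      (fun n i => (((hv _).1.hasWeakPartial (hP _) i).mono (hWP n)).congr Metric.isOpen_ball
        (hvw n) EventuallyEq.rfl)
      (fun n i j => ((hv _).1.hasWeakPartial₂ (hP _) i j).mono (hWP n))
      (fun n => ae_restrict_of_ae_restrict_of_subset (hWP n) (hv _).2.1)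
      hDtop
      (fun n i j => ((hv _).1.memLp_weakHess i j).mono_measure
        (Measure.restrict_mono_set volume (hWP n)))
      (fun n i j => (eLpNorm_weakPartial_le_weakHess _ _ i j _).trans
        ((eLpNorm_mono_measure _ hle).trans (hYD _)))
      ((huW.1.mono_measure hle).mono_exponent le_top)
      (fun i => (hpu i).mono hWω) (fun i j => (hpX i j).mono hWU)
      (add_nonneg (hCp0 0) (hCp0 1)) (fun i => ?_) (fun Φ hΦ => ?_) hg hH
    · filter_upwards [ae_restrict_of_ae_restrict_of_subset hWω (hCp i)] with y hy
      refine hy.trans ?_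
      fin_cases i
      · exact le_add_of_nonneg_right (hCp0 1)
      · exact le_add_of_nonneg_left (hCp0 0)
    · refine (hvl Φ hΦ).congr fun n => integral_congr_ae ?_
      filter_upwards [hvw n] with y hy
      rw [hy]
  have hiso : IsIsometric ω u := by
    unfold IsIsometric
    rw [← hrestr, ae_restrict_iff' hU.measurableSet, ae_iff]
    -- The exceptional set is null near each point off the curve, hence null.
    refine measure_null_of_locally_null _ fun x hx => ?_
    simp only [mem_ofPred_eq, Classical.not_imp] at hx
    obtain ⟨r, hr, hball⟩ := hisoU x hx.1
    rw [ae_restrict_iff' measurableSet_ball, ae_iff] at hball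
    refine ⟨_, inter_mem_nhdsWithin _ (Metric.ball_mem_nhds x hr), measure_mono_null ?_ hball⟩
    rintro y ⟨hy, hyr⟩
    simp only [mem_ofPred_eq, Classical.not_imp] at hy ⊢
    exact ⟨hyr, hy.2⟩
  have hW12 : MemW1p (ω \ γ) 2 u := by
    refine ⟨?_, fun j => ⟨_, (hpu j).mono hUω⟩, ?_⟩
    · rw [hrestr]
      exact huW.1.mono_exponent le_top
    · rw [memLp_piLp_iff]
      intro j
      refine MemLp.ae_eq (hpU j).symm ?_
      rw [hrestr]
      exact (huW.memLp_weakPartial j).mono_exponent le_top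
  refine ⟨⟨⟨hW12, fun i j => ⟨_, hpX' i j⟩, ?_⟩, huW, hiso⟩, hHL, k, hk, fun Φ hΦ => ?_⟩
  · rw [hrestr]; exact hHL
  · have : ∫ x in ω, inner ℝ (weakHess (ω \ γ) u x) (Φ x) = ∫ x in ω, inner ℝ (X x) (Φ x) := by
      apply integral_congr_ae
      filter_upwards [hHX] with x hx
      rw [hx]
    rw [this]
    exact hXlim Φ hΦ

end Compactness

/-! ### The compactness theorem -/

theorem proposition2p1 (ω ω₁ ω₂ : Set R2) (b : ℝ → R2) (α β : ℝ)
    (hω : IsCreasedDomain ω ω₁ ω₂ b α β)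
    (M : ℕ → CreaseMesh ω b α β)
    (κ : ℝ) (hreg : ∀ m, (M m).ShapeRegular κ)
    (hmesh : Tendsto (fun m => (M m).meshSize) atTop (𝓝 0))
    (v : ℕ → R2 → R3) (hv : ∀ m, v m ∈ relaxedAdmissible (M m))
    (c : ℝ) (hc : ∀ m, relaxedEnergy (M m) (v m) ≤ c) :
    ∃ vt : ℕ → R2 → R3,
      (∀ m, IsNodalInterpolant (M m) (v m) (vt m)) ∧
      (∀ m, MemW1p ω ∞ (vt m)) ∧
      (∃ c' : ℝ, ∀ m,
        eLpNorm (weakGrad ω (vt m)) ∞ (volume.restrict ω) ≤ ENNReal.ofReal c') ∧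
      (∀ ω' : Set R2, IsOpen ω' → IsCompact (closure ω') → closure ω' ⊆ ω \ b '' Icc α β →
        TendstoZeroH1 ω' (fun m => vt m - (M m).perforated.indicator (v m))) ∧
      ∀ u : R2 → R3, IsWeakStarAccPt ω vt u →
        u ∈ admissible ω (b '' Icc α β) ∧
        IsWeakL2AccPt ω (fun m => weakHess (M m).perforated (v m))
          (weakHess (ω \ b '' Icc α β) u) := by
  obtain ⟨q, w, A, C, hC, h⟩ :=
    exists_interpolantData_seq hω.lipschitz hω.inside M hreg hmesh hv
  have hW := fun m =>
    Triangulation.memW1p_of_piecewiseAffine hω.lipschitz.1 hC (h m).eqOn (h m).bound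
  have hz := fun (W : Set R2) (hW : IsOpen W) (hWc : IsCompact (closure W))
      (hWω : closure W ⊆ ω \ b '' Icc α β) =>
    tendstoZeroH1_interpolants hω.lipschitz hω.arc.2.1 M hreg hmesh hv hc hC h hW hWc hWω
  exact ⟨q, fun m => (h m).isNodalInterpolant, fun m => (hW m).1, ⟨2 * C, fun m => (hW m).2⟩, hz,
    fun u hu => weakStarAccPt_mem_admissible hω.lipschitz hω.arc hmesh hv hc (fun m => (hW m).1)
      (fun m => (h m).contRep) (fun m => (h m).lip) hz hu⟩
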